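/- Fix $\delta>0$ and consider $\partial_t u+6u\partial_x u+\partial_x^3u+\delta(\partial_x^2u+\partial_x^4u)=0$. For $k$ in an open subset $K$ of $(0,\infty)$ let $U^{(0)}(\cdot;k)$ be a smooth family of mean-zero $1$-periodic profiles with speeds $c^{(0)}(k)$ and constants $\bar q^{(0)}(k)$ (also smooth in $k$), i.e. $$-c^{(0)}U^{(0)}+3(U^{(0)})^2+k^2U^{(0)\prime\prime}+\delta\big(kU^{(0)\prime}+k^3U^{(0)\prime\prime\prime}\big)=\bar q^{(0)},$$ and put $U(k,M)=M+U^{(0)}(\cdot;k)$, $c(k,M)=6M+c^{(0)}(k)$; $\langle\cdot\rangle$ is the mean over a period. Fix $k_\star\in K$ and $M_\star\in\mathbb R$; a subscript $\star$ means evaluation at $(k_\star,M_\star)$. For $\nu\in\mathbb C$ let $$\mathcal L_\nu f=k_\star(\partial_x+\nu)\big((6U_\star-c_\star)f\big)+k_\star^3(\partial_x+\nu)^3f+\delta\big(k_\star^2(\partial_x+\nu)^2f+k_\star^4(\partial_x+\nu)^4f\big)$$ on smooth $1$-periodic complex functions. Call $\lambda$ a Bloch eigenvalue at $\nu$, with eigenvector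 $\hat u\neq0$, if $\mathcal L_\nu\hat u=-\lambda\hat u$. The wave is spectrally stable if $\mathrm{Re}\,\lambda\le0$ for all Bloch eigenvalues at all $\nu\in i\mathbb R$. Assume that the kernel of $\mathcal L_0$ is spanned by $U_\star'$. The first-order Whitham system is $$\partial_Tk+\partial_X(k\,c(k,M))=0,\qquad \partial_TM+\partial_X\langle3U^2\rangle=0,\qquad \langle 3U^2\rangle=\bar q^{(0)}(k)+3M^2 .$$ Linearize it about $(k_\star,M_\star)$ in the frame moving at speed $c_\star$. Call $(\Lambda;\kappa,m)\in\mathbb C^3$ a Whitham mode if the plane waves $e^{\nu(X+\Lambda T)}(\kappa,m)$ are solutions for all $\nu\in\mathbb C$; call $\Lambda$ a root of the dispersion relation if it has a mode with $(\kappa,m)\ne(0,0)$. Let $\Delta(k)=(c^{(0)}+k\,c^{(0)\prime})^2+24\,k\,\bar q^{(0)\prime}$ and $$D(\Lambda)=\begin{pmatrix}\Lambda+k_\star\partial_kc_\star&k_\star\partial_Mc_\star\\ \partial_k\langle3U^2\rangle_\star&\Lambda-c_\star+\partial_M\langle3U^2\rangle_\star\end{pmatrix}.$$ Then: 1. $(\Lambda;\kappa,m)$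 is a Whitham mode iff $D(\Lambda)(\kappa,m)^T=0$, and $\Lambda$ is a root of the dispersion relation iff $\det D(\Lambda)=0$, where (with $c^{(0)},\bar q^{(0)}$ and their derivatives taken at $k_\star$) $\det D(\Lambda)=\Lambda^2+(k_\star c^{(0)\prime}-c^{(0)})\Lambda-(k_\star c^{(0)}c^{(0)\prime}+6k_\star\bar q^{(0)\prime})$. There are two distinct real roots (the Whitham system is hyperbolic) iff $\Delta(k_\star)>0$. 2. Let $\lambda(\nu),\hat u(\nu)$, for $\nu\in i\mathbb R\setminus\{0\}$ small, be Bloch eigenvalues and eigenvectors with $\lambda=\nu\lambda_0+O(\nu^2)$, $\hat u=\hat u_0+\nu\hat u_1+O(\nu^2)$ (uniformly with derivatives up to order $4$), $\hat u_0,\hat u_1$ smooth and $\hat u_0\ne0$. Then there are $\kappa\neq0$, $m$, $k_1\in\mathbb C$ such that $\hat u_0=\frac{\kappa}{k_\star}U_\star'$, $\hat u_1=\kappa\,\partial_kU_\star+m\,\partial_MU_\star+\frac{k_1}{k_\star}U_\star'$, and $(\lambda_0/k_\star;\kappa,m)$ is a Whitham mode. 3. There are $r>0$ and $C$ such that $|\det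 D(\lambda/(\nu k_\star))|\le C|\nu|$ for every Bloch eigenvalue $\lambda$ at $\nu\in\mathbb C$ with $0<|\nu|<r$, $|\lambda|<r$. Conversely, for every root $\Lambda$ of the dispersion relation and every $\varepsilon>0$, for all sufficiently small $\nu\in\mathbb C$ there is a Bloch eigenvalue $\lambda$ at $\nu$ with $|\lambda-\nu k_\star\Lambda|\le\varepsilon|\nu|$. 4. If $\Delta(k_\star)\neq0$, there is $r>0$ such that each root $\Lambda$ of the dispersion relation has a branch $\lambda_\Lambda(\nu)$ of Bloch eigenvalues, analytic in $|\nu|<r$, with eigenvectors $\hat u_\Lambda(\nu)$, and a Whitham mode $(\Lambda;\kappa,m)$ with $\kappa\ne0$, such that for $|\nu|<r$ $$\lambda_\Lambda(\nu)=\nu k_\star\Lambda+O(\nu^2),\qquad \hat u_\Lambda(\nu)=\tfrac{\kappa}{k_\star}U_\star'+\nu\big(\kappa\,\partial_kU_\star+m\,\partial_MU_\star\big)+O(\nu^2),$$ uniformly with derivatives up to order $4$. Every Bloch eigenvalue $\lambda$ at $\nu$ with $|\nu|<r$, $|\lambda|<r$ lies on one of these branches, and its eigenvectors are multiples of $\hat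 u_\Lambda(\nu)$. 5. If the wave is spectrally stable, all roots of the dispersion relation are real and $\Delta(k_\star)\ge0$. Thus, outside the degenerate case $\Delta(k_\star)=0$, hyperbolicity $\Delta(k_\star)>0$ is necessary for spectral stability. -/

import Mathlib

open scoped ContDiff Topology

noncomputable section

/-- A smooth one-parameter family, indexed by the wavenumber `k` in an open set `K ⊆ (0, ∞)`, of
mean-zero 1-periodic travelling wave profiles `V k = U⁽⁰⁾(·; k)` of
`∂ₜu + 6u∂ₓu + ∂ₓ³u + δ(∂ₓ²u + ∂ₓ⁴u) = 0`, with speed `c₀ k` and integration constant `q₀ k`.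
The profile equation is the once integrated travelling wave equation, in the variable
`y = k (x - c₀ t)`. -/
structure WaveTrains (δ : ℝ) where
  K : Set ℝ
  V : ℝ → ℝ → ℝ
  c₀ : ℝ → ℝ
  q₀ : ℝ → ℝ
  isOpen_K : IsOpen K
  pos : ∀ k ∈ K, 0 < k
  smooth_V : ContDiffOn ℝ ∞ (Function.uncurry V) (K ×ˢ (Set.univ : Set ℝ))
  smooth_c₀ : ContDiffOn ℝ ∞ c₀ K
  smooth_q₀ : ContDiffOn ℝ ∞ q₀ K
  periodic : ∀ k ∈ K, Function.Periodic (V k) 1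
  mean_zero : ∀ k ∈ K, ∫ y in (0 : ℝ)..1, V k y = 0
  profile : ∀ k ∈ K, ∀ y : ℝ,
    -c₀ k * V k y + 3 * V k y ^ 2 + k ^ 2 * iteratedDeriv 2 (V k) y
      + δ * (k * deriv (V k) y + k ^ 3 * iteratedDeriv 3 (V k) y) = q₀ k

namespace WaveTrains

variable {δ : ℝ} (W : WaveTrains δ)

/-- The wave train `U(y; k, M) = M + U⁽⁰⁾(y; k)` of wavenumber `k` and mean `M`. -/
def U (k M y : ℝ) : ℝ := M + W.V k y

/-- Its speed `c(k, M) = 6 M + c⁽⁰⁾(k)`. -/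
def c (k M : ℝ) : ℝ := 6 * M + W.c₀ k

/-- The average `⟨3U²⟩` over one period. -/
def avgFlux (k M : ℝ) : ℝ := ∫ y in (0 : ℝ)..1, 3 * W.U k M y ^ 2

/-- `U(·; k, M)` does solve the profile equation with speed `c(k, M)`; the integration constant is
`q` with `q⁽⁰⁾ = q + c M - 3 M²`. -/
theorem profile_U (k M y : ℝ) (hk : k ∈ W.K) :
    -W.c k M * W.U k M y + 3 * W.U k M y ^ 2 + k ^ 2 * iteratedDeriv 2 (W.U k M) y
      + δ * (k * deriv (W.U k M) y + k ^ 3 * iteratedDeriv 3 (W.U k M) y)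
      = W.q₀ k - W.c k M * M + 3 * M ^ 2 := by
  have h1 : deriv (W.U k M) = deriv (W.V k) := by
    funext z
    exact deriv_const_add' M (f := W.V k) ▸ rfl
  have h2 : iteratedDeriv 2 (W.U k M) = iteratedDeriv 2 (W.V k) := by
    rw [iteratedDeriv_succ', iteratedDeriv_succ' (f := W.V k), h1]
  have h3 : iteratedDeriv 3 (W.U k M) = iteratedDeriv 3 (W.V k) := by
    rw [iteratedDeriv_succ', iteratedDeriv_succ' (f := W.V k), h1]
  have h := W.profile k hk y
  rw [h1, h2, h3]
  simp only [U, c]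
  linear_combination h

/-! ### The Bloch problem -/

/-- The operator `d/dx + ν`. -/
def blochD (ν : ℂ) (f : ℝ → ℂ) : ℝ → ℂ := fun x => deriv f x + ν * f x

/-- The Bloch transformed linearized operator about `U(·; k, M)`:
`k (d/dx + ν)((6U - c) f) + k³ (d/dx + ν)³ f + δ (k² (d/dx + ν)² f + k⁴ (d/dx + ν)⁴ f)`. -/
def blochOp (k M : ℝ) (ν : ℂ) (f : ℝ → ℂ) (x : ℝ) : ℂ :=
  k * blochD ν (fun y => ((6 * W.U k M y - W.c k M : ℝ) : ℂ) * f y) x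
    + k ^ 3 * (blochD ν)^[3] f x
    + δ * (k ^ 2 * (blochD ν)^[2] f x + k ^ 4 * (blochD ν)^[4] f x)

/-- `e^{lam t + ν x} f(x)`, with `f` a nonzero 1-periodic function, solves the equation linearized
about the wave train (in the co-moving frame, `x` being the phase variable). -/
def IsBlochEigenpair (k M : ℝ) (ν lam : ℂ) (f : ℝ → ℂ) : Prop :=
  ContDiff ℝ ∞ f ∧ Function.Periodic f 1 ∧ f ≠ 0 ∧ ∀ x, W.blochOp k M ν f x = -lam * f x

/-- The kernel of the linearized operator on 1-periodic functions is spanned by `U'`. (As constants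
are mapped to multiples of `U'`, this forces `U' ≠ 0`, so the kernel is then one dimensional.) -/
def KernelSpannedByTranslation (k M : ℝ) : Prop :=
  ∀ f : ℝ → ℂ, ContDiff ℝ ∞ f → Function.Periodic f 1 → (∀ x, W.blochOp k M 0 f x = 0) →
    ∃ a : ℂ, ∀ x, f x = a * ((deriv (W.U k M) x : ℝ) : ℂ)

/-- Spectral stability: no Bloch eigenvalue, for any Bloch parameter `ν ∈ iℝ`, has positive real
part. -/
def SpectrallyStable (k M : ℝ) : Prop :=
  ∀ (ξ : ℝ) (lam : ℂ) (f : ℝ → ℂ), W.IsBlochEigenpair k M (Complex.I * ξ) lam f → lam.re ≤ 0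

/-- `κ U'/k`, the general form of an element of the kernel. -/
def mode₀ (k M : ℝ) (κ : ℂ) (x : ℝ) : ℂ := κ / k * ((deriv (W.U k M) x : ℝ) : ℂ)

/-- `κ ∂ₖU + m ∂_M U`. -/
def mode₁ (k M : ℝ) (κ m : ℂ) (x : ℝ) : ℂ :=
  κ * ((deriv (fun k' => W.U k' M x) k : ℝ) : ℂ) + m * ((deriv (fun M' => W.U k M' x) M : ℝ) : ℂ)

/-! ### The first-order Whitham system `∂_T k + ∂_X (k c) = 0`, `∂_T M + ∂_X ⟨3U²⟩ = 0` -/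

/-- Jacobian matrix of the fluxes `(k c(k, M), ⟨3U²⟩(k, M))`. -/
def whithamJacobian (k M : ℝ) : Matrix (Fin 2) (Fin 2) ℝ :=
  !![deriv (fun k' => k' * W.c k' M) k, deriv (fun M' => k * W.c k M') M;
     deriv (fun k' => W.avgFlux k' M) k, deriv (fun M' => W.avgFlux k M') M]

/-- `(w₁, w₂)(X, T)` solves the Whitham system linearized about the constant state `(k, M)`, written
in the frame moving at speed `c(k, M)`: `∂_T w + (J - c) ∂_X w = 0`. -/
def IsLinWhithamSolution (k M : ℝ) (w₁ w₂ : ℝ → ℝ → ℂ) : Prop :=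
  Differentiable ℝ (Function.uncurry w₁) ∧ Differentiable ℝ (Function.uncurry w₂) ∧
  ∀ X T : ℝ,
    deriv (fun t => w₁ X t) T
      + ((W.whithamJacobian k M 0 0 - W.c k M : ℝ) : ℂ) * deriv (fun x => w₁ x T) X
      + (W.whithamJacobian k M 0 1 : ℂ) * deriv (fun x => w₂ x T) X = 0 ∧
    deriv (fun t => w₂ X t) T
      + (W.whithamJacobian k M 1 0 : ℂ) * deriv (fun x => w₁ x T) X
      + ((W.whithamJacobian k M 1 1 - W.c k M : ℝ) : ℂ) * deriv (fun x => w₂ x T) X = 0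

/-- The plane waves `e^{ν (X + Λ T)} (κ, m)` solve the linearized Whitham system. -/
def IsWhithamMode (k M : ℝ) (Λ κ m : ℂ) : Prop :=
  ∀ ν : ℂ, W.IsLinWhithamSolution k M
    (fun X T => Complex.exp (ν * (X + Λ * T)) * κ) (fun X T => Complex.exp (ν * (X + Λ * T)) * m)

/-- `Λ` satisfies the dispersion relation of the linearized Whitham system: there is a nontrivial
plane wave. -/
def IsDispersionRoot (k M : ℝ) (Λ : ℂ) : Prop :=
  ∃ κ m : ℂ, (κ ≠ 0 ∨ m ≠ 0) ∧ W.IsWhithamMode k M Λ κ m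

/-- The matrix of the two mode problem for `(κ, m)`. -/
def dispersionMatrix (k M : ℝ) (Λ : ℂ) : Matrix (Fin 2) (Fin 2) ℂ :=
  !![Λ + k * ((deriv (fun k' => W.c k' M) k : ℝ) : ℂ), k * ((deriv (fun M' => W.c k M') M : ℝ) : ℂ);
     ((deriv (fun k' => W.avgFlux k' M) k : ℝ) : ℂ),
       Λ - (W.c k M : ℂ) + ((deriv (fun M' => W.avgFlux k M') M : ℝ) : ℂ)]

/-- `Δ(k) = (c⁽⁰⁾ + k c⁽⁰⁾')² + 24 k q⁽⁰⁾'`. -/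
def Delta (k : ℝ) : ℝ := (W.c₀ k + k * deriv W.c₀ k) ^ 2 + 24 * k * deriv W.q₀ k

end WaveTrains

end

/-! The argument is a Lyapunov–Schmidt reduction, carried out by bordering. The profile equation
supplies three identities for L_ν = L₀ + νL₁ + ν²L₂ + …. Differentiating in y gives L₀U' = 0.
Galilean invariance appears as L₀1 = 6kU'. Differentiating in k gives L₀(k∂ₖU) + L₁U' = k²c₀'U'. The
mean annihilates the range of L₀ because the equation is a conservation law. Hence U' + ν k∂ₖU + s·1
solves (L_ν + λ)f = 0 up to second order as soon as s = -(λ + νk²c₀')/(6k), and this choice is the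
first row of the Whitham dispersion matrix. The mean of the second order residual is the second row:
⟨(6U - c)∂ₖU⟩ = q₀' and ⟨6U - c⟩ = -c₀.

To make this rigorous, add the rank one operator ℓ(·)e, with e = 1 and ℓ(U') = 1 after
identification. The bordered operator is invertible at the origin, hence nearby, and a singular
parameter must be a zero of the scalar function `reduced`; conversely, a zero yields a kernel vector
`sol` when this is nonzero. The residual has only terms of order at least two, so with λ = νμ a
factor ν² splits off (`reduced_mul`). The quotient `scaledReduced` is analytic near ν = 0, and its
value there is `charPoly` μ = -(k/6) det D(μ/k) (`scaledReduced_zero`, `charPoly_eq_det`).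

Everything local follows from this function. A cubic remainder estimate confines all small
eigenvalues (`exists_bound`). The maximum principle for its reciprocal produces a zero near every
root, even a double one (`eventually_exists_near_root`). The implicit function theorem gives
analytic branches at simple roots (`exists_branch`). Prescribed expansions are treated by comparing
powers of ν (`first_order_expansion`). Instability for a nonreal root comes from following it along
the half of iℝ on which Re(νkΛ) > 0.

The differential operators become bounded on continuous periodic functions through f = S⁴g with S =
(d/dx + 1)⁻¹: each derivative up to order four of f is a bounded operator applied to g, and orders
below four are compact (`hasDerivAt_T`, `isCompactOperator_T`). As δk⁴ ≠ 0, the Fredholm alternative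
and elliptic bootstrapping apply. -/

noncomputable section

/-! ### Lyapunov–Schmidt reduction of an operator pencil by bordering -/

/-- A quartic operator pencil `A₀ + ν A₁ + ν² A₂ + ν³ A₃ + ν⁴ A₄ + λ R` whose value at the origin
has the kernel `span φ` and the range `ker mean`, together with the first order data of a
two-dimensional generalized kernel `span {φ, e}`. -/
structure BifurcationData (E : Type*) [NormedAddCommGroup E] [NormedSpace ℂ E] where
  A₀ : E →L[ℂ] E
  A₁ : E →L[ℂ] E
  A₂ : E →L[ℂ] E
  A₃ : E →L[ℂ] E
  A₄ : E →L[ℂ] E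
  R : E →L[ℂ] E
  φ : E
  ψ : E
  e : E
  mean : E →L[ℂ] ℂ
  ℓ : E →L[ℂ] ℂ
  a : ℂ
  b : ℂ
  p₀ : ℂ
  p₁ : ℂ
  a_ne : a ≠ 0
  isUnit : IsUnit (A₀ + ℓ.smulRight e)
  mean_A₀ : ∀ g, mean (A₀ g) = 0
  mean_e : mean e = 1
  ℓ_φ : ℓ φ = 1
  A₀_φ : A₀ φ = 0
  A₀_e : A₀ e = a • R φ
  A₀_ψ : A₀ ψ + A₁ φ = b • R φ
  mean_second : mean (A₁ ψ + A₂ φ) = p₀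
  mean_A₁_e : mean (A₁ e) = p₁
  mean_R_ψ : mean (R ψ) = 0
  mean_R_e : mean (R e) = 1

namespace BifurcationData

open Filter Asymptotics

variable {E : Type*} [NormedAddCommGroup E] [NormedSpace ℂ E] (B : BifurcationData E)

/-- The operator pencil, at `p = (ν, λ)`. -/
def A (p : ℂ × ℂ) : E →L[ℂ] E :=
  B.A₀ + p.1 • B.A₁ + p.1 ^ 2 • B.A₂ + p.1 ^ 3 • B.A₃ + p.1 ^ 4 • B.A₄ + p.2 • B.R

/-- The pencil plus a rank one operator which makes it invertible near the origin. -/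
def bordered (p : ℂ × ℂ) : E →L[ℂ] E := B.A p + B.ℓ.smulRight B.e

/-- The inverse of the bordered pencil. -/
def inv (p : ℂ × ℂ) : E →L[ℂ] E := Ring.inverse (B.bordered p)

/-- The coefficient of `e` in the first order approximation, for `λ = ν μ`. -/
def slope (μ : ℂ) : ℂ := -(μ + B.b) / B.a

/-- The coefficient of `e` in the homogeneous first order approximation. -/
def coeff (p : ℂ × ℂ) : ℂ := -(p.2 + p.1 * B.b) / B.a

/-- First order approximation to a kernel element of the pencil. -/
def approx (p : ℂ × ℂ) : E := B.φ + (p.1 • B.ψ + B.coeff p • B.e)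

/-- The second order residual of `approx`. -/
def residual (p : ℂ × ℂ) : E :=
  p.1 • B.A₁ (p.1 • B.ψ + B.coeff p • B.e)
    + (p.1 ^ 2 • B.A₂ (B.approx p) + p.1 ^ 3 • B.A₃ (B.approx p) + p.1 ^ 4 • B.A₄ (B.approx p))
    + p.2 • B.R (p.1 • B.ψ + B.coeff p • B.e)

/-- The residual at `(ν, ν μ)` divided by `ν²`. -/
def scaledResidual (q : ℂ × ℂ) : E :=
  B.A₁ (B.ψ + B.slope q.2 • B.e)
    + (B.A₂ (B.φ + q.1 • (B.ψ + B.slope q.2 • B.e))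
      + q.1 • B.A₃ (B.φ + q.1 • (B.ψ + B.slope q.2 • B.e))
      + q.1 ^ 2 • B.A₄ (B.φ + q.1 • (B.ψ + B.slope q.2 • B.e)))
    + q.2 • B.R (B.ψ + B.slope q.2 • B.e)

/-- The corrected approximation. -/
def sol (p : ℂ × ℂ) : E := B.approx p - B.inv p (B.residual p)

/-- The reduced function, whose zeros are the singular parameters of the pencil. -/
def reduced (p : ℂ × ℂ) : ℂ := B.ℓ (B.inv p (B.residual p))

/-- The reduced function at `(ν, ν μ)` divided by `ν²`. -/
def scaledReduced (q : ℂ × ℂ) : ℂ := B.ℓ (B.inv (q.1, q.1 * q.2) (B.scaledResidual q))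

/-- The leading quadratic form of `reduced`. -/
def quadForm (p : ℂ × ℂ) : ℂ := B.p₀ * p.1 ^ 2 + (B.p₁ * p.1 + p.2) * B.coeff p

/-- The reduced function at leading order: the characteristic polynomial of the modulation. -/
def charPoly (μ : ℂ) : ℂ := B.p₀ + (B.p₁ + μ) * B.slope μ

theorem coeff_mul (ν μ : ℂ) : B.coeff (ν, ν * μ) = ν * B.slope μ := by
  simp only [coeff, slope]; ring

theorem quadForm_mul (ν μ : ℂ) : B.quadForm (ν, ν * μ) = ν ^ 2 * B.charPoly μ := by
  simp only [quadForm, charPoly, coeff_mul]; ring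

/-- Every term of the residual has degree at least two in (ν, λ). On the blow-up λ = νμ the factor
ν² can therefore be removed without creating a singularity. -/
theorem residual_mul (ν μ : ℂ) :
    B.residual (ν, ν * μ) = ν ^ 2 • B.scaledResidual (ν, μ) := by
  have h : ν • B.ψ + B.coeff (ν, ν * μ) • B.e = ν • (B.ψ + B.slope μ • B.e) := by
    rw [coeff_mul, smul_add, smul_smul]
  simp only [residual, scaledResidual, approx]
  rw [h]
  simp only [map_smul]
  module

theorem reduced_mul (ν μ : ℂ) : B.reduced (ν, ν * μ) = ν ^ 2 * B.scaledReduced (ν, μ) := by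
  simp only [reduced, scaledReduced, residual_mul, map_smul, smul_eq_mul]

/-- The first order terms add up to (λ + νb + a · coeff) Rφ, and `coeff` is the value that cancels
this bracket. -/
theorem A_approx (p : ℂ × ℂ) : B.A p (B.approx p) = B.residual p := by
  have h1 : B.A₀ B.ψ = B.b • B.R B.φ - B.A₁ B.φ := eq_sub_of_add_eq B.A₀_ψ
  have h2 : B.coeff p * B.a = -(p.2 + p.1 * B.b) := by
    simp only [coeff]; field_simp [B.a_ne]
  have h3 : (B.coeff p * B.a + (p.2 + p.1 * B.b)) • B.R B.φ = 0 := by rw [h2]; simp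
  have h4 : B.A p (B.approx p)
      = B.residual p + (B.coeff p * B.a + (p.2 + p.1 * B.b)) • B.R B.φ := by
    simp only [A, residual, approx, add_apply, smul_apply,
      map_add, map_smul, B.A₀_φ, B.A₀_e, h1]
    module
  rw [h4, h3, add_zero]

theorem bordered_inv {p : ℂ × ℂ} (hp : IsUnit (B.bordered p)) (x : E) :
    B.bordered p (B.inv p x) = x := by
  have := Ring.mul_inverse_cancel _ hp
  exact DFunLike.congr_fun this x

theorem inv_bordered {p : ℂ × ℂ} (hp : IsUnit (B.bordered p)) (x : E) :
    B.inv p (B.bordered p x) = x := by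
  have := Ring.inverse_mul_cancel _ hp
  exact DFunLike.congr_fun this x

theorem bordered_apply (p : ℂ × ℂ) (x : E) : B.bordered p x = B.A p x + B.ℓ x • B.e := rfl

/-- If x is the bordered inverse of the residual, then A x + ℓ(x)e is the residual, so subtracting x
from `approx` leaves exactly ℓ(x)e. -/
theorem A_sol {p : ℂ × ℂ} (hp : IsUnit (B.bordered p)) :
    B.A p (B.sol p) = B.reduced p • B.e := by
  have h := B.bordered_inv hp (B.residual p)
  rw [bordered_apply] at h
  rw [sol, map_sub, A_approx, reduced]
  exact sub_eq_of_eq_add' h.symm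

/-- A kernel element is determined by its value under `ℓ`. -/
theorem eq_smul_of_A_eq_zero {p : ℂ × ℂ} (hp : IsUnit (B.bordered p)) {g : E}
    (hg : B.A p g = 0) : g = B.ℓ g • B.inv p B.e := by
  have h := B.inv_bordered hp g
  rw [bordered_apply, hg, zero_add, map_smul] at h
  exact h.symm

theorem ℓ_ne_zero_of_A_eq_zero {p : ℂ × ℂ} (hp : IsUnit (B.bordered p)) {g : E}
    (hg : B.A p g = 0) (hg0 : g ≠ 0) : B.ℓ g ≠ 0 := by
  intro h
  apply hg0
  rw [B.eq_smul_of_A_eq_zero hp hg, h, zero_smul]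

theorem exists_smul_of_A_eq_zero {p : ℂ × ℂ} (hp : IsUnit (B.bordered p)) {g h : E}
    (hg : B.A p g = 0) (hh : B.A p h = 0) (hh0 : h ≠ 0) : ∃ c : ℂ, g = c • h := by
  have h0 := B.ℓ_ne_zero_of_A_eq_zero hp hh hh0
  refine ⟨B.ℓ g / B.ℓ h, ?_⟩
  have h1 := B.eq_smul_of_A_eq_zero hp hg
  have h2 := congrArg (fun x => (B.ℓ g / B.ℓ h) • x) (B.eq_smul_of_A_eq_zero hp hh)
  simp only [smul_smul, div_mul_cancel₀ _ h0] at h2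
  rw [h2]
  exact h1

/-- A kernel element is a nonzero multiple of `inv` e, which forces ℓ(`inv` e) = 1. Applying ℓ to
`sol` = (`reduced` + ℓ(`sol`)) · `inv` e then leaves `reduced` = 0. -/
theorem reduced_eq_zero {p : ℂ × ℂ} (hp : IsUnit (B.bordered p)) {g : E}
    (hg : B.A p g = 0) (hg0 : g ≠ 0) : B.reduced p = 0 := by
  have h0 := B.ℓ_ne_zero_of_A_eq_zero hp hg hg0
  have h1 : B.ℓ (B.inv p B.e) = 1 := by
    have h := congrArg B.ℓ (B.eq_smul_of_A_eq_zero hp hg)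
    rw [map_smul, smul_eq_mul] at h
    exact mul_left_cancel₀ h0 (by rw [← h, mul_one])
  have h2 := B.inv_bordered hp (B.sol p)
  rw [bordered_apply, A_sol B hp, ← add_smul, map_smul] at h2
  have h3 := congrArg B.ℓ h2
  rw [map_smul, h1, smul_eq_mul, mul_one] at h3
  exact add_eq_right.mp h3

theorem bordered_zero : B.bordered 0 = B.A₀ + B.ℓ.smulRight B.e := by
  simp [bordered, A]

theorem isUnit_bordered_zero : IsUnit (B.bordered 0) := B.bordered_zero ▸ B.isUnit

/-- The mean of A₀y + ℓ(y)e = x is ℓ(y), since the mean kills the range of A₀. The arbitrary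
functional ℓ thus turns into the solvability condition at the origin. -/
theorem ℓ_inv_zero (x : E) : B.ℓ (B.inv 0 x) = B.mean x := by
  have h := congrArg B.mean (B.bordered_inv B.isUnit_bordered_zero x)
  rw [bordered_zero] at h
  simpa [B.mean_A₀, B.mean_e] using h

theorem mean_scaledResidual (μ : ℂ) : B.mean (B.scaledResidual (0, μ)) = B.charPoly μ := by
  have h := B.mean_second
  rw [map_add] at h
  simp [scaledResidual, charPoly, B.mean_A₁_e, B.mean_R_ψ, B.mean_R_e, ← h]
  ring

/-- This is the link between the exact problem and the modulation equations: the blown-up function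
extends to ν = 0 with the characteristic polynomial as its value. -/
theorem scaledReduced_zero (μ : ℂ) : B.scaledReduced (0, μ) = B.charPoly μ := by
  have h : ((0 : ℂ), (0 : ℂ) * μ) = 0 := by simp
  simp only [scaledReduced]
  rw [h, ℓ_inv_zero, mean_scaledResidual]

theorem contDiff_bordered : ContDiff ℂ ω B.bordered := by
  unfold bordered A
  fun_prop

theorem contDiff_coeff : ContDiff ℂ ω B.coeff := by
  unfold coeff
  fun_prop

theorem contDiff_slope : ContDiff ℂ ω B.slope := by
  unfold slope
  fun_prop

theorem contDiff_approx : ContDiff ℂ ω B.approx := by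
  have := B.contDiff_coeff
  unfold approx
  fun_prop

theorem contDiff_scaledResidual : ContDiff ℂ ω B.scaledResidual := by
  have := B.contDiff_slope
  unfold scaledResidual
  fun_prop

theorem contDiff_charPoly : ContDiff ℂ ω B.charPoly := by
  have := B.contDiff_slope
  unfold charPoly
  fun_prop

theorem fst_isBigO : (fun p : ℂ × ℂ => p.1) =O[𝓝 0] fun p : ℂ × ℂ => p :=
  IsBigO.of_bound 1 (Eventually.of_forall fun p => by simpa using norm_fst_le p)

theorem snd_isBigO : (fun p : ℂ × ℂ => p.2) =O[𝓝 0] fun p : ℂ × ℂ => p :=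
  IsBigO.of_bound 1 (Eventually.of_forall fun p => by simpa using norm_snd_le p)

theorem coeff_isBigO : B.coeff =O[𝓝 0] fun p : ℂ × ℂ => p := by
  have h : B.coeff = fun p : ℂ × ℂ => -(1 / B.a) * p.2 + -(B.b / B.a) * p.1 := by
    funext p; simp only [coeff]; ring
  rw [h]
  exact (snd_isBigO.const_mul_left _).add (fst_isBigO.const_mul_left _)

variable [CompleteSpace E]

theorem eventually_isUnit : ∀ᶠ p in 𝓝 (0 : ℂ × ℂ), IsUnit (B.bordered p) :=
  B.contDiff_bordered.continuous.continuousAt.eventually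
    (Units.isOpen.mem_nhds B.isUnit_bordered_zero)

theorem contDiffAt_inv {p : ℂ × ℂ} (hp : IsUnit (B.bordered p)) : ContDiffAt ℂ ω B.inv p := by
  obtain ⟨u, hu⟩ := hp
  have h := contDiffAt_ringInverse ℂ (n := ω) u
  rw [hu] at h
  exact h.comp p B.contDiff_bordered.contDiffAt

theorem inv_sub_isBigO : (fun p => B.inv p - B.inv 0) =O[𝓝 0] fun p : ℂ × ℂ => p := by
  have h := (B.contDiffAt_inv B.isUnit_bordered_zero).differentiableAt (by simp)
  simpa using h.isBigO_sub

end BifurcationData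

end

/-! ### Estimates for small singular parameters and existence near every root -/

noncomputable section

namespace BifurcationData

open Filter Asymptotics

variable {E : Type*} [NormedAddCommGroup E] [NormedSpace ℂ E] (B : BifurcationData E)

theorem residual_isBigO : B.residual =O[𝓝 0] fun p : ℂ × ℂ => ‖p‖ ^ 2 := by
  have h1 := fst_isBigO.norm_right
  have h2 := snd_isBigO.norm_right
  have h3 := B.coeff_isBigO.norm_right
  have hc (x : E) : (fun _ : ℂ × ℂ => x) =O[𝓝 0] fun _ => (1 : ℝ) := isBigO_const_one ℝ x _
  have hn : (fun p : ℂ × ℂ => ‖p‖) =O[𝓝 0] fun _ => (1 : ℝ) :=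
    (continuous_norm.continuousAt (x := (0 : ℂ × ℂ))).isBigO_one ℝ
  have h4 : (fun p : ℂ × ℂ => p.1 • B.ψ + B.coeff p • B.e) =O[𝓝 0] fun p => ‖p‖ := by
    simpa using (h1.smul (hc B.ψ)).add (h3.smul (hc B.e))
  have h5 : B.approx =O[𝓝 0] fun _ => (1 : ℝ) :=
    (B.contDiff_approx.continuous.continuousAt).isBigO_one ℝ
  have hA (T : E →L[ℂ] E) (f : ℂ × ℂ → E) : (fun p => T (f p)) =O[𝓝 0] f :=
    T.isBigO_comp f _
  have h6 : (fun p : ℂ × ℂ => p.1 ^ 3) =O[𝓝 0] fun p => ‖p‖ ^ 2 := by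
    simpa [pow_succ] using (h1.pow 2).mul (h1.trans hn)
  have h7 : (fun p : ℂ × ℂ => p.1 ^ 4) =O[𝓝 0] fun p => ‖p‖ ^ 2 := by
    simpa [pow_succ] using h6.mul (h1.trans hn)
  refine IsBigO.add (IsBigO.add ?_ (IsBigO.add (IsBigO.add ?_ ?_) ?_)) ?_
  · simpa [sq] using h1.smul ((hA B.A₁ _).trans h4)
  · simpa using (h1.pow 2).smul ((hA B.A₂ _).trans h5)
  · simpa using h6.smul ((hA B.A₃ _).trans h5)
  · simpa using h7.smul ((hA B.A₄ _).trans h5)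
  · simpa [sq] using h2.smul ((hA B.R _).trans h4)

/-- The normalizations of `mean` on A₁ψ + A₂φ, A₁e, Rψ and Re identify the whole quadratic part, so
only cubic terms are left. -/
theorem mean_residual_sub_isBigO :
    (fun p => B.mean (B.residual p) - B.quadForm p) =O[𝓝 0] fun p : ℂ × ℂ => ‖p‖ ^ 3 := by
  have h1 := fst_isBigO.norm_right
  have h3 := B.coeff_isBigO.norm_right
  have hc (x : E) : (fun _ : ℂ × ℂ => x) =O[𝓝 0] fun _ => (1 : ℝ) := isBigO_const_one ℝ x _
  have hn : (fun p : ℂ × ℂ => ‖p‖) =O[𝓝 0] fun _ => (1 : ℝ) :=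
    (continuous_norm.continuousAt (x := (0 : ℂ × ℂ))).isBigO_one ℝ
  have h4 : (fun p : ℂ × ℂ => p.1 • B.ψ + B.coeff p • B.e) =O[𝓝 0] fun p => ‖p‖ := by
    simpa using (h1.smul (hc B.ψ)).add (h3.smul (hc B.e))
  have h5 : B.approx =O[𝓝 0] fun _ => (1 : ℝ) :=
    (B.contDiff_approx.continuous.continuousAt).isBigO_one ℝ
  have hA (T : E →L[ℂ] E) (f : ℂ × ℂ → E) : (fun p => B.mean (T (f p))) =O[𝓝 0] f :=
    (B.mean ∘L T).isBigO_comp f _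
  have h7 : (fun p : ℂ × ℂ => p.1 ^ 4) =O[𝓝 0] fun p => ‖p‖ ^ 3 := by
    simpa [pow_succ] using (h1.pow 3).mul (h1.trans hn)
  have heq : (fun p => B.mean (B.residual p) - B.quadForm p) = fun p : ℂ × ℂ =>
      p.1 ^ 2 * B.mean (B.A₂ (p.1 • B.ψ + B.coeff p • B.e))
        + p.1 ^ 3 * B.mean (B.A₃ (B.approx p)) + p.1 ^ 4 * B.mean (B.A₄ (B.approx p)) := by
    funext p
    have h := B.mean_second
    rw [map_add] at h
    simp only [residual, quadForm, map_add, map_smul, smul_eq_mul, B.mean_A₁_e, B.mean_R_ψ,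
      B.mean_R_e, ← h]
    rw [show B.approx p = B.φ + (p.1 • B.ψ + B.coeff p • B.e) from rfl]
    simp only [map_add, map_smul, smul_eq_mul]
    ring
  rw [heq]
  refine IsBigO.add (IsBigO.add ?_ ?_) ?_
  · simpa [pow_succ] using (h1.pow 2).mul ((hA B.A₂ _).trans h4)
  · simpa using (h1.pow 3).mul ((hA B.A₃ _).trans h5)
  · simpa using h7.mul ((hA B.A₄ _).trans h5)

theorem scaledReduced_eq_zero {ν μ : ℂ} (hν : ν ≠ 0) (hp : IsUnit (B.bordered (ν, ν * μ))) {g : E}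
    (hg : B.A (ν, ν * μ) g = 0) (hg0 : g ≠ 0) : B.scaledReduced (ν, μ) = 0 := by
  have h := B.reduced_eq_zero hp hg hg0
  rw [reduced_mul] at h
  exact (mul_eq_zero.mp h).resolve_left (pow_ne_zero 2 hν)

/-- The second root of `charPoly`. -/
theorem charPoly_eq {μ₀ : ℂ} (h : B.charPoly μ₀ = 0) (μ : ℂ) :
    B.charPoly μ = -((μ - μ₀) * (μ - (-μ₀ - B.p₁ - B.b))) / B.a := by
  have : B.charPoly μ = B.charPoly μ - B.charPoly μ₀ := by rw [h, sub_zero]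
  rw [this]
  simp only [charPoly, slope]
  ring

theorem isUnit_bordered_zero_mul (μ : ℂ) : IsUnit (B.bordered ((0 : ℂ), (0 : ℂ) * μ)) := by
  have : ((0 : ℂ), (0 : ℂ) * μ) = 0 := by simp
  rw [this]; exact B.isUnit_bordered_zero

/-- The solution at `(ν, ν μ)`, expanded. -/
theorem sol_mul (ν μ : ℂ) : B.sol (ν, ν * μ)
    = B.φ + ν • (B.ψ + B.slope μ • B.e)
      - ν ^ 2 • B.inv (ν, ν * μ) (B.scaledResidual (ν, μ)) := by
  rw [sol, residual_mul, map_smul, approx, coeff_mul]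
  module

theorem φ_ne_zero : B.φ ≠ 0 := fun h => by simpa [h] using B.ℓ_φ

theorem A_sol_mul {ν μ : ℂ} (hp : IsUnit (B.bordered (ν, ν * μ)))
    (h : B.scaledReduced (ν, μ) = 0) : B.A (ν, ν * μ) (B.sol (ν, ν * μ)) = 0 := by
  rw [B.A_sol hp, reduced_mul, h, mul_zero, zero_smul]

variable [CompleteSpace E]

/-- Replacing the inverse at p by the inverse at the origin costs O(|p|) on a residual of size
O(|p|²). At the origin `ℓ_inv_zero` turns ℓ into the mean. -/
theorem reduced_sub_isBigO :
    (fun p => B.reduced p - B.quadForm p) =O[𝓝 0] fun p : ℂ × ℂ => ‖p‖ ^ 3 := by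
  have h1 : (fun p => B.ℓ ((B.inv p - B.inv 0) (B.residual p))) =O[𝓝 0]
      fun p : ℂ × ℂ => ‖p‖ ^ 3 := by
    have h2 : (fun p => B.ℓ ((B.inv p - B.inv 0) (B.residual p))) =O[𝓝 0]
        fun p => ‖B.inv p - B.inv 0‖ * ‖B.residual p‖ := by
      refine (B.ℓ.isBigO_comp _ _).trans (IsBigO.of_bound 1 (Eventually.of_forall fun p => ?_))
      simpa using (B.inv p - B.inv 0).le_opNorm (B.residual p)
    refine h2.trans ?_
    have h3 := B.inv_sub_isBigO.norm_norm.mul B.residual_isBigO.norm_left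
    refine h3.congr_right fun p => ?_
    ring
  refine (h1.add B.mean_residual_sub_isBigO).congr_left fun p => ?_
  rw [← ℓ_inv_zero, reduced]
  simp

/-- A priori bounds for the small singular parameters of the pencil. -/
theorem exists_bound : ∃ r > 0, ∃ C : ℝ, ∀ (ν lam : ℂ) (g : E), ‖ν‖ < r → ‖lam‖ < r →
    B.A (ν, lam) g = 0 → g ≠ 0 →
      ‖lam‖ ≤ C * ‖ν‖ ∧ (ν ≠ 0 → ‖B.charPoly (lam / ν)‖ ≤ C * ‖ν‖) := by
  obtain ⟨c, hc, hbound⟩ := B.reduced_sub_isBigO.exists_pos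
  rw [IsBigOWith] at hbound
  obtain ⟨r, hr, hball⟩ := Metric.eventually_nhds_iff.mp (hbound.and B.eventually_isUnit)
  set N := ‖B.a‖ with hN
  have hNpos : 0 < N := norm_pos_iff.mpr B.a_ne
  set c₁ := ‖B.b + B.p₁‖ + ‖B.a * B.p₀ - B.p₁ * B.b‖ with hc₁
  have hc₁0 : 0 ≤ c₁ := by positivity
  -- The constant exceeds 2c₁, and the radius below makes |a| c |λ| ≤ 1/2. Half of |λ|² then absorbs
  -- the cubic remainder, and the rest yields |λ| ≤ 2c₁|ν|.
  set K := 2 * c₁ + 1 with hK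
  set r' := min r (1 / (2 * (N * c))) with hr'
  have hr'0 : 0 < r' := lt_min hr (by positivity)
  have hquad : ∀ (ν lam : ℂ) (g : E), ‖ν‖ < r' → ‖lam‖ < r' → B.A (ν, lam) g = 0 → g ≠ 0 →
      ‖B.quadForm (ν, lam)‖ ≤ c * max ‖ν‖ ‖lam‖ ^ 3 := by
    intro ν lam g hν hlam hg hg0
    have hd : dist (ν, lam) (0 : ℂ × ℂ) < r := by
      rw [dist_zero_right, Prod.norm_mk]
      exact max_lt (hν.trans_le (min_le_left _ _)) (hlam.trans_le (min_le_left _ _))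
    obtain ⟨h1, h2⟩ := hball hd
    rw [B.reduced_eq_zero h2 hg hg0] at h1
    simpa [Prod.norm_mk, abs_of_nonneg (le_max_of_le_left (norm_nonneg ν))] using h1
  have hle : ∀ (ν lam : ℂ) (g : E), ‖ν‖ < r' → ‖lam‖ < r' → B.A (ν, lam) g = 0 → g ≠ 0 →
      ‖lam‖ ≤ K * ‖ν‖ := by
    intro ν lam g hν hlam hg hg0
    by_contra! hlt
    have h1 := hquad ν lam g hν hlam hg hg0
    have hνl : ‖ν‖ ≤ ‖lam‖ := by nlinarith [norm_nonneg ν]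
    rw [max_eq_right hνl] at h1
    have hpos : 0 < ‖lam‖ := by nlinarith [norm_nonneg ν]
    -- Multiplying `quadForm` by a makes it monic in λ up to sign, and λ² can be solved for.
    have h2 : lam ^ 2 = -(B.a * B.quadForm (ν, lam)) - (B.b + B.p₁) * (ν * lam)
        + (B.a * B.p₀ - B.p₁ * B.b) * (ν * ν) := by
      simp only [quadForm, coeff]
      field_simp [B.a_ne]
      ring
    have h3 : ‖lam‖ ^ 2 ≤ N * (c * ‖lam‖ ^ 3) + c₁ * (‖ν‖ * ‖lam‖) := by
      rw [← norm_pow, h2]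
      refine (norm_add_le _ _).trans ?_
      refine (add_le_add_left (norm_sub_le _ _) _).trans ?_
      rw [norm_neg, norm_mul, norm_mul, norm_mul, norm_mul, norm_mul, ← hN, hc₁]
      have := mul_le_mul_of_nonneg_left h1 hNpos.le
      have h4 : ‖ν‖ * ‖ν‖ ≤ ‖ν‖ * ‖lam‖ := mul_le_mul_of_nonneg_left hνl (norm_nonneg _)
      have := mul_le_mul_of_nonneg_left h4 (norm_nonneg (B.a * B.p₀ - B.p₁ * B.b))
      linarith
    have h5 : ‖lam‖ * (N * c) ≤ 1 / 2 := by
      have : ‖lam‖ ≤ 1 / (2 * (N * c)) := (hlam.trans_le (min_le_right _ _)).le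
      rw [le_div_iff₀ (by positivity)] at this
      linarith
    have h6 : ‖lam‖ ≤ (‖lam‖ * (N * c)) * ‖lam‖ + c₁ * ‖ν‖ := by
      have : ‖lam‖ * ‖lam‖ ≤ ‖lam‖ * ((‖lam‖ * (N * c)) * ‖lam‖ + c₁ * ‖ν‖) := by
        nlinarith
      exact le_of_mul_le_mul_left this hpos
    have h7 := mul_le_mul_of_nonneg_right h5 hpos.le
    nlinarith [norm_nonneg ν]
  refine ⟨r', hr'0, max K (c * K ^ 3), fun ν lam g hν hlam hg hg0 => ⟨?_, fun hν0 => ?_⟩⟩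
  · exact (hle ν lam g hν hlam hg hg0).trans
      (mul_le_mul_of_nonneg_right (le_max_left _ _) (norm_nonneg _))
  · have h1 := hquad ν lam g hν hlam hg hg0
    have h2 := hle ν lam g hν hlam hg hg0
    have h3 : max ‖ν‖ ‖lam‖ ≤ K * ‖ν‖ := max_le (by nlinarith [norm_nonneg ν]) h2
    -- Once λ = O(ν) is known, the error is O(ν³), while the quadratic form is ν² times `charPoly`
    -- (λ/ν).
    have h4 : lam = ν * (lam / ν) := by field_simp
    rw [h4, quadForm_mul, ← h4, norm_mul, norm_pow] at h1
    have hpos : 0 < ‖ν‖ := norm_pos_iff.mpr hν0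
    have h5 : max ‖ν‖ ‖lam‖ ^ 3 ≤ (K * ‖ν‖) ^ 3 :=
      pow_le_pow_left₀ (le_max_of_le_left (norm_nonneg _)) h3 3
    have h6 : ‖ν‖ ^ 2 * ‖B.charPoly (lam / ν)‖ ≤ ‖ν‖ ^ 2 * (c * K ^ 3 * ‖ν‖) := by
      refine h1.trans ((mul_le_mul_of_nonneg_left h5 hc.le).trans_eq ?_)
      ring
    exact (le_of_mul_le_mul_left h6 (by positivity)).trans
      (mul_le_mul_of_nonneg_right (le_max_right _ _) (norm_nonneg _))

theorem contDiffAt_inv_mul {q : ℂ × ℂ} (hq : IsUnit (B.bordered (q.1, q.1 * q.2))) :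
    ContDiffAt ℂ ω (fun q : ℂ × ℂ => B.inv (q.1, q.1 * q.2)) q := by
  have h : ContDiffAt ℂ ω (fun q : ℂ × ℂ => (q.1, q.1 * q.2)) q := by fun_prop
  exact ContDiffAt.comp (g := B.inv) q (B.contDiffAt_inv hq) h

theorem contDiffAt_scaledReduced {q : ℂ × ℂ} (hq : IsUnit (B.bordered (q.1, q.1 * q.2))) :
    ContDiffAt ℂ ω B.scaledReduced q :=
  B.ℓ.contDiff.contDiffAt.comp q
    ((B.contDiffAt_inv_mul hq).clm_apply B.contDiff_scaledResidual.contDiffAt)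

theorem eventually_isUnit_mul (μ : ℂ) :
    ∀ᶠ q in 𝓝 ((0 : ℂ), μ), IsUnit (B.bordered (q.1, q.1 * q.2)) := by
  have h : Continuous fun q : ℂ × ℂ => B.bordered (q.1, q.1 * q.2) := by
    have := B.contDiff_bordered.continuous
    fun_prop
  exact h.continuousAt.eventually (Units.isOpen.mem_nhds (B.isUnit_bordered_zero_mul μ))

theorem contDiffAt_correction {q : ℂ × ℂ} (hq : IsUnit (B.bordered (q.1, q.1 * q.2))) :
    ContDiffAt ℂ ω (fun q : ℂ × ℂ => B.inv (q.1, q.1 * q.2) (B.scaledResidual q)) q :=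
  (B.contDiffAt_inv_mul hq).clm_apply B.contDiff_scaledResidual.contDiffAt

/-- At ν = 0 the corrected approximation is φ, and it depends continuously on (ν, μ). -/
theorem eventually_sol_ne_zero (μ : ℂ) :
    ∀ᶠ q in 𝓝 ((0 : ℂ), μ), B.sol (q.1, q.1 * q.2) ≠ 0 := by
  have h1 := (B.contDiffAt_correction (q := (0, μ)) (B.isUnit_bordered_zero_mul μ)).continuousAt
  have h2 : ContinuousAt (fun q : ℂ × ℂ => B.sol (q.1, q.1 * q.2)) (0, μ) := by
    have h3 := B.contDiff_slope.continuous
    have h4 : ContinuousAt (fun q : ℂ × ℂ => B.φ + q.1 • (B.ψ + B.slope q.2 • B.e)) (0, μ) := by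
      fun_prop
    have h5 : ContinuousAt (fun q : ℂ × ℂ => q.1 ^ 2) (0, μ) := by fun_prop
    refine (h4.sub (h5.smul h1)).congr (Eventually.of_forall fun q => ?_)
    simp [sol_mul]
  refine h2.eventually_ne ?_
  rw [sol_mul]
  simpa using B.φ_ne_zero

/-- Every root of `charPoly` is a limit of singular parameters. -/
theorem eventually_exists_near_root {μ₀ : ℂ} (h₀ : B.charPoly μ₀ = 0) {ε : ℝ} (hε : 0 < ε) :
    ∀ᶠ ν : ℂ in 𝓝 0, ∃ (lam : ℂ) (g : E), g ≠ 0 ∧ B.A (ν, lam) g = 0 ∧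
      ‖lam - ν * μ₀‖ ≤ ε * ‖ν‖ := by
  set μ₁ := -μ₀ - B.p₁ - B.b with hμ₁
  set d := ‖μ₁ - μ₀‖ with hd
  -- The radius avoids the distance d to the other root, so both factors of `charPoly` are bounded
  -- below on the circle. For a double root d = 0 and nothing is lost.
  obtain ⟨ρ, hρ0, hρε, hρd⟩ : ∃ ρ : ℝ, 0 < ρ ∧ ρ ≤ ε ∧ ρ ≠ d := by
    by_cases h : ε = d
    · exact ⟨ε / 2, by linarith, by linarith, by rw [← h]; linarith⟩
    · exact ⟨ε, hε, le_rfl, h⟩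
  have hN : 0 < ‖B.a‖ := norm_pos_iff.mpr B.a_ne
  set c := ρ * |ρ - d| / ‖B.a‖ with hc
  have hc0 : 0 < c := by
    have : 0 < |ρ - d| := abs_pos.mpr (sub_ne_zero.mpr hρd)
    positivity
  have hsphere : ∀ z ∈ Metric.sphere μ₀ ρ, c ≤ ‖B.charPoly z‖ := by
    intro z hz
    rw [mem_sphere_iff_norm] at hz
    rw [B.charPoly_eq h₀, norm_div, norm_neg, norm_mul, hz, hc]
    have : |ρ - d| ≤ ‖z - μ₁‖ := by
      have := abs_norm_sub_norm_le (z - μ₀) (μ₁ - μ₀)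
      rwa [hz, sub_sub_sub_cancel_right] at this
    gcongr
  -- Compactness of the disc turns the convergence at each (0, μ) into a bound that is uniform in μ.
  have htube : ∀ᶠ ν in 𝓝 (0 : ℂ), ∀ μ ∈ Metric.closedBall μ₀ ρ,
      ‖B.scaledReduced (ν, μ) - B.charPoly μ‖ < c / 4 ∧ IsUnit (B.bordered (ν, ν * μ)) ∧
        B.sol (ν, ν * μ) ≠ 0 := by
    refine (isCompact_closedBall μ₀ ρ).eventually_forall_of_forall_eventually fun μ _ => ?_
    refine Eventually.and ?_ ((B.eventually_isUnit_mul μ).and (B.eventually_sol_ne_zero μ))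
    have h1 : ContinuousAt (fun q : ℂ × ℂ => ‖B.scaledReduced q - B.charPoly q.2‖) (0, μ) := by
      have h2 := (B.contDiffAt_scaledReduced (q := (0, μ))
        (B.isUnit_bordered_zero_mul μ)).continuousAt
      have h3 := B.contDiff_charPoly.continuous
      fun_prop
    refine h1.eventually (gt_mem_nhds ?_)
    simpa [scaledReduced_zero] using hc0
  filter_upwards [htube] with ν hν
  -- Without a zero in the disc the reciprocal is holomorphic, of modulus at most (3c/4)⁻¹ on the
  -- circle and hence at the centre. But at the centre `charPoly` vanishes, so the function is
  -- smaller than c/4 there.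
  obtain ⟨μ, hμ, hzero⟩ : ∃ μ ∈ Metric.closedBall μ₀ ρ, B.scaledReduced (ν, μ) = 0 := by
    by_contra! hne
    have hdiff : ∀ μ ∈ Metric.closedBall μ₀ ρ,
        DifferentiableAt ℂ (fun μ => (B.scaledReduced (ν, μ))⁻¹) μ := by
      intro μ hμ
      have h1 := (B.contDiffAt_scaledReduced (q := (ν, μ)) (hν μ hμ).2.1).differentiableAt (by simp)
      have h2 : DifferentiableAt ℂ (fun μ => B.scaledReduced (ν, μ)) μ :=
        h1.comp μ (by fun_prop)
      exact h2.inv (hne μ hμ)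
    have hcl : DiffContOnCl ℂ (fun μ => (B.scaledReduced (ν, μ))⁻¹) (Metric.ball μ₀ ρ) := by
      refine DifferentiableOn.diffContOnCl fun μ hμ => ?_
      rw [closure_ball μ₀ hρ0.ne'] at hμ
      exact (hdiff μ hμ).differentiableWithinAt
    have h1 : ‖(B.scaledReduced (ν, μ₀))⁻¹‖ ≤ (3 * c / 4)⁻¹ := by
      refine Complex.norm_le_of_forall_mem_frontier_norm_le Metric.isBounded_ball hcl
        (fun z hz => ?_) (subset_closure (Metric.mem_ball_self hρ0))
      rw [frontier_ball μ₀ hρ0.ne'] at hz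
      rw [norm_inv]
      refine inv_anti₀ (by positivity) ?_
      have h2 := (hν z (Metric.sphere_subset_closedBall hz)).1
      have h3 := hsphere z hz
      have h4 := norm_sub_norm_le (B.charPoly z) (B.charPoly z - B.scaledReduced (ν, z))
      rw [sub_sub_cancel, norm_sub_rev (B.charPoly z) (B.scaledReduced _)] at h4
      linarith
    have h2 := (hν μ₀ (Metric.mem_closedBall_self hρ0.le)).1
    rw [h₀, sub_zero] at h2
    have h3 : 0 < ‖B.scaledReduced (ν, μ₀)‖ :=
      norm_pos_iff.mpr (hne μ₀ (Metric.mem_closedBall_self hρ0.le))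
    rw [norm_inv] at h1
    have h4 := (inv_le_inv₀ h3 (by positivity)).mp h1
    linarith
  refine ⟨ν * μ, B.sol (ν, ν * μ), (hν μ hμ).2.2, B.A_sol_mul (hν μ hμ).2.1 hzero, ?_⟩
  rw [← mul_sub, norm_mul, mul_comm]
  rw [mem_closedBall_iff_norm] at hμ
  exact mul_le_mul_of_nonneg_right (hμ.trans hρε) (norm_nonneg _)

end BifurcationData

end

/-! ### Analytic branches at simple roots -/

noncomputable section

namespace BifurcationData

open Filter Asymptotics

variable {E : Type*} [NormedAddCommGroup E] [NormedSpace ℂ E] (B : BifurcationData E)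

theorem hasDerivAt_charPoly {μ₀ : ℂ} (h₀ : B.charPoly μ₀ = 0) :
    HasDerivAt B.charPoly (-(μ₀ - (-μ₀ - B.p₁ - B.b)) / B.a) μ₀ := by
  have h1 : B.charPoly = fun μ => -((μ - μ₀) * (μ - (-μ₀ - B.p₁ - B.b))) / B.a :=
    funext (B.charPoly_eq h₀)
  rw [h1]
  have h2 := ((hasDerivAt_id μ₀).sub_const μ₀).mul
    ((hasDerivAt_id μ₀).sub_const (-μ₀ - B.p₁ - B.b))
  convert! h2.neg.div_const B.a using 1
  simp

variable [CompleteSpace E]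

/-- A simple root of `charPoly` is the origin of an analytic branch of singular parameters. -/
theorem exists_branch {μ₀ : ℂ} (h₀ : B.charPoly μ₀ = 0) (hsimple : μ₀ ≠ -μ₀ - B.p₁ - B.b) :
    ∃ r > 0, ∃ (C : ℝ) (mu : ℂ → ℂ) (G : ℂ → E), AnalyticOnNhd ℂ mu (Metric.ball 0 r) ∧
      (∀ ν : ℂ, ‖ν‖ < r → G ν ≠ 0 ∧ B.A (ν, ν * mu ν) (G ν) = 0 ∧ ‖mu ν - μ₀‖ ≤ C * ‖ν‖ ∧
        ‖G ν - (B.φ + ν • (B.ψ + B.slope μ₀ • B.e))‖ ≤ C * ‖ν‖ ^ 2) ∧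
      (∀ (ν μ : ℂ) (g : E), ν ≠ 0 → ‖ν‖ < r → ‖μ - μ₀‖ < r → B.A (ν, ν * μ) g = 0 → g ≠ 0 →
        μ = mu ν) := by
  have cdf : ContDiffAt ℂ ω B.scaledReduced (0, μ₀) :=
    B.contDiffAt_scaledReduced (B.isUnit_bordered_zero_mul μ₀)
  have hω : (ω : WithTop ℕ∞) ≠ 0 := by simp
  -- The partial derivative in μ is that of `charPoly`, because the two functions agree on ν = 0.
  -- Simplicity of the root makes it nonzero.
  have hval : (fderiv ℂ B.scaledReduced (0, μ₀) ∘L .inr ℂ ℂ ℂ) 1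
      = -(μ₀ - (-μ₀ - B.p₁ - B.b)) / B.a := by
    have h1 : HasFDerivAt (fun μ : ℂ => B.scaledReduced (0, μ))
        (fderiv ℂ B.scaledReduced (0, μ₀) ∘L .inr ℂ ℂ ℂ) μ₀ :=
      (cdf.differentiableAt (by simp)).hasFDerivAt.comp μ₀ (hasFDerivAt_prodMk_right 0 μ₀)
    simp only [scaledReduced_zero] at h1
    exact h1.hasDerivAt.unique (B.hasDerivAt_charPoly h₀)
  have hinv : (fderiv ℂ B.scaledReduced (0, μ₀) ∘L .inr ℂ ℂ ℂ).IsInvertible := by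
    have hne : (fderiv ℂ B.scaledReduced (0, μ₀) ∘L .inr ℂ ℂ ℂ) 1 ≠ 0 := by
      rw [hval]
      exact div_ne_zero (neg_ne_zero.mpr (sub_ne_zero.mpr hsimple)) B.a_ne
    refine ⟨ContinuousLinearEquiv.unitsEquivAut ℂ (Units.mk0 _ hne), ?_⟩
    ext
    simp
  set mu : ℂ → ℂ := cdf.implicitFunction hω hinv with hmu
  have hmu0 : mu 0 = μ₀ := cdf.implicitFunction_apply_self hω hinv
  have hmuω : ContDiffAt ℂ ω mu 0 := cdf.contDiffAt_implicitFunction hω hinv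
  have hz : B.scaledReduced (0, μ₀) = 0 := by rw [scaledReduced_zero, h₀]
  have ev1 : ∀ᶠ ν : ℂ in 𝓝 0, B.scaledReduced (ν, mu ν) = 0 := by
    have := cdf.eventually_apply_implicitFunction hω hinv
    rwa [hz] at this
  have ev2 : ∀ᶠ q : ℂ × ℂ in 𝓝 (0, μ₀), B.scaledReduced q = 0 → mu q.1 = q.2 := by
    have := cdf.eventually_apply_eq_iff_implicitFunction hω hinv
    rw [hz] at this
    exact this.mono fun q hq => hq.mp
  have hpair : ContinuousAt (fun ν : ℂ => (ν, mu ν)) 0 :=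
    continuousAt_id.prodMk hmuω.continuousAt
  have hpair' : Tendsto (fun ν : ℂ => (ν, mu ν)) (𝓝 0) (𝓝 (0, μ₀)) := by
    have := hpair.tendsto
    rwa [hmu0] at this
  have ev3 := hpair'.eventually (B.eventually_isUnit_mul μ₀)
  have ev4 := hpair'.eventually (B.eventually_sol_ne_zero μ₀)
  have ev5 : ∀ᶠ ν : ℂ in 𝓝 0, AnalyticAt ℂ mu ν := hmuω.analyticAt.eventually_analyticAt
  have hO1 : (fun ν => mu ν - μ₀) =O[𝓝 0] fun ν : ℂ => ν := by
    have := (hmuω.differentiableAt (by simp)).isBigO_sub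
    simpa [hmu0] using this
  have hO2 : (fun ν => B.sol (ν, ν * mu ν) - (B.φ + ν • (B.ψ + B.slope μ₀ • B.e)))
      =O[𝓝 0] fun ν : ℂ => ν ^ 2 := by
    have h1 : (fun ν => B.inv (ν, ν * mu ν) (B.scaledResidual (ν, mu ν)))
        =O[𝓝 0] fun _ : ℂ => (1 : ℂ) := by
      have h2 := (B.contDiffAt_correction (q := (0, μ₀))
        (B.isUnit_bordered_zero_mul μ₀)).continuousAt
      exact (h2.tendsto.comp hpair').isBigO_one ℂ
    -- The slope is affine in μ, so freezing it at μ₀ changes the first order term by ν · O(ν).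
    have h3 : (fun ν => (-(ν * (mu ν - μ₀) / B.a)) • B.e) =O[𝓝 0] fun ν : ℂ => ν ^ 2 := by
      have h4 : (fun ν : ℂ => -(ν * (mu ν - μ₀) / B.a)) =O[𝓝 0] fun ν : ℂ => ν ^ 2 := by
        have h5 := ((isBigO_refl (fun ν : ℂ => ν) (𝓝 0)).mul hO1).const_mul_left (-(1 / B.a))
        refine h5.congr (fun ν => by ring) (fun ν => by ring)
      simpa using h4.smul (isBigO_const_one ℂ B.e _)
    have h6 : (fun ν => ν ^ 2 • B.inv (ν, ν * mu ν) (B.scaledResidual (ν, mu ν)))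
        =O[𝓝 0] fun ν : ℂ => ν ^ 2 := by
      simpa using (isBigO_refl (fun ν : ℂ => ν ^ 2) (𝓝 0)).smul h1
    refine (h3.sub h6).congr_left fun ν => ?_
    rw [sol_mul]
    simp only [slope]
    module
  obtain ⟨C₁, hC₁⟩ := hO1.bound
  obtain ⟨C₂, hC₂⟩ := hO2.bound
  obtain ⟨r₁, hr₁, hb₁⟩ := Metric.eventually_nhds_iff.mp
    (ev1.and (ev3.and (ev4.and (ev5.and (hC₁.and hC₂)))))
  obtain ⟨r₂, hr₂, hb₂⟩ := Metric.eventually_nhds_iff.mp (ev2.and (B.eventually_isUnit_mul μ₀))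
  refine ⟨min r₁ r₂, lt_min hr₁ hr₂, max C₁ C₂, mu, fun ν => B.sol (ν, ν * mu ν), ?_, ?_, ?_⟩
  · intro ν hν
    rw [Metric.mem_ball] at hν
    exact (hb₁ (hν.trans_le (min_le_left _ _))).2.2.2.1
  · intro ν hν
    obtain ⟨h1, h2, h3, -, h4, h5⟩ :=
      hb₁ (y := ν) (by rw [dist_zero_right]; exact hν.trans_le (min_le_left _ _))
    refine ⟨h3, B.A_sol_mul h2 h1, h4.trans ?_, h5.trans ?_⟩
    · exact mul_le_mul_of_nonneg_right (le_max_left _ _) (norm_nonneg _)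
    · rw [norm_pow]
      exact mul_le_mul_of_nonneg_right (le_max_right _ _) (by positivity)
  · intro ν μ g hν0 hν hμ hg hg0
    have hd : dist (ν, μ) ((0 : ℂ), μ₀) < r₂ := by
      rw [Prod.dist_eq, dist_zero_right, dist_eq_norm]
      exact max_lt (hν.trans_le (min_le_right _ _)) (hμ.trans_le (min_le_right _ _))
    obtain ⟨h1, h2⟩ := hb₂ hd
    exact (h1 (B.scaledReduced_eq_zero hν0 h2 hg hg0)).symm

/-- If the roots of `charPoly` are simple, then the singular parameters near the origin form
exactly two analytic branches. -/
theorem exists_branches (hsimple : ∀ μ, B.charPoly μ = 0 → μ ≠ -μ - B.p₁ - B.b) :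
    ∃ r > 0, ∃ (C : ℝ) (lam : ℂ → ℂ → ℂ) (G : ℂ → ℂ → E),
      (∀ μ₀, B.charPoly μ₀ = 0 → AnalyticOnNhd ℂ (lam μ₀) (Metric.ball 0 r) ∧
        ∀ ν : ℂ, ‖ν‖ < r → G μ₀ ν ≠ 0 ∧ B.A (ν, lam μ₀ ν) (G μ₀ ν) = 0 ∧
          ‖lam μ₀ ν - ν * μ₀‖ ≤ C * ‖ν‖ ^ 2 ∧
          ‖G μ₀ ν - (B.φ + ν • (B.ψ + B.slope μ₀ • B.e))‖ ≤ C * ‖ν‖ ^ 2) ∧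
      (∀ (ν l : ℂ) (g : E), ‖ν‖ < r → ‖l‖ < r → B.A (ν, l) g = 0 → g ≠ 0 →
        ∃ μ₀, B.charPoly μ₀ = 0 ∧ l = lam μ₀ ν ∧ ∃ c : ℂ, g = c • G μ₀ ν) := by
  -- Up to the factor -1/a, `charPoly` is μ² + (p₁ + b)μ + p₁b - a p₀; z is a square root of its
  -- discriminant.
  obtain ⟨μ₁, hμ₁⟩ : ∃ μ₁, B.charPoly μ₁ = 0 := by
    obtain ⟨z, hz⟩ := IsAlgClosed.exists_pow_nat_eq
      ((B.p₁ + B.b) ^ 2 - 4 * (B.p₁ * B.b - B.a * B.p₀)) (n := 2) (by norm_num)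
    refine ⟨(-(B.p₁ + B.b) + z) / 2, ?_⟩
    simp only [charPoly, slope]
    field_simp [B.a_ne]
    linear_combination -hz
  set μ₂ := -μ₁ - B.p₁ - B.b with hμ₂'
  have hμ₂ : B.charPoly μ₂ = 0 := by rw [B.charPoly_eq hμ₁]; simp [hμ₂']
  have hne : μ₁ ≠ μ₂ := hsimple μ₁ hμ₁
  have hroots : ∀ μ, B.charPoly μ = 0 → μ = μ₁ ∨ μ = μ₂ := by
    intro μ hμ
    rw [B.charPoly_eq hμ₁, div_eq_zero_iff, neg_eq_zero, mul_eq_zero, sub_eq_zero,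
      sub_eq_zero] at hμ
    exact hμ.resolve_right B.a_ne
  obtain ⟨r₁, hr₁, C₁, mu₁, G₁, ha₁, hG₁, hu₁⟩ := B.exists_branch hμ₁ (hsimple μ₁ hμ₁)
  obtain ⟨r₂, hr₂, C₂, mu₂, G₂, ha₂, hG₂, hu₂⟩ := B.exists_branch hμ₂ (hsimple μ₂ hμ₂)
  obtain ⟨r₃, hr₃, C₃, hbound⟩ := B.exists_bound
  obtain ⟨r₄, hr₄, hunit⟩ := Metric.eventually_nhds_iff.mp B.eventually_isUnit
  set s := min r₁ r₂ with hs
  have hs0 : 0 < s := lt_min hr₁ hr₂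
  have hN : 0 < ‖B.a‖ := norm_pos_iff.mpr B.a_ne
  -- For |ν| below this radius the a priori bound gives |l/ν - μ₁| |l/ν - μ₂| < s², so one factor is
  -- below s and local uniqueness applies to that root.
  set r₅ := s * s / (‖B.a‖ * (|C₃| + 1)) with hr₅
  have hr₅0 : 0 < r₅ := by positivity
  have hnear : ∀ (ν l : ℂ) (g : E), ν ≠ 0 → ‖ν‖ < min r₃ r₅ → ‖l‖ < r₃ → B.A (ν, l) g = 0 →
      g ≠ 0 → ‖l / ν - μ₁‖ < s ∨ ‖l / ν - μ₂‖ < s := by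
    intro ν l g hν0 hν hl hg hg0
    by_contra! hcon
    have h1 := (hbound ν l g (hν.trans_le (min_le_left _ _)) hl hg hg0).2 hν0
    rw [B.charPoly_eq hμ₁, norm_div, norm_neg, norm_mul, div_le_iff₀ hN] at h1
    have h2 := mul_le_mul hcon.1 hcon.2 hs0.le (norm_nonneg _)
    have h3 : ‖ν‖ * (‖B.a‖ * (|C₃| + 1)) < s * s := by
      have := hν.trans_le (min_le_right _ _)
      rwa [hr₅, lt_div_iff₀ (by positivity)] at this
    have h4 : C₃ * ‖ν‖ * ‖B.a‖ ≤ (|C₃| + 1) * ‖ν‖ * ‖B.a‖ := by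
      gcongr
      linarith [le_abs_self C₃]
    linarith
  have hr0 : 0 < min (min s r₄) (min r₃ r₅) := by positivity
  refine ⟨min (min s r₄) (min r₃ r₅), hr0, max C₁ C₂, fun μ₀ ν => ν * if μ₀ = μ₁ then mu₁ ν else mu₂ ν,
    fun μ₀ ν => if μ₀ = μ₁ then G₁ ν else G₂ ν, ?_, ?_⟩
  · intro μ₀ hμ₀
    have hlam {C : ℝ} {mu : ℂ → ℂ} {ν μ : ℂ} (h : ‖mu ν - μ‖ ≤ C * ‖ν‖) (hC : C ≤ max C₁ C₂) :
        ‖ν * mu ν - ν * μ‖ ≤ max C₁ C₂ * ‖ν‖ ^ 2 := by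
      rw [← mul_sub, norm_mul]
      have := mul_le_mul_of_nonneg_left
        (h.trans (mul_le_mul_of_nonneg_right hC (norm_nonneg ν))) (norm_nonneg ν)
      linarith
    have hsub : ∀ {t : ℝ}, s ≤ t →
        Metric.ball (0 : ℂ) (min (min s r₄) (min r₃ r₅)) ⊆ Metric.ball 0 t := fun ht =>
      Metric.ball_subset_ball (((min_le_left _ _).trans (min_le_left _ _)).trans ht)
    rcases hroots μ₀ hμ₀ with rfl | rfl
    · simp only [if_true]
      refine ⟨analyticOnNhd_id.mul (ha₁.mono (hsub (min_le_left _ _))), fun ν hν => ?_⟩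
      obtain ⟨h1, h2, h3, h4⟩ := hG₁ ν (by
        simpa using hsub (min_le_left r₁ r₂) (mem_ball_zero_iff.mpr hν))
      exact ⟨h1, h2, hlam h3 (le_max_left _ _), h4.trans
        (mul_le_mul_of_nonneg_right (le_max_left _ _) (by positivity))⟩
    · simp only [if_neg hne.symm]
      refine ⟨analyticOnNhd_id.mul (ha₂.mono (hsub (min_le_right _ _))), fun ν hν => ?_⟩
      obtain ⟨h1, h2, h3, h4⟩ := hG₂ ν (by
        simpa using hsub (min_le_right r₁ r₂) (mem_ball_zero_iff.mpr hν))
      exact ⟨h1, h2, hlam h3 (le_max_right _ _), h4.trans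
        (mul_le_mul_of_nonneg_right (le_max_right _ _) (by positivity))⟩
  · intro ν l g hν hl hg hg0
    have hνs : ‖ν‖ < s := hν.trans_le ((min_le_left _ _).trans (min_le_left _ _))
    have hν₁ : ‖ν‖ < r₁ := hνs.trans_le (min_le_left _ _)
    have hν₂ : ‖ν‖ < r₂ := hνs.trans_le (min_le_right _ _)
    have hν35 : ‖ν‖ < min r₃ r₅ := hν.trans_le (min_le_right _ _)
    have hl3 : ‖l‖ < r₃ := hl.trans_le ((min_le_right _ _).trans (min_le_left _ _))
    have hU : IsUnit (B.bordered (ν, l)) := by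
      refine hunit ?_
      rw [dist_zero_right, Prod.norm_mk]
      exact max_lt (hν.trans_le ((min_le_left _ _).trans (min_le_right _ _)))
        (hl.trans_le ((min_le_left _ _).trans (min_le_right _ _)))
    suffices h : l = ν * mu₁ ν ∨ l = ν * mu₂ ν by
      rcases h with h | h
      · refine ⟨μ₁, hμ₁, by simpa using h, ?_⟩
        simp only [if_true]
        obtain ⟨h1, h2, -⟩ := hG₁ ν hν₁
        rw [← h] at h2
        exact B.exists_smul_of_A_eq_zero hU hg h2 h1
      · refine ⟨μ₂, hμ₂, by simpa [hne.symm] using h, ?_⟩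
        simp only [if_neg hne.symm]
        obtain ⟨h1, h2, -⟩ := hG₂ ν hν₂
        rw [← h] at h2
        exact B.exists_smul_of_A_eq_zero hU hg h2 h1
    -- At ν = 0 the a priori bound leaves only l = 0, where both branches start.
    by_cases hν0 : ν = 0
    · left
      have := (hbound ν l g (hν35.trans_le (min_le_left _ _)) hl3 hg hg0).1
      rw [hν0] at this ⊢
      simpa using this
    · have hlν : l = ν * (l / ν) := by field_simp
      have hg' : B.A (ν, ν * (l / ν)) g = 0 := by rw [← hlν]; exact hg
      rcases hnear ν l g hν0 hν35 hl3 hg hg0 with h | h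
      · left
        rw [← hu₁ ν (l / ν) g hν0 hν₁ (h.trans_le (min_le_left _ _)) hg' hg0]
        exact hlν
      · right
        rw [← hu₂ ν (l / ν) g hν0 hν₂ (h.trans_le (min_le_right _ _)) hg' hg0]
        exact hlν

end BifurcationData

end

noncomputable section

/-! ### Continuous periodic functions and the resolvent of the derivative -/

namespace PeriodicCalculus

open intervalIntegral

/-- Continuous 1-periodic functions. -/
abbrev PerC := C(UnitAddCircle, ℂ)

/-- A continuous function on the circle as a periodic function on the line. -/
def per (g : PerC) (x : ℝ) : ℂ := g (x : UnitAddCircle)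

theorem continuous_per (g : PerC) : Continuous (per g) :=
  g.continuous.comp (AddCircle.continuous_mk' 1)

theorem periodic_per (g : PerC) : Function.Periodic (per g) 1 := by
  intro x
  simp [per]

theorem per_injective : Function.Injective per := by
  intro g h hgh
  ext x
  obtain ⟨y, rfl⟩ := QuotientAddGroup.mk_surjective x
  exact congrFun hgh y

theorem norm_per_le (g : PerC) (x : ℝ) : ‖per g x‖ ≤ ‖g‖ := g.norm_coe_le_norm _

theorem exists_per_eq {f : ℝ → ℂ} (hf : Continuous f) (hp : Function.Periodic f 1) :
    ∃ g : PerC, per g = f := by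
  refine ⟨⟨hp.lift, ?_⟩, ?_⟩
  · exact continuous_coinduced_dom.mpr hf
  · funext x
    exact hp.lift_coe x

/-- The mean value. -/
def mean : PerC →L[ℂ] ℂ :=
  LinearMap.mkContinuous
    { toFun := fun g => ∫ x in (0 : ℝ)..1, per g x
      map_add' := fun g h => by
        rw [← integral_add ((continuous_per g).intervalIntegrable _ _)
          ((continuous_per h).intervalIntegrable _ _)]
        rfl
      map_smul' := fun c g => by
        rw [RingHom.id_apply, smul_eq_mul, ← integral_const_mul]
        rfl }
    1 (fun g => by
      have := norm_integral_le_of_norm_le_const (a := 0) (b := 1) (f := per g) (C := ‖g‖)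
        (fun x _ => norm_per_le g x)
      simpa using this)

theorem mean_apply (g : PerC) : mean g = ∫ x in (0 : ℝ)..1, per g x := rfl

theorem mean_eq_zero_of_hasDerivAt {f : ℝ → ℂ} {g : PerC} (hp : Function.Periodic f 1)
    (h : ∀ x, HasDerivAt f (per g x) x) : mean g = 0 := by
  rw [mean_apply, integral_eq_sub_of_hasDerivAt (fun x _ => h x)
    ((continuous_per g).intervalIntegrable _ _)]
  have := hp 0
  rw [zero_add] at this
  rw [this, sub_self]

/-- The normalizing constant `1 / (1 - e⁻¹)`. -/
def resolventConst : ℂ := (1 - Complex.exp (-1))⁻¹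

theorem one_sub_exp_ne : 1 - Complex.exp (-1) ≠ 0 := by
  have h : Complex.exp (-1) = ((Real.exp (-1) : ℝ) : ℂ) := by simp
  rw [h, sub_ne_zero]
  have : Real.exp (-1) < 1 := by simp
  exact_mod_cast this.ne'

/-- The solution of `f' + f = g`, as a function on the circle. -/
def resolventFun (g : PerC) : PerC where
  toFun x := resolventConst * ∫ s in (0 : ℝ)..1, Complex.exp (-s) * g (x - (s : UnitAddCircle))
  continuous_toFun := by
    refine continuous_const.mul (continuous_parametric_intervalIntegral_of_continuous' ?_ _ _)
    have h : Continuous fun p : UnitAddCircle × ℝ => ((p.2 : ℝ) : UnitAddCircle) :=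
      (AddCircle.continuous_mk' 1).comp continuous_snd
    simp only [Function.uncurry_def]
    fun_prop

/-- The operator `(d/dx + 1)⁻¹`. -/
def S : PerC →L[ℂ] PerC :=
  LinearMap.mkContinuous
    { toFun := resolventFun
      map_add' := fun g h => by
        have hc (g : PerC) (x : UnitAddCircle) : IntervalIntegrable
            (fun s : ℝ => Complex.exp (-s) * g (x - (s : UnitAddCircle)))
            MeasureTheory.volume 0 1 := by
          refine Continuous.intervalIntegrable ?_ _ _
          have : Continuous fun s : ℝ => (s : UnitAddCircle) := AddCircle.continuous_mk' 1
          fun_prop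
        ext x
        simp only [resolventFun, ContinuousMap.coe_mk, ContinuousMap.add_apply, mul_add]
        rw [integral_add (hc g x) (hc h x), mul_add]
      map_smul' := fun c g => by
        ext x
        simp only [resolventFun, ContinuousMap.coe_mk, ContinuousMap.smul_apply, smul_eq_mul,
          RingHom.id_apply]
        rw [mul_left_comm c]
        congr 1
        rw [← integral_const_mul]
        congr 1
        funext s
        ring }
    ‖resolventConst‖ (fun g => by
      refine (ContinuousMap.norm_le _ (by positivity)).mpr fun x => ?_
      simp only [LinearMap.coe_mk, AddHom.coe_mk, resolventFun, ContinuousMap.coe_mk, norm_mul]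
      refine mul_le_mul_of_nonneg_left ?_ (norm_nonneg _)
      have := norm_integral_le_of_norm_le_const (a := 0) (b := 1)
        (f := fun s : ℝ => Complex.exp (-s) * g (x - (s : UnitAddCircle))) (C := ‖g‖) (by
          intro s hs
          rw [Set.uIoc_of_le zero_le_one] at hs
          have h1 : ‖Complex.exp (-s)‖ ≤ 1 := by
            rw [Complex.norm_exp]
            simpa using hs.1.le
          rw [norm_mul]
          exact (mul_le_mul h1 (g.norm_coe_le_norm _) (norm_nonneg _) zero_le_one).trans_eq
            (one_mul _))
      simpa using this)

/-- The substitution t = x - s turns the convolution, which is visibly a function on the circle,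
into an integral over a moving window that can be differentiated. -/
theorem per_S (g : PerC) (x : ℝ) :
    per (S g) x = resolventConst * (Complex.exp (-x) * ∫ t in (x - 1)..x, Complex.exp t * per g t) := by
  have h1 : per (S g) x
      = resolventConst * ∫ s in (0 : ℝ)..1, Complex.exp (-s) * per g (x - s) := rfl
  have h2 := integral_comp_sub_left (a := 0) (b := 1)
    (fun t : ℝ => Complex.exp (-x) * (Complex.exp t * per g t)) x
  rw [sub_zero] at h2
  rw [h1, ← integral_const_mul (Complex.exp (-x)), ← h2]
  congr 2
  funext s
  rw [← mul_assoc, ← Complex.exp_add]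
  push_cast
  ring_nf

theorem exp_neg_mul_sub (x : ℝ) (c : ℂ) :
    Complex.exp (-x) * (Complex.exp x * c - Complex.exp ((x - 1 : ℝ) : ℂ) * c)
      = (1 - Complex.exp (-1)) * c := by
  push_cast
  rw [Complex.exp_sub, Complex.exp_neg, Complex.exp_neg]
  have := Complex.exp_ne_zero (x : ℂ)
  field_simp

theorem hasDerivAt_ofReal (x : ℝ) : HasDerivAt (fun y : ℝ => (y : ℂ)) 1 x :=
  Complex.ofRealCLM.hasDerivAt

/-- By periodicity of g the two endpoint contributions combine to (1 - e⁻¹)g(x), which the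
normalizing constant cancels. -/
theorem hasDerivAt_S (g : PerC) (x : ℝ) : HasDerivAt (per (S g)) (per g x - per (S g) x) x := by
  set F : ℝ → ℂ := fun t => Complex.exp t * per g t with hF
  have hFc : Continuous F := by
    have := continuous_per g
    fun_prop
  have hP : ∀ y, HasDerivAt (fun y => ∫ t in (0 : ℝ)..y, F t) (F y) y := fun y =>
    integral_hasDerivAt_right (hFc.intervalIntegrable _ _)
      (hFc.stronglyMeasurableAtFilter _ _) hFc.continuousAt
  have hI : ∀ y, ∫ t in (y - 1)..y, F t
      = (∫ t in (0 : ℝ)..y, F t) - ∫ t in (0 : ℝ)..(y - 1), F t := fun y =>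
    (integral_interval_sub_left (hFc.intervalIntegrable _ _) (hFc.intervalIntegrable _ _)).symm
  have h1 : HasDerivAt (fun y => ∫ t in (y - 1)..y, F t) (F x - F (x - 1)) x := by
    simp only [hI]
    exact (hP x).sub ((hP (x - 1)).comp_sub_const x 1)
  have h2 : HasDerivAt (fun y : ℝ => Complex.exp (-y)) (-Complex.exp (-x)) x := by
    simpa using (hasDerivAt_ofReal x).fun_neg.cexp
  have h3 := (h2.mul h1).const_mul resolventConst
  have h4 : per (S g) = fun y : ℝ => resolventConst * (Complex.exp (-y) * ∫ t in (y - 1)..y, F t) :=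
    funext (per_S g)
  rw [h4]
  refine h3.congr_deriv ?_
  have h5 : Complex.exp (-x) * (F x - F (x - 1)) = (1 - Complex.exp (-1)) * per g x := by
    have h6 : per g (x - 1) = per g x := (periodic_per g).sub_eq x
    simp only [hF, h6]
    exact exp_neg_mul_sub x _
  rw [h5, mul_add, ← mul_assoc resolventConst (1 - Complex.exp (-1)), resolventConst,
    inv_mul_cancel₀ one_sub_exp_ne]
  ring

/-- The operator `d/dx ∘ (d/dx + 1)⁻¹`. -/
def D : PerC →L[ℂ] PerC := 1 - S

theorem hasDerivAt_S' (g : PerC) (x : ℝ) : HasDerivAt (per (S g)) (per (D g) x) x :=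
  hasDerivAt_S g x

theorem D_add_S (g : PerC) : D g + S g = g := by simp [D]

theorem D_S (g : PerC) : D (S g) = S (D g) := by simp [D]

theorem mean_D (g : PerC) : mean (D g) = 0 :=
  mean_eq_zero_of_hasDerivAt (periodic_per (S g)) (hasDerivAt_S' g)

theorem S_injective : Function.Injective S := by
  rw [injective_iff_map_eq_zero]
  intro g hg
  have h1 : D g = 0 := by
    apply per_injective
    funext x
    have h2 := hasDerivAt_S' g x
    have h3 : per (S g) = fun _ => 0 := by rw [hg]; rfl
    rw [h3] at h2
    exact h2.unique (hasDerivAt_const x 0)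
  rw [← D_add_S g, h1, hg, add_zero]

/-- `S` is a left inverse of `d/dx + 1`. -/
theorem S_eq_of_hasDerivAt {f h : PerC}
    (hf : ∀ x, HasDerivAt (per f) (per h x - per f x) x) : S h = f := by
  apply per_injective
  funext x
  rw [per_S]
  have h1 : ∀ t : ℝ, HasDerivAt (fun t : ℝ => Complex.exp t * per f t)
      (Complex.exp t * per h t) t := by
    intro t
    have h2 : HasDerivAt (fun y : ℝ => Complex.exp y) (Complex.exp t) t := by
      simpa using (hasDerivAt_ofReal t).cexp
    refine (h2.mul (hf t)).congr_deriv ?_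
    ring
  have hc : Continuous fun t : ℝ => Complex.exp t * per h t := by
    have := continuous_per h
    fun_prop
  rw [integral_eq_sub_of_hasDerivAt (fun t _ => h1 t) (hc.intervalIntegrable _ _),
    (periodic_per f).sub_eq x]
  rw [exp_neg_mul_sub, resolventConst, inv_mul_cancel_left₀ one_sub_exp_ne]

/-- The identity (Sg)' = g - Sg passes the regularity of g to the derivative of Sg, one order at a
time. -/
theorem contDiff_per_S {g : PerC} {n : ℕ} (hg : ContDiff ℝ n (per g)) :
    ContDiff ℝ (n + 1 : ℕ) (per (S g)) := by
  have hd : deriv (per (S g)) = fun x => per g x - per (S g) x :=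
    funext fun x => (hasDerivAt_S g x).deriv
  have hdiff : Differentiable ℝ (per (S g)) := fun x => (hasDerivAt_S g x).differentiableAt
  induction n with
  | zero =>
    have : ContDiff ℝ 0 (deriv (per (S g))) := by
      rw [hd, contDiff_zero]
      exact (continuous_per g).sub (continuous_per (S g))
    exact contDiff_succ_iff_deriv.mpr ⟨hdiff, by simp, this⟩
  | succ n ih =>
    have h1 := ih (hg.of_le (by exact_mod_cast Nat.le_succ n))
    have : ContDiff ℝ (n + 1 : ℕ) (deriv (per (S g))) := by
      rw [hd]
      exact hg.sub h1
    have h2 : ContDiff ℝ (((n + 1 : ℕ) : WithTop ℕ∞) + 1) (per (S g)) :=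
      contDiff_succ_iff_deriv.mpr ⟨hdiff, by simp, this⟩
    exact_mod_cast h2

theorem contDiff_per_S' {g : PerC} {n : ℕ} (hg : ContDiff ℝ n (per g)) :
    ContDiff ℝ n (per (S g)) :=
  (contDiff_per_S hg).of_le (by exact_mod_cast Nat.le_succ n)

theorem contDiff_per_D {g : PerC} {n : ℕ} (hg : ContDiff ℝ n (per g)) :
    ContDiff ℝ n (per (D g)) :=
  hg.sub (contDiff_per_S' hg)

theorem exists_S_eq {f : ℝ → ℂ} (hf : ContDiff ℝ ∞ f) (hp : Function.Periodic f 1) :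
    ∃ h : PerC, per (S h) = f ∧ ContDiff ℝ ∞ (per h) := by
  have hd : ContDiff ℝ ∞ (deriv f) := (contDiff_infty_iff_deriv.mp hf).2
  have hdp : Function.Periodic (deriv f) 1 := by
    intro x
    rw [← deriv_comp_add_const]
    congr 1
    exact funext hp
  obtain ⟨F, hF⟩ := exists_per_eq hf.continuous hp
  obtain ⟨h, hh⟩ := exists_per_eq (f := fun x => deriv f x + f x)
    (hd.continuous.add hf.continuous) (hdp.add hp)
  refine ⟨h, ?_, ?_⟩
  · rw [S_eq_of_hasDerivAt (f := F), hF]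
    intro x
    rw [hF, hh]
    have := ((hf.differentiable (by simp)) x).hasDerivAt
    simpa using this
  · rw [hh]
    exact hd.add hf

theorem norm_per_S_sub_le (g : PerC) (x y : ℝ) :
    ‖per (S g) y - per (S g) x‖ ≤ ‖D g‖ * |y - x| :=
  Convex.norm_image_sub_le_of_norm_hasDerivWithin_le
    (fun z _ => (hasDerivAt_S' g z).hasDerivWithinAt) (fun z _ => norm_per_le (D g) z)
    convex_univ (Set.mem_univ x) (Set.mem_univ y)

theorem norm_S_sub_le (g : PerC) (x y : UnitAddCircle) :
    ‖S g y - S g x‖ ≤ ‖D g‖ * dist y x := by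
  obtain ⟨x, rfl⟩ := QuotientAddGroup.mk_surjective x
  obtain ⟨y, rfl⟩ := QuotientAddGroup.mk_surjective y
  -- Shifting y by the integer nearest to y - x picks the representative that realizes the distance
  -- on the circle.
  have h1 : dist (y : UnitAddCircle) (x : UnitAddCircle) = |(y - round (y - x)) - x| := by
    rw [dist_eq_norm, ← AddCircle.coe_sub, UnitAddCircle.norm_eq]
    ring_nf
  have h2 : per (S g) (y - round (y - x)) = per (S g) y := by
    have := (periodic_per (S g)).sub_zsmul_eq (round (y - x)) (x := y)
    simpa using this
  have h3 := norm_per_S_sub_le g x (y - round (y - x))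
  rw [h2, ← h1] at h3
  exact h3

/-- Arzelà-Ascoli for uniformly Lipschitz functions. -/
theorem isCompact_lipschitz (C L : ℝ) :
    IsCompact {h : PerC | (∀ x, ‖h x‖ ≤ C) ∧ ∀ x y, ‖h y - h x‖ ≤ L * dist y x} := by
  refine ArzelaAscoli.isCompact_of_equicontinuous _ ?_ ?_
  · have himg : ContinuousMap.toFun ''
        {h : PerC | (∀ x, ‖h x‖ ≤ C) ∧ ∀ x y, ‖h y - h x‖ ≤ L * dist y x}
        = {F : UnitAddCircle → ℂ | (∀ x, ‖F x‖ ≤ C) ∧ ∀ x y, ‖F y - F x‖ ≤ L * dist y x} := by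
      ext F
      constructor
      · rintro ⟨h, hh, rfl⟩
        exact hh
      · intro hF
        have hc : Continuous F := by
          refine continuous_iff_continuousAt.mpr fun x => ?_
          rw [ContinuousAt, tendsto_iff_norm_sub_tendsto_zero]
          refine squeeze_zero (fun _ => norm_nonneg _) (fun y => hF.2 x y) ?_
          have : Filter.Tendsto (fun y => L * dist y x) (𝓝 x) (𝓝 (L * dist x x)) :=
            (continuous_const.mul (continuous_id.dist continuous_const)).tendsto x
          simpa using this
        exact ⟨⟨F, hc⟩, hF, rfl⟩
    rw [himg]
    refine (isCompact_univ_pi fun _ : UnitAddCircle =>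
      isCompact_closedBall (0 : ℂ) C).of_isClosed_subset ?_ ?_
    · have h1 : IsClosed {F : UnitAddCircle → ℂ | ∀ x, ‖F x‖ ≤ C} := by
        simp only [Set.ofPred_forall]
        exact isClosed_iInter fun x =>
          isClosed_le (continuous_apply x).norm continuous_const
      have h2 : IsClosed {F : UnitAddCircle → ℂ | ∀ x y, ‖F y - F x‖ ≤ L * dist y x} := by
        simp only [Set.ofPred_forall]
        exact isClosed_iInter fun x => isClosed_iInter fun y =>
          isClosed_le ((continuous_apply y).sub (continuous_apply x)).norm continuous_const
      exact h1.inter h2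
    · intro F hF x _
      simpa using hF.1 x
  · intro x
    rw [Metric.equicontinuousAt_iff_right]
    intro ε hε
    have h1 : Filter.Tendsto (fun y => L * dist y x) (𝓝 x) (𝓝 0) := by
      have : Filter.Tendsto (fun y => L * dist y x) (𝓝 x) (𝓝 (L * dist x x)) :=
        (continuous_const.mul (continuous_id.dist continuous_const)).tendsto x
      simpa using this
    filter_upwards [h1.eventually (gt_mem_nhds hε)] with y hy h
    rw [dist_comm, dist_eq_norm]
    exact (h.2.2 x y).trans_lt hy

/-- The derivative of Sg is Dg, so the image of the unit ball is uniformly bounded and uniformly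
Lipschitz. -/
theorem isCompactOperator_S : IsCompactOperator S := by
  refine (isCompactOperator_iff_image_ball_subset_compact (S : PerC →ₗ[ℂ] PerC)
    one_pos).mpr ⟨_, isCompact_lipschitz ‖S‖ ‖D‖, ?_⟩
  rintro _ ⟨g, hg, rfl⟩
  have hg1 : ‖g‖ ≤ 1 := (mem_ball_zero_iff.mp hg).le
  refine ⟨fun x => ((S g).norm_coe_le_norm x).trans ?_, fun x y => (norm_S_sub_le g x y).trans ?_⟩
  · exact (S.le_opNorm g).trans (mul_le_of_le_one_right (norm_nonneg _) hg1)
  · refine mul_le_mul_of_nonneg_right ?_ dist_nonneg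
    exact (D.le_opNorm g).trans (mul_le_of_le_one_right (norm_nonneg _) hg1)

/-! ### Fourth order operators in terms of the resolvent -/

/-- `Dʲ S⁴⁻ʲ`, the `j`-th derivative of the fourth power of the resolvent. -/
def T (j : ℕ) : PerC →L[ℂ] PerC := D ^ j * S ^ (4 - j)

theorem commute_D_S : Commute D S := by
  exact ContinuousLinearMap.ext D_S

theorem T_eq {j : ℕ} (hj : j < 4) (g : PerC) : T j g = S ((D ^ j * S ^ (3 - j)) g) := by
  have h1 : T j = S * (D ^ j * S ^ (3 - j)) := by
    rw [T, show 4 - j = (3 - j) + 1 by omega, pow_succ', ← mul_assoc, ← mul_assoc,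
      (commute_D_S.pow_left j).eq]
  rw [h1]; rfl

theorem T_succ_eq {j : ℕ} (hj : j < 4) (g : PerC) :
    T (j + 1) g = D ((D ^ j * S ^ (3 - j)) g) := by
  have h1 : T (j + 1) = D * (D ^ j * S ^ (3 - j)) := by
    rw [T, show 4 - (j + 1) = 3 - j by omega, pow_succ', mul_assoc]
  rw [h1]; rfl

/-- With f = T 0 g, differentiation of f up to order four becomes the passage from T 0 to bounded
operators T j applied to g. -/
theorem hasDerivAt_T {j : ℕ} (hj : j < 4) (g : PerC) (x : ℝ) :
    HasDerivAt (per (T j g)) (per (T (j + 1) g) x) x := by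
  rw [T_eq hj, T_succ_eq hj]
  exact hasDerivAt_S' _ x

theorem iteratedDeriv_T {j : ℕ} (hj : j ≤ 4) (g : PerC) :
    iteratedDeriv j (per (T 0 g)) = per (T j g) := by
  induction j with
  | zero => simp
  | succ j ih =>
    rw [iteratedDeriv_succ, ih (by omega)]
    exact funext fun x => (hasDerivAt_T (by omega) g x).deriv

theorem mean_T_succ {j : ℕ} (hj : j < 4) (g : PerC) : mean (T (j + 1) g) = 0 := by
  rw [T_succ_eq hj, mean_D]

theorem T_zero_apply (g : PerC) : T 0 g = S (S (S (S g))) := by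
  simp [T, pow_succ]

theorem T_zero_injective : Function.Injective (T 0) := by
  intro g h hgh
  simp only [T_zero_apply] at hgh
  exact S_injective (S_injective (S_injective (S_injective hgh)))

theorem isCompactOperator_T {j : ℕ} (hj : j < 4) : IsCompactOperator (T j) := by
  have h1 : (T j : PerC → PerC) = S ∘ (D ^ j * S ^ (3 - j) : PerC →L[ℂ] PerC) :=
    funext (T_eq hj)
  rw [h1]
  exact isCompactOperator_S.comp_clm _

/-- Since D = 1 - S, the identity 1 - D⁴ = (1 - D)(1 + D + D² + D³) shows that T 4 is the identity
minus a compact operator gaining one derivative. -/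
theorem T_four (g : PerC) : T 4 g = g - S (g + D g + D (D g) + D (D (D g))) := by
  have h : T 4 g = D (D (D (D g))) := by simp [T, pow_succ]
  rw [h]
  simp only [D, sub_apply, map_add, map_sub, one_apply_eq_self]
  abel

theorem contDiff_pow {n : ℕ} {g : PerC} (hg : ContDiff ℝ n (per g)) (i j : ℕ) :
    ContDiff ℝ n (per ((D ^ i * S ^ j) g)) := by
  have hS : ContDiff ℝ n (per ((S ^ j) g)) := by
    induction j with
    | zero => simpa using hg
    | succ j ih => rw [pow_succ']; exact contDiff_per_S' ih
  induction i with
  | zero => simpa using hS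
  | succ i ih => rw [pow_succ', mul_assoc]; exact contDiff_per_D ih

theorem contDiff_T {n j : ℕ} (hj : j < 4) {g : PerC} (hg : ContDiff ℝ n (per g)) :
    ContDiff ℝ (n + 1 : ℕ) (per (T j g)) := by
  rw [T_eq hj]
  exact contDiff_per_S (contDiff_pow hg _ _)

/-- Bootstrapping: if the top order term `T 4 g` is controlled by the lower order ones, then `g` is
smooth. -/
theorem contDiff_of_T_four {g : PerC}
    (h : ∀ n : ℕ, (∀ j < 4, ContDiff ℝ n (per (T j g))) → ContDiff ℝ n (per (T 4 g))) :
    ContDiff ℝ ∞ (per g) := by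
  rw [contDiff_infty]
  intro n
  induction n with
  | zero => simpa using continuous_per g
  | succ n ih =>
    have h1 := h (n + 1) fun j hj => contDiff_T hj ih
    have hD := contDiff_per_D ih
    have hD2 := contDiff_per_D hD
    have h2 : ContDiff ℝ (n + 1 : ℕ) (per (S (g + D g + D (D g) + D (D (D g))))) :=
      contDiff_per_S (((ih.add hD).add hD2).add (contDiff_per_D hD2))
    have h3 : g = T 4 g + S (g + D g + D (D g) + D (D (D g))) := by
      rw [T_four, sub_add_cancel]
    rw [h3]
    exact h1.add h2

theorem exists_T_zero_eq {f : ℝ → ℂ} (hf : ContDiff ℝ ∞ f) (hp : Function.Periodic f 1) :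
    ∃ g : PerC, per (T 0 g) = f := by
  obtain ⟨h₁, e₁, c₁⟩ := exists_S_eq hf hp
  obtain ⟨h₂, e₂, c₂⟩ := exists_S_eq c₁ (periodic_per h₁)
  obtain ⟨h₃, e₃, c₃⟩ := exists_S_eq c₂ (periodic_per h₂)
  obtain ⟨h₄, e₄, -⟩ := exists_S_eq c₃ (periodic_per h₃)
  refine ⟨h₄, ?_⟩
  rw [T_zero_apply, per_injective e₄, per_injective e₃, per_injective e₂, e₁]

theorem contDiff_T_zero {g : PerC} (hg : ContDiff ℝ ∞ (per g)) : ContDiff ℝ ∞ (per (T 0 g)) := by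
  rw [contDiff_infty] at hg ⊢
  exact fun n => (contDiff_T (by norm_num) (hg n)).of_le (by exact_mod_cast Nat.le_succ n)

theorem S_one : S 1 = 1 := by
  refine S_eq_of_hasDerivAt fun x => ?_
  have h : per (1 : PerC) = fun _ => (1 : ℂ) := rfl
  rw [h]
  simpa using hasDerivAt_const x (1 : ℂ)

theorem T_zero_one : T 0 1 = 1 := by simp only [T_zero_apply, S_one]

theorem T_succ_one {j : ℕ} (hj : j < 4) : T (j + 1) 1 = 0 := by
  have hD : D 1 = 0 := by simp [D, S_one]
  have h : T (j + 1) = D ^ j * S ^ (3 - j) * D := by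
    rw [T, show 4 - (j + 1) = 3 - j by omega, pow_succ, mul_assoc, mul_assoc,
      (commute_D_S.pow_right _).eq]
  rw [h]
  simp [hD]

theorem mean_one : mean 1 = 1 := by
  have h : per (1 : PerC) = fun _ => (1 : ℂ) := rfl
  rw [mean_apply, h]
  simp

/-- Fredholm alternative for `c T₄` plus lower order terms. -/
theorem isUnit_of_injective {c : ℂ} (hc : c ≠ 0) {A : PerC →L[ℂ] PerC}
    (hA : IsCompactOperator (A - c • T 4 : PerC →L[ℂ] PerC)) (hinj : ∀ g, A g = 0 → g = 0) :
    IsUnit A := by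
  -- Write c - A = c(1 - T 4) - (A - c T 4), both parts compact. The number c ≠ 0 is then an
  -- eigenvalue of c - A, excluded by injectivity of A, or a resolvent point, which makes A
  -- invertible.
  have h1 : IsCompactOperator (c • 1 - A : PerC →L[ℂ] PerC) := by
    have h2 : IsCompactOperator (c • (1 - T 4) : PerC →L[ℂ] PerC) := by
      have h3 : (1 - T 4 : PerC →L[ℂ] PerC) = S * (1 + D + D ^ 2 + D ^ 3) := by
        ext1 g
        simp [T_four, pow_succ]
      rw [h3]
      have h4 := isCompactOperator_S.comp_clm (1 + D + D ^ 2 + D ^ 3)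
      exact h4.smul c
    have h5 := h2.sub hA
    have h6 : (c • 1 - A : PerC →L[ℂ] PerC) = c • (1 - T 4) - (A - c • T 4) := by
      ext1 g
      simp [smul_sub]
    rw [h6]
    exact h5
  rcases h1.hasEigenvalue_or_mem_resolventSet hc with h | h
  · obtain ⟨g, hg⟩ := h.exists_hasEigenvector
    have h2 := hg.apply_eq_smul
    have h3 : A g = 0 := by
      have h4 : c • g - A g = c • g := h2
      exact sub_eq_self.mp h4
    exact absurd (hinj g h3) hg.2
  · rw [spectrum.mem_resolventSet_iff, Algebra.algebraMap_eq_smul_one] at h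
    simpa using h

end PeriodicCalculus

end

noncomputable section

/-! ### Smooth one-parameter families of functions -/

namespace SmoothFamily

variable {K : Set ℝ} {F : ℝ → ℝ → ℝ}

/-- The derivative of a family in the space variable. -/
def dy (F : ℝ → ℝ → ℝ) (k y : ℝ) : ℝ := deriv (F k) y

/-- The derivative of a family in the parameter. -/
def dk (F : ℝ → ℝ → ℝ) (k y : ℝ) : ℝ := deriv (fun k' => F k' y) k

theorem isOpen_prod (hK : IsOpen K) : IsOpen (K ×ˢ (Set.univ : Set ℝ)) := hK.prod isOpen_univ

theorem contDiffAt (hK : IsOpen K)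
    (hF : ContDiffOn ℝ ∞ (Function.uncurry F) (K ×ˢ (Set.univ : Set ℝ))) {k : ℝ} (hk : k ∈ K)
    (y : ℝ) : ContDiffAt ℝ ∞ (Function.uncurry F) (k, y) :=
  hF.contDiffAt ((isOpen_prod hK).mem_nhds ⟨hk, Set.mem_univ y⟩)

theorem hasDerivAt_dy_fderiv (hK : IsOpen K)
    (hF : ContDiffOn ℝ ∞ (Function.uncurry F) (K ×ˢ (Set.univ : Set ℝ))) {k : ℝ} (hk : k ∈ K)
    (y : ℝ) : HasDerivAt (F k) (fderiv ℝ (Function.uncurry F) (k, y) (0, 1)) y := by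
  have h1 := ((contDiffAt hK hF hk y).differentiableAt (by simp)).hasFDerivAt
  have h2 : HasDerivAt (fun y' : ℝ => (k, y')) ((0 : ℝ), (1 : ℝ)) y :=
    (hasDerivAt_const y k).prodMk (hasDerivAt_id y)
  exact h1.comp_hasDerivAt y h2

theorem hasDerivAt_dk_fderiv (hK : IsOpen K)
    (hF : ContDiffOn ℝ ∞ (Function.uncurry F) (K ×ˢ (Set.univ : Set ℝ))) {k : ℝ} (hk : k ∈ K)
    (y : ℝ) :
    HasDerivAt (fun k' => F k' y) (fderiv ℝ (Function.uncurry F) (k, y) (1, 0)) k := by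
  have h1 := ((contDiffAt hK hF hk y).differentiableAt (by simp)).hasFDerivAt
  have h2 : HasDerivAt (fun k' : ℝ => (k', y)) ((1 : ℝ), (0 : ℝ)) k :=
    (hasDerivAt_id k).prodMk (hasDerivAt_const k y)
  exact h1.comp_hasDerivAt (f := fun k' : ℝ => (k', y)) k h2

theorem hasDerivAt_dy (hK : IsOpen K)
    (hF : ContDiffOn ℝ ∞ (Function.uncurry F) (K ×ˢ (Set.univ : Set ℝ))) {k : ℝ} (hk : k ∈ K)
    (y : ℝ) : HasDerivAt (F k) (dy F k y) y :=
  (hasDerivAt_dy_fderiv hK hF hk y).differentiableAt.hasDerivAt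

theorem hasDerivAt_dk (hK : IsOpen K)
    (hF : ContDiffOn ℝ ∞ (Function.uncurry F) (K ×ˢ (Set.univ : Set ℝ))) {k : ℝ} (hk : k ∈ K)
    (y : ℝ) : HasDerivAt (fun k' => F k' y) (dk F k y) k :=
  (hasDerivAt_dk_fderiv hK hF hk y).differentiableAt.hasDerivAt

theorem contDiffOn_fderiv_apply (hK : IsOpen K)
    (hF : ContDiffOn ℝ ∞ (Function.uncurry F) (K ×ˢ (Set.univ : Set ℝ))) (v : ℝ × ℝ) :
    ContDiffOn ℝ ∞ (fun p => fderiv ℝ (Function.uncurry F) p v) (K ×ˢ (Set.univ : Set ℝ)) :=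
  (hF.fderiv_of_isOpen (isOpen_prod hK) (by simp)).clm_apply contDiffOn_const

theorem contDiffOn_dy (hK : IsOpen K)
    (hF : ContDiffOn ℝ ∞ (Function.uncurry F) (K ×ˢ (Set.univ : Set ℝ))) :
    ContDiffOn ℝ ∞ (Function.uncurry (dy F)) (K ×ˢ (Set.univ : Set ℝ)) :=
  (contDiffOn_fderiv_apply hK hF (0, 1)).congr fun p hp =>
    (hasDerivAt_dy_fderiv hK hF hp.1 p.2).deriv

theorem contDiffOn_dk (hK : IsOpen K)
    (hF : ContDiffOn ℝ ∞ (Function.uncurry F) (K ×ˢ (Set.univ : Set ℝ))) :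
    ContDiffOn ℝ ∞ (Function.uncurry (dk F)) (K ×ˢ (Set.univ : Set ℝ)) :=
  (contDiffOn_fderiv_apply hK hF (1, 0)).congr fun p hp =>
    (hasDerivAt_dk_fderiv hK hF hp.1 p.2).deriv

theorem contDiff_of_mem
    (hF : ContDiffOn ℝ ∞ (Function.uncurry F) (K ×ˢ (Set.univ : Set ℝ))) {k : ℝ} (hk : k ∈ K) :
    ContDiff ℝ ∞ (F k) := by
  have h1 : ContDiff ℝ ∞ (fun y : ℝ => (k, y)) := by fun_prop
  rw [← contDiffOn_univ] at h1 ⊢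
  exact hF.comp h1 fun y _ => ⟨hk, Set.mem_univ y⟩

/-- The mixed partial derivatives agree. -/
theorem hasDerivAt_dk_dy (hK : IsOpen K)
    (hF : ContDiffOn ℝ ∞ (Function.uncurry F) (K ×ˢ (Set.univ : Set ℝ))) {k : ℝ} (hk : k ∈ K)
    (y : ℝ) : HasDerivAt (dk F k) (dk (dy F) k y) y := by
  have hs : IsSymmSndFDerivAt ℝ (Function.uncurry F) (k, y) :=
    (contDiffAt hK hF hk y).isSymmSndFDerivAt (by
      -- Over the reals C² suffices for symmetry of the second derivative.
      rw [minSmoothness_of_isRCLikeNormedField]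
      exact WithTop.coe_le_coe.mpr le_top)
  have hd : DifferentiableAt ℝ (fderiv ℝ (Function.uncurry F)) (k, y) :=
    ((hF.fderiv_of_isOpen (isOpen_prod hK) (by simp)).contDiffAt (n := ∞)
      ((isOpen_prod hK).mem_nhds ⟨hk, Set.mem_univ y⟩)).differentiableAt (by simp)
  have h1 : HasDerivAt (fun y' => fderiv ℝ (Function.uncurry F) (k, y') (1, 0))
      (fderiv ℝ (fderiv ℝ (Function.uncurry F)) (k, y) (0, 1) (1, 0)) y := by
    have h2 : HasDerivAt (fun y' : ℝ => (k, y')) ((0 : ℝ), (1 : ℝ)) y :=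
      (hasDerivAt_const y k).prodMk (hasDerivAt_id y)
    have h3 := hd.hasFDerivAt.comp_hasDerivAt y h2
    simpa using h3.clm_apply (hasDerivAt_const y ((1 : ℝ), (0 : ℝ)))
  have h4 : HasDerivAt (fun k' => fderiv ℝ (Function.uncurry F) (k', y) (0, 1))
      (fderiv ℝ (fderiv ℝ (Function.uncurry F)) (k, y) (1, 0) (0, 1)) k := by
    have h2 : HasDerivAt (fun k' : ℝ => (k', y)) ((1 : ℝ), (0 : ℝ)) k :=
      (hasDerivAt_id k).prodMk (hasDerivAt_const k y)
    have h3 := hd.hasFDerivAt.comp_hasDerivAt (f := fun k' : ℝ => (k', y)) k h2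
    simpa using h3.clm_apply (hasDerivAt_const k ((0 : ℝ), (1 : ℝ)))
  have h5 : dk (dy F) k y = fderiv ℝ (fderiv ℝ (Function.uncurry F)) (k, y) (1, 0) (0, 1) := by
    refine (h4.congr_of_eventuallyEq ?_).deriv
    filter_upwards [hK.mem_nhds hk] with k' hk'
    exact (hasDerivAt_dy_fderiv hK hF hk' y).deriv
  have h6 : dk F k = fun y' => fderiv ℝ (Function.uncurry F) (k, y') (1, 0) :=
    funext fun y' => (hasDerivAt_dk_fderiv hK hF hk y').deriv
  rw [h5, h6, ← hs.eq (0, 1) (1, 0)]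
  exact h1

theorem periodic_dy {k : ℝ} (hp : Function.Periodic (F k) 1) : Function.Periodic (dy F k) 1 := by
  intro y
  simp only [dy]
  rw [← deriv_comp_add_const]
  congr 1
  exact funext hp

theorem periodic_dk (hK : IsOpen K) (hp : ∀ k ∈ K, Function.Periodic (F k) 1) {k : ℝ}
    (hk : k ∈ K) : Function.Periodic (dk F k) 1 := by
  intro y
  refine Filter.EventuallyEq.deriv_eq ?_
  filter_upwards [hK.mem_nhds hk] with k' hk'
  exact hp k' hk' y

/-- Differentiation under the integral sign. -/
theorem hasDerivAt_integral (hK : IsOpen K)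
    (hF : ContDiffOn ℝ ∞ (Function.uncurry F) (K ×ˢ (Set.univ : Set ℝ))) {k : ℝ} (hk : k ∈ K) :
    HasDerivAt (fun k' => ∫ y in (0 : ℝ)..1, F k' y) (∫ y in (0 : ℝ)..1, dk F k y) k := by
  obtain ⟨ε, hε, hball⟩ := Metric.nhds_basis_closedBall.mem_iff.mp (hK.mem_nhds hk)
  -- Compactness of the closed ball times [0, 1] supplies a constant dominating the parameter
  -- derivative.
  have hcont : ContinuousOn (Function.uncurry (dk F)) (Metric.closedBall k ε ×ˢ Set.Icc 0 1) :=
    (contDiffOn_dk hK hF).continuousOn.mono (Set.prod_mono hball (Set.subset_univ _))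
  obtain ⟨C, hC⟩ := ((isCompact_closedBall k ε).prod isCompact_Icc).exists_bound_of_continuousOn
    hcont
  have hc : ∀ k' ∈ K, Continuous (F k') := fun k' hk' => (contDiff_of_mem hF hk').continuous
  refine (intervalIntegral.hasDerivAt_integral_of_dominated_loc_of_deriv_le
    (F := F) (F' := dk F) (bound := fun _ => C) (s := Metric.closedBall k ε)
    (Metric.closedBall_mem_nhds k hε) ?_ ((hc k hk).intervalIntegrable _ _) ?_ ?_
    (intervalIntegrable_const) ?_).2
  · filter_upwards [hK.mem_nhds hk] with k' hk'
    exact (hc k' hk').aestronglyMeasurable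
  · exact (contDiff_of_mem (contDiffOn_dk hK hF) hk).continuous.aestronglyMeasurable
  · refine Filter.Eventually.of_forall fun y hy k' hk' => hC (k', y) ⟨hk', ?_⟩
    rw [Set.uIoc_of_le zero_le_one] at hy
    exact ⟨hy.1.le, hy.2⟩
  · exact Filter.Eventually.of_forall fun y _ k' hk' => hasDerivAt_dk hK hF (hball hk') y

theorem integral_eq_zero_of_hasDerivAt {f f' : ℝ → ℝ} (hp : Function.Periodic f 1)
    (h : ∀ x, HasDerivAt f (f' x) x) (hc : Continuous f') : ∫ x in (0 : ℝ)..1, f' x = 0 := by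
  rw [intervalIntegral.integral_eq_sub_of_hasDerivAt (fun x _ => h x) (hc.intervalIntegrable _ _)]
  have := hp 0
  rw [zero_add] at this
  rw [this, sub_self]

end SmoothFamily

/-! ### Derivatives of the profile equation -/

namespace WaveTrains

open SmoothFamily

variable {δ : ℝ} (W : WaveTrains δ)

/-- The `j`-th space derivative of the profile. -/
def Vd : ℕ → ℝ → ℝ → ℝ
  | 0 => W.V
  | j + 1 => dy (Vd j)

theorem contDiffOn_Vd (j : ℕ) :
    ContDiffOn ℝ ∞ (Function.uncurry (W.Vd j)) (W.K ×ˢ (Set.univ : Set ℝ)) := by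
  induction j with
  | zero => exact W.smooth_V
  | succ j ih => exact contDiffOn_dy W.isOpen_K ih

theorem periodic_Vd {k : ℝ} (hk : k ∈ W.K) (j : ℕ) : Function.Periodic (W.Vd j k) 1 := by
  induction j with
  | zero => exact W.periodic k hk
  | succ j ih => exact periodic_dy ih

theorem iteratedDeriv_V (j : ℕ) (k : ℝ) : iteratedDeriv j (W.V k) = W.Vd j k := by
  induction j with
  | zero => simp [Vd]
  | succ j ih => rw [iteratedDeriv_succ, ih]; rfl

/-- The parameter derivative of the `j`-th space derivative of the profile. -/
def Gd (j : ℕ) : ℝ → ℝ → ℝ := dk (W.Vd j)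

variable {k : ℝ} (hk : k ∈ W.K)
include hk

theorem hasDerivAt_Vd (j : ℕ) (y : ℝ) : HasDerivAt (W.Vd j k) (W.Vd (j + 1) k y) y :=
  hasDerivAt_dy W.isOpen_K (W.contDiffOn_Vd j) hk y

theorem hasDerivAt_Vd_param (j : ℕ) (y : ℝ) :
    HasDerivAt (fun k' => W.Vd j k' y) (W.Gd j k y) k :=
  hasDerivAt_dk W.isOpen_K (W.contDiffOn_Vd j) hk y

theorem hasDerivAt_Gd (j : ℕ) (y : ℝ) : HasDerivAt (W.Gd j k) (W.Gd (j + 1) k y) y :=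
  hasDerivAt_dk_dy W.isOpen_K (W.contDiffOn_Vd j) hk y

theorem contDiff_Vd (j : ℕ) : ContDiff ℝ ∞ (W.Vd j k) := contDiff_of_mem (W.contDiffOn_Vd j) hk

theorem contDiff_Gd (j : ℕ) : ContDiff ℝ ∞ (W.Gd j k) :=
  contDiff_of_mem (contDiffOn_dk W.isOpen_K (W.contDiffOn_Vd j)) hk

theorem periodic_Gd (j : ℕ) : Function.Periodic (W.Gd j k) 1 :=
  periodic_dk W.isOpen_K (fun _ hk' => W.periodic_Vd hk' j) hk

theorem hasDerivAt_c₀ : HasDerivAt W.c₀ (deriv W.c₀ k) k :=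
  ((W.smooth_c₀.contDiffAt (W.isOpen_K.mem_nhds hk)).differentiableAt (by simp)).hasDerivAt

theorem hasDerivAt_q₀ : HasDerivAt W.q₀ (deriv W.q₀ k) k :=
  ((W.smooth_q₀.contDiffAt (W.isOpen_K.mem_nhds hk)).differentiableAt (by simp)).hasDerivAt

theorem profile_Vd (y : ℝ) :
    -W.c₀ k * W.Vd 0 k y + 3 * W.Vd 0 k y ^ 2 + k ^ 2 * W.Vd 2 k y
      + δ * (k * W.Vd 1 k y + k ^ 3 * W.Vd 3 k y) = W.q₀ k := by
  have h := W.profile k hk y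
  rw [iteratedDeriv_V, iteratedDeriv_V] at h
  exact h

theorem profile_dy (y : ℝ) :
    (6 * W.Vd 0 k y - W.c₀ k) * W.Vd 1 k y + k ^ 2 * W.Vd 3 k y
      + δ * (k * W.Vd 2 k y + k ^ 3 * W.Vd 4 k y) = 0 := by
  have h1 := ((((W.hasDerivAt_Vd hk 0 y).const_mul (-W.c₀ k)).add
    (((W.hasDerivAt_Vd hk 0 y).pow 2).const_mul 3)).add
    ((W.hasDerivAt_Vd hk 2 y).const_mul (k ^ 2))).add
    ((((W.hasDerivAt_Vd hk 1 y).const_mul k).add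
      ((W.hasDerivAt_Vd hk 3 y).const_mul (k ^ 3))).const_mul δ)
  have h2 := h1.unique ((hasDerivAt_const y (W.q₀ k)).congr_of_eventuallyEq
    (Filter.Eventually.of_forall fun y => W.profile_Vd hk y))
  simp only [Nat.reduceAdd, Nat.add_one_sub_one, pow_one, Nat.cast_ofNat] at h2
  linear_combination h2

theorem profile_dk (y : ℝ) :
    -deriv W.c₀ k * W.Vd 0 k y + (6 * W.Vd 0 k y - W.c₀ k) * W.Gd 0 k y
      + (k ^ 2 * W.Gd 2 k y + 2 * k * W.Vd 2 k y)
      + δ * (k * W.Gd 1 k y + W.Vd 1 k y + k ^ 3 * W.Gd 3 k y + 3 * k ^ 2 * W.Vd 3 k y)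
      = deriv W.q₀ k := by
  have hV := fun j => W.hasDerivAt_Vd_param hk j y
  have hid := hasDerivAt_id k
  have h1 := ((((W.hasDerivAt_c₀ hk).neg.mul (hV 0)).add (((hV 0).pow 2).const_mul 3)).add
    ((hid.pow 2).mul (hV 2))).add
    (((hid.mul (hV 1)).add ((hid.pow 3).mul (hV 3))).const_mul δ)
  have h2 := h1.unique ((W.hasDerivAt_q₀ hk).congr_of_eventuallyEq (by
    filter_upwards [W.isOpen_K.mem_nhds hk] with k' hk'
    exact W.profile_Vd hk' y))
  simp only [Pi.neg_apply, id_eq, Nat.add_one_sub_one, pow_one, Nat.cast_ofNat, mul_one,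
    Pi.pow_apply] at h2
  linear_combination h2

/-- Combined with `profile_dy`, this becomes the solvability relation for the wavenumber direction,
L₀(k∂ₖU) + L₁U' = k²c₀'U'. -/
theorem profile_dk_dy (y : ℝ) :
    -deriv W.c₀ k * W.Vd 1 k y + 6 * W.Vd 1 k y * W.Gd 0 k y
      + (6 * W.Vd 0 k y - W.c₀ k) * W.Gd 1 k y
      + (k ^ 2 * W.Gd 3 k y + 2 * k * W.Vd 3 k y)
      + δ * (k * W.Gd 2 k y + W.Vd 2 k y + k ^ 3 * W.Gd 4 k y + 3 * k ^ 2 * W.Vd 4 k y) = 0 := by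
  have hV := fun j => W.hasDerivAt_Vd hk j y
  have hG := fun j => W.hasDerivAt_Gd hk j y
  have h1 := ((((hV 0).const_mul (-deriv W.c₀ k)).add
    ((((hV 0).const_mul 6).sub_const (W.c₀ k)).mul (hG 0))).add
    (((hG 2).const_mul (k ^ 2)).add ((hV 2).const_mul (2 * k)))).add
    ((((((hG 1).const_mul k).add (hV 1)).add ((hG 3).const_mul (k ^ 3))).add
      ((hV 3).const_mul (3 * k ^ 2))).const_mul δ)
  have h2 := h1.unique ((hasDerivAt_const y (deriv W.q₀ k)).congr_of_eventuallyEq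
    (Filter.Eventually.of_forall fun y => W.profile_dk hk y))
  simp only [Nat.reduceAdd, zero_add] at h2
  linear_combination h2

theorem integral_Vd_zero : ∫ y in (0 : ℝ)..1, W.Vd 0 k y = 0 := W.mean_zero k hk

theorem integral_Vd_succ (j : ℕ) : ∫ y in (0 : ℝ)..1, W.Vd (j + 1) k y = 0 :=
  integral_eq_zero_of_hasDerivAt (W.periodic_Vd hk j) (W.hasDerivAt_Vd hk j)
    (W.contDiff_Vd hk (j + 1)).continuous

theorem integral_Gd_succ (j : ℕ) : ∫ y in (0 : ℝ)..1, W.Gd (j + 1) k y = 0 :=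
  integral_eq_zero_of_hasDerivAt (W.periodic_Gd hk j) (W.hasDerivAt_Gd hk j)
    (W.contDiff_Gd hk (j + 1)).continuous

theorem integral_Gd_zero : ∫ y in (0 : ℝ)..1, W.Gd 0 k y = 0 := by
  have h1 := hasDerivAt_integral W.isOpen_K (W.contDiffOn_Vd 0) hk
  refine h1.unique ((hasDerivAt_const k (0 : ℝ)).congr_of_eventuallyEq ?_)
  filter_upwards [W.isOpen_K.mem_nhds hk] with k' hk'
  exact W.integral_Vd_zero hk'

theorem intervalIntegrable_Vd (j : ℕ) (a b : ℝ) :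
    IntervalIntegrable (W.Vd j k) MeasureTheory.volume a b :=
  (W.contDiff_Vd hk j).continuous.intervalIntegrable a b

theorem intervalIntegrable_Gd (j : ℕ) (a b : ℝ) :
    IntervalIntegrable (W.Gd j k) MeasureTheory.volume a b :=
  (W.contDiff_Gd hk j).continuous.intervalIntegrable a b

/-- The mean of the profile equation. -/
theorem integral_sq : ∫ y in (0 : ℝ)..1, 3 * W.Vd 0 k y ^ 2 = W.q₀ k := by
  have h1 : ∀ y, 3 * W.Vd 0 k y ^ 2 = W.q₀ k + W.c₀ k * W.Vd 0 k y - k ^ 2 * W.Vd 2 k y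
      - δ * k * W.Vd 1 k y - δ * k ^ 3 * W.Vd 3 k y := fun y => by
    linear_combination W.profile_Vd hk y
  have hV := fun j => W.intervalIntegrable_Vd hk j 0 1
  simp only [h1]
  have h0 : IntervalIntegrable (fun _ : ℝ => W.q₀ k) MeasureTheory.volume 0 1 :=
    intervalIntegrable_const
  have i1 := h0.add ((hV 0).const_mul (W.c₀ k))
  have i2 := i1.sub ((hV 2).const_mul (k ^ 2))
  have i3 := i2.sub ((hV 1).const_mul (δ * k))
  rw [intervalIntegral.integral_sub i3 ((hV 3).const_mul _),
    intervalIntegral.integral_sub i2 ((hV 1).const_mul _),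
    intervalIntegral.integral_sub i1 ((hV 2).const_mul _),
    intervalIntegral.integral_add h0 ((hV 0).const_mul _)]
  simp only [intervalIntegral.integral_const_mul, W.integral_Vd_zero hk, W.integral_Vd_succ hk]
  simp

/-- The mean of the parameter derivative of the profile equation. -/
theorem integral_mul_Gd :
    ∫ y in (0 : ℝ)..1, (6 * W.Vd 0 k y - W.c₀ k) * W.Gd 0 k y = deriv W.q₀ k := by
  have h1 : ∀ y, (6 * W.Vd 0 k y - W.c₀ k) * W.Gd 0 k y
      = deriv W.q₀ k + deriv W.c₀ k * W.Vd 0 k y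
        - (k ^ 2 * W.Gd 2 k y + 2 * k * W.Vd 2 k y)
        - (δ * k * W.Gd 1 k y + δ * W.Vd 1 k y)
        - (δ * k ^ 3 * W.Gd 3 k y + δ * (3 * k ^ 2) * W.Vd 3 k y) := fun y => by
    linear_combination W.profile_dk hk y
  have hV := fun j c => (W.intervalIntegrable_Vd hk j 0 1).const_mul c
  have hG := fun j c => (W.intervalIntegrable_Gd hk j 0 1).const_mul c
  simp only [h1]
  have h0 : IntervalIntegrable (fun _ : ℝ => deriv W.q₀ k) MeasureTheory.volume 0 1 :=
    intervalIntegrable_const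
  have i1 := h0.add (hV 0 (deriv W.c₀ k))
  have j2 := (hG 2 (k ^ 2)).add (hV 2 (2 * k))
  have j3 := (hG 1 (δ * k)).add (hV 1 δ)
  have j4 := (hG 3 (δ * k ^ 3)).add (hV 3 (δ * (3 * k ^ 2)))
  rw [intervalIntegral.integral_sub ((i1.sub j2).sub j3) j4,
    intervalIntegral.integral_sub (i1.sub j2) j3, intervalIntegral.integral_sub i1 j2,
    intervalIntegral.integral_add h0 (hV 0 _), intervalIntegral.integral_add (hG 2 _) (hV 2 _),
    intervalIntegral.integral_add (hG 1 _) (hV 1 _),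
    intervalIntegral.integral_add (hG 3 _) (hV 3 _)]
  simp only [intervalIntegral.integral_const_mul, W.integral_Vd_zero hk, W.integral_Vd_succ hk,
    W.integral_Gd_succ hk]
  simp

theorem integral_coeff : ∫ y in (0 : ℝ)..1, (6 * W.Vd 0 k y - W.c₀ k) = -W.c₀ k := by
  rw [intervalIntegral.integral_sub ((W.intervalIntegrable_Vd hk 0 0 1).const_mul 6)
    intervalIntegrable_const]
  simp [W.integral_Vd_zero hk]

theorem avgFlux_eq (M : ℝ) : W.avgFlux k M = W.q₀ k + 3 * M ^ 2 := by
  have h1 : ∀ y, 3 * W.U k M y ^ 2 = 3 * M ^ 2 + 6 * M * W.Vd 0 k y + 3 * W.Vd 0 k y ^ 2 :=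
    fun y => by simp only [U, Vd]; ring
  have hV := W.intervalIntegrable_Vd hk 0 0 1
  have hV2 : IntervalIntegrable (fun y => 3 * W.Vd 0 k y ^ 2) MeasureTheory.volume 0 1 := by
    have := (W.contDiff_Vd hk 0).continuous
    exact Continuous.intervalIntegrable (by fun_prop) _ _
  have h0 : IntervalIntegrable (fun _ : ℝ => 3 * M ^ 2) MeasureTheory.volume 0 1 :=
    intervalIntegrable_const
  simp only [avgFlux, h1]
  rw [intervalIntegral.integral_add (h0.add (hV.const_mul (6 * M))) hV2,
    intervalIntegral.integral_add h0 (hV.const_mul _), W.integral_sq hk]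
  simp [W.integral_Vd_zero hk]
  ring

end WaveTrains

end

noncomputable section

/-! ### The Bloch operators as an operator pencil on continuous periodic functions -/

namespace WaveTrains

open PeriodicCalculus SmoothFamily

variable {δ : ℝ} (W : WaveTrains δ)

theorem blochD_eq {f f' : ℝ → ℂ} (h : ∀ x, HasDerivAt f (f' x) x) (ν : ℂ) :
    blochD ν f = fun x => f' x + ν * f x :=
  funext fun x => by rw [blochD, (h x).deriv]

/-- The Bloch operator, expanded in powers of the Bloch parameter. -/
theorem blochOp_eq {k M : ℝ} {q' : ℝ → ℂ} {f : ℕ → ℝ → ℂ}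
    (hq : ∀ x, HasDerivAt (fun y => ((6 * W.U k M y - W.c k M : ℝ) : ℂ)) (q' x) x)
    (hf : ∀ j < 4, ∀ x, HasDerivAt (f j) (f (j + 1) x) x) (ν : ℂ) (x : ℝ) :
    W.blochOp k M ν (f 0) x
      = k * (q' x * f 0 x + ((6 * W.U k M x - W.c k M : ℝ) : ℂ) * f 1 x
          + ν * (((6 * W.U k M x - W.c k M : ℝ) : ℂ) * f 0 x))
        + k ^ 3 * (f 3 x + 3 * ν * f 2 x + 3 * ν ^ 2 * f 1 x + ν ^ 3 * f 0 x)
        + δ * (k ^ 2 * (f 2 x + 2 * ν * f 1 x + ν ^ 2 * f 0 x)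
          + k ^ 4 * (f 4 x + 4 * ν * f 3 x + 6 * ν ^ 2 * f 2 x + 4 * ν ^ 3 * f 1 x
            + ν ^ 4 * f 0 x)) := by
  have h0 := hf 0 (by norm_num)
  have h1 := hf 1 (by norm_num)
  have h2 := hf 2 (by norm_num)
  have h3 := hf 3 (by norm_num)
  simp only [Nat.reduceAdd] at h0 h1 h2 h3
  have e1 := blochD_eq h0 ν
  have e2 := blochD_eq (fun x => (h1 x).fun_add ((h0 x).const_mul ν)) ν
  have e3 := blochD_eq (fun x => ((h2 x).fun_add ((h1 x).const_mul ν)).fun_add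
    (((h1 x).fun_add ((h0 x).const_mul ν)).const_mul ν)) ν
  have e4 := blochD_eq (fun x => (((h3 x).fun_add ((h2 x).const_mul ν)).fun_add
    (((h2 x).fun_add ((h1 x).const_mul ν)).const_mul ν)).fun_add
      ((((h2 x).fun_add ((h1 x).const_mul ν)).fun_add
    (((h1 x).fun_add ((h0 x).const_mul ν)).const_mul ν)).const_mul ν)) ν
  have eq := blochD_eq (fun x => (hq x).fun_mul (h0 x)) ν
  have i2 : (blochD ν)^[2] (f 0) = blochD ν (blochD ν (f 0)) := rfl
  have i3 : (blochD ν)^[3] (f 0) = blochD ν (blochD ν (blochD ν (f 0))) := rfl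
  have i4 : (blochD ν)^[4] (f 0) = blochD ν (blochD ν (blochD ν (blochD ν (f 0)))) := rfl
  simp only [blochOp, i2, i3, i4]
  rw [eq, e1, e2, e3, e4]
  ring

variable {k : ℝ} (hk : k ∈ W.K)

theorem U_eq (k M y : ℝ) : W.U k M y = M + W.Vd 0 k y := rfl

theorem coeff_eq (k M y : ℝ) : 6 * W.U k M y - W.c k M = 6 * W.Vd 0 k y - W.c₀ k := by
  simp only [U_eq, c]; ring

theorem deriv_U (k M y : ℝ) : deriv (W.U k M) y = W.Vd 1 k y :=
  deriv_const_add' M (f := W.V k) ▸ rfl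

theorem deriv_U_param (k M y : ℝ) : deriv (fun k' => W.U k' M y) k = W.Gd 0 k y :=
  deriv_const_add' M (f := fun k' => W.V k' y) ▸ rfl

theorem deriv_U_mean (k M y : ℝ) : deriv (fun M' => W.U k M' y) M = 1 := by
  simp [U]

include hk

theorem exists_per_Vd (j : ℕ) : ∃ g : PerC, per g = fun x => (W.Vd j k x : ℂ) :=
  exists_per_eq (Complex.continuous_ofReal.comp (W.contDiff_Vd hk j).continuous)
    (fun x => by simp only [W.periodic_Vd hk j x])

theorem hasDerivAt_coeff (M x : ℝ) :
    HasDerivAt (fun y => ((6 * W.U k M y - W.c k M : ℝ) : ℂ)) ((6 * W.Vd 1 k x : ℝ) : ℂ) x := by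
  simp only [coeff_eq]
  exact (((W.hasDerivAt_Vd hk 0 x).const_mul 6).sub_const (W.c₀ k)).ofReal_comp

/-- Multiplication by the coefficient `6U - c`. -/
def coeffMul : PerC →L[ℂ] PerC :=
  ContinuousLinearMap.mul ℂ PerC ((6 : ℂ) • (W.exists_per_Vd hk 0).choose - (W.c₀ k : ℂ) • 1)

/-- Multiplication by the derivative of the coefficient `6U - c`. -/
def coeffDerivMul : PerC →L[ℂ] PerC :=
  ContinuousLinearMap.mul ℂ PerC ((6 : ℂ) • (W.exists_per_Vd hk 1).choose)

theorem per_coeffMul (g : PerC) (x : ℝ) :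
    per (W.coeffMul hk g) x = ((6 * W.Vd 0 k x - W.c₀ k : ℝ) : ℂ) * per g x := by
  have h := congrFun (W.exists_per_Vd hk 0).choose_spec x
  have h1 : per (W.coeffMul hk g) x
      = ((6 : ℂ) * per (W.exists_per_Vd hk 0).choose x - (W.c₀ k : ℂ) * 1) * per g x := rfl
  rw [h1, h]
  push_cast
  ring

theorem per_coeffDerivMul (g : PerC) (x : ℝ) :
    per (W.coeffDerivMul hk g) x = ((6 * W.Vd 1 k x : ℝ) : ℂ) * per g x := by
  have h := congrFun (W.exists_per_Vd hk 1).choose_spec x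
  have h1 : per (W.coeffDerivMul hk g) x
      = ((6 : ℂ) * per (W.exists_per_Vd hk 1).choose x) * per g x := rfl
  rw [h1, h]
  push_cast
  ring

/-- The coefficients bloch₀, …, bloch₄ are those of ν⁰, …, ν⁴ in `blochOp_eq`, with T j in place of
the j-th derivative. The term with `coeffDerivMul` comes from the product rule for (6U - c)f. -/
def bloch₀ : PerC →L[ℂ] PerC :=
  (k : ℂ) • (W.coeffDerivMul hk * T 0 + W.coeffMul hk * T 1) + (k : ℂ) ^ 3 • T 3
    + (δ : ℂ) • ((k : ℂ) ^ 2 • T 2 + (k : ℂ) ^ 4 • T 4)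

def bloch₁ : PerC →L[ℂ] PerC :=
  (k : ℂ) • (W.coeffMul hk * T 0) + (3 * (k : ℂ) ^ 3) • T 2
    + (δ : ℂ) • ((2 * (k : ℂ) ^ 2) • T 1 + (4 * (k : ℂ) ^ 4) • T 3)

omit hk in
def bloch₂ (δ k : ℝ) : PerC →L[ℂ] PerC :=
  (3 * (k : ℂ) ^ 3) • T 1 + (δ : ℂ) • ((k : ℂ) ^ 2 • T 0 + (6 * (k : ℂ) ^ 4) • T 2)

def bloch₃ (δ k : ℝ) : PerC →L[ℂ] PerC :=
  (k : ℂ) ^ 3 • T 0 + (δ : ℂ) • ((4 * (k : ℂ) ^ 4) • T 1)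

def bloch₄ (δ k : ℝ) : PerC →L[ℂ] PerC := (δ : ℂ) • ((k : ℂ) ^ 4 • T 0)

theorem per_bloch₀ (g : PerC) (x : ℝ) : per (W.bloch₀ hk g) x
    = k * (((6 * W.Vd 1 k x : ℝ) : ℂ) * per (T 0 g) x
        + ((6 * W.Vd 0 k x - W.c₀ k : ℝ) : ℂ) * per (T 1 g) x) + k ^ 3 * per (T 3 g) x
      + δ * (k ^ 2 * per (T 2 g) x + k ^ 4 * per (T 4 g) x) := by
  rw [← per_coeffMul W hk, ← per_coeffDerivMul W hk]; rfl

theorem per_bloch₁ (g : PerC) (x : ℝ) : per (W.bloch₁ hk g) x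
    = k * (((6 * W.Vd 0 k x - W.c₀ k : ℝ) : ℂ) * per (T 0 g) x) + 3 * k ^ 3 * per (T 2 g) x
      + δ * (2 * k ^ 2 * per (T 1 g) x + 4 * k ^ 4 * per (T 3 g) x) := by
  rw [← per_coeffMul W hk]; rfl

/-- The pencil `A₀ + ν A₁ + ν² A₂ + ν³ A₃ + ν⁴ A₄ + λ T₀`. -/
def pencil (p : ℂ × ℂ) : PerC →L[ℂ] PerC :=
  W.bloch₀ hk + p.1 • W.bloch₁ hk + p.1 ^ 2 • bloch₂ δ k + p.1 ^ 3 • bloch₃ δ k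
    + p.1 ^ 4 • bloch₄ δ k + p.2 • T 0

/-- The mean M is absent from the pencil because 6U - c does not depend on it: the shifts of U and
of c cancel. -/
theorem per_pencil (M : ℝ) (p : ℂ × ℂ) (g : PerC) (x : ℝ) : per (W.pencil hk p g) x
    = W.blochOp k M p.1 (per (T 0 g)) x + p.2 * per (T 0 g) x := by
  have h1 : per (W.pencil hk p g) x = per (W.bloch₀ hk g) x + p.1 * per (W.bloch₁ hk g) x
      + p.1 ^ 2 * (3 * k ^ 3 * per (T 1 g) x
        + δ * (k ^ 2 * per (T 0 g) x + 6 * k ^ 4 * per (T 2 g) x))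
      + p.1 ^ 3 * (k ^ 3 * per (T 0 g) x + δ * (4 * k ^ 4 * per (T 1 g) x))
      + p.1 ^ 4 * (δ * (k ^ 4 * per (T 0 g) x)) + p.2 * per (T 0 g) x := rfl
  rw [h1, per_bloch₀, per_bloch₁,
    W.blochOp_eq (f := fun j => per (T j g)) (W.hasDerivAt_coeff hk M)
      (fun j hj x => hasDerivAt_T hj g x), coeff_eq]
  ring

/-- As δk⁴ ≠ 0, the equation can be solved for T 4 g in terms of the smoother T j g with j < 4, and
bootstrapping applies. -/
theorem contDiff_of_pencil (hδ : 0 < δ) {p : ℂ × ℂ} {g : PerC} (hg : W.pencil hk p g = 0) :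
    ContDiff ℝ ∞ (per g) := by
  refine contDiff_of_T_four fun n hn => ?_
  have hc : (δ : ℂ) * (k : ℂ) ^ 4 ≠ 0 := by
    have := W.pos k hk
    exact_mod_cast (by positivity : δ * k ^ 4 ≠ 0)
  have hq : ContDiff ℝ n fun x => ((6 * W.Vd 0 k x - W.c₀ k : ℝ) : ℂ) := by
    have h1 := (W.contDiff_Vd hk 0).of_le (m := (n : WithTop ℕ∞)) (by exact_mod_cast le_top)
    have h2 : ContDiff ℝ n fun x => 6 * W.Vd 0 k x - W.c₀ k := by fun_prop
    exact Complex.ofRealCLM.contDiff.comp h2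
  have hq' : ContDiff ℝ n fun x => ((6 * W.Vd 1 k x : ℝ) : ℂ) := by
    have h1 := (W.contDiff_Vd hk 1).of_le (m := (n : WithTop ℕ∞)) (by exact_mod_cast le_top)
    have h2 : ContDiff ℝ n fun x => 6 * W.Vd 1 k x := by fun_prop
    exact Complex.ofRealCLM.contDiff.comp h2
  have h0 := hn 0 (by norm_num)
  have h1 := hn 1 (by norm_num)
  have h2 := hn 2 (by norm_num)
  have h3 := hn 3 (by norm_num)
  have h4 : per (T 4 g) = fun x => -((δ : ℂ) * (k : ℂ) ^ 4)⁻¹ *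
      (k * (((6 * W.Vd 1 k x : ℝ) : ℂ) * per (T 0 g) x
        + ((6 * W.Vd 0 k x - W.c₀ k : ℝ) : ℂ) * per (T 1 g) x) + k ^ 3 * per (T 3 g) x
      + δ * (k ^ 2 * per (T 2 g) x)
      + p.1 * (k * (((6 * W.Vd 0 k x - W.c₀ k : ℝ) : ℂ) * per (T 0 g) x)
        + 3 * k ^ 3 * per (T 2 g) x + δ * (2 * k ^ 2 * per (T 1 g) x + 4 * k ^ 4 * per (T 3 g) x))
      + p.1 ^ 2 * (3 * k ^ 3 * per (T 1 g) x
        + δ * (k ^ 2 * per (T 0 g) x + 6 * k ^ 4 * per (T 2 g) x))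
      + p.1 ^ 3 * (k ^ 3 * per (T 0 g) x + δ * (4 * k ^ 4 * per (T 1 g) x))
      + p.1 ^ 4 * (δ * (k ^ 4 * per (T 0 g) x)) + p.2 * per (T 0 g) x) := by
    funext x
    have h5 : per (W.bloch₀ hk g) x + p.1 * per (W.bloch₁ hk g) x
      + p.1 ^ 2 * (3 * k ^ 3 * per (T 1 g) x
        + δ * (k ^ 2 * per (T 0 g) x + 6 * k ^ 4 * per (T 2 g) x))
      + p.1 ^ 3 * (k ^ 3 * per (T 0 g) x + δ * (4 * k ^ 4 * per (T 1 g) x))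
      + p.1 ^ 4 * (δ * (k ^ 4 * per (T 0 g) x)) + p.2 * per (T 0 g) x = 0 :=
      congrArg (fun g => per g x) hg
    rw [per_bloch₀, per_bloch₁] at h5
    rw [neg_mul, eq_neg_iff_add_eq_zero, ← mul_right_inj' hc, mul_add, mul_inv_cancel_left₀ hc,
      mul_zero]
    linear_combination h5
  rw [h4]
  fun_prop

/-- Kernel elements of the pencil give Bloch eigenpairs. -/
theorem isBlochEigenpair_of_pencil (hδ : 0 < δ) (M : ℝ) {ν lam : ℂ} {g : PerC}
    (hg : W.pencil hk (ν, lam) g = 0) (hg0 : g ≠ 0) :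
    W.IsBlochEigenpair k M ν lam (per (T 0 g)) := by
  refine ⟨contDiff_T_zero (W.contDiff_of_pencil hk hδ hg), periodic_per _, ?_, fun x => ?_⟩
  · intro h
    refine hg0 (T_zero_injective (per_injective ?_))
    rw [h, map_zero]
    rfl
  · have h := W.per_pencil hk M (ν, lam) g x
    rw [hg] at h
    have h0 : per (0 : PerC) x = 0 := rfl
    rw [h0] at h
    linear_combination -h

/-- Bloch eigenpairs come from kernel elements of the pencil. -/
theorem exists_of_isBlochEigenpair {M : ℝ} {ν lam : ℂ} {f : ℝ → ℂ}
    (hf : W.IsBlochEigenpair k M ν lam f) :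
    ∃ g : PerC, per (T 0 g) = f ∧ g ≠ 0 ∧ W.pencil hk (ν, lam) g = 0 := by
  obtain ⟨h1, h2, h3, h4⟩ := hf
  obtain ⟨g, hg⟩ := exists_T_zero_eq h1 h2
  refine ⟨g, hg, ?_, ?_⟩
  · rintro rfl
    apply h3
    rw [← hg, map_zero]
    rfl
  · apply per_injective
    funext x
    rw [W.per_pencil hk M, hg, h4]
    have h0 : per (0 : PerC) x = 0 := rfl
    rw [h0]
    ring

/-- The linearized equation is in conservation form, so at ν = 0 the operator produces an exact
derivative of a periodic function. -/
theorem mean_bloch₀ (g : PerC) : mean (W.bloch₀ hk g) = 0 := by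
  have hd : ∀ x, HasDerivAt (fun y => k * (((6 * W.Vd 0 k y - W.c₀ k : ℝ) : ℂ) * per (T 0 g) y)
      + k ^ 3 * per (T 2 g) y + δ * (k ^ 2 * per (T 1 g) y + k ^ 4 * per (T 3 g) y))
      (per (W.bloch₀ hk g) x) x := by
    intro x
    have hq := W.hasDerivAt_coeff hk 0 x
    simp only [coeff_eq] at hq
    have hT := fun j hj => hasDerivAt_T (j := j) hj g x
    have h := (((hq.mul (hT 0 (by norm_num))).const_mul (k : ℂ)).add
      ((hT 2 (by norm_num)).const_mul ((k : ℂ) ^ 3))).add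
      ((((hT 1 (by norm_num)).const_mul ((k : ℂ) ^ 2)).add
        ((hT 3 (by norm_num)).const_mul ((k : ℂ) ^ 4))).const_mul (δ : ℂ))
    refine h.congr_deriv ?_
    rw [per_bloch₀]
  refine mean_eq_zero_of_hasDerivAt (fun x => ?_) hd
  simp only [periodic_per _ x, W.periodic_Vd hk 0 x]

theorem mean_coeffMul {g : PerC} {f : ℝ → ℝ} (hg : per g = fun x => (f x : ℂ)) :
    mean (W.coeffMul hk g) = ((∫ x in (0 : ℝ)..1, (6 * W.Vd 0 k x - W.c₀ k) * f x : ℝ) : ℂ) := by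
  rw [mean_apply, ← intervalIntegral.integral_ofReal]
  congr 1
  funext x
  rw [per_coeffMul, hg]
  push_cast
  ring

omit hk in
theorem mean_of_real {g : PerC} {f : ℝ → ℝ} (hg : per g = fun x => (f x : ℂ)) :
    mean g = ((∫ x in (0 : ℝ)..1, f x : ℝ) : ℂ) := by
  rw [mean_apply, hg, intervalIntegral.integral_ofReal]

theorem mean_bloch₁ (g : PerC) : mean (W.bloch₁ hk g) = k * mean (W.coeffMul hk (T 0 g)) := by
  have h1 : W.bloch₁ hk g = (k : ℂ) • W.coeffMul hk (T 0 g) + (3 * (k : ℂ) ^ 3) • T (1 + 1) g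
    + (δ : ℂ) • ((2 * (k : ℂ) ^ 2) • T (0 + 1) g + (4 * (k : ℂ) ^ 4) • T (2 + 1) g) := rfl
  rw [h1]
  simp only [map_add, map_smul, smul_eq_mul]
  rw [mean_T_succ (by norm_num), mean_T_succ (by norm_num), mean_T_succ (by norm_num)]
  ring

omit hk in
theorem mean_bloch₂ (g : PerC) : mean (bloch₂ δ k g) = δ * (k ^ 2 * mean (T 0 g)) := by
  have h1 : bloch₂ δ k g = (3 * (k : ℂ) ^ 3) • T (0 + 1) g
    + (δ : ℂ) • ((k : ℂ) ^ 2 • T 0 g + (6 * (k : ℂ) ^ 4) • T (1 + 1) g) := rfl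
  rw [h1]
  simp only [map_add, map_smul, smul_eq_mul]
  rw [mean_T_succ (by norm_num), mean_T_succ (by norm_num)]
  ring

end WaveTrains

end

/-! ### The wave train as an instance of the abstract reduction -/

noncomputable section

namespace WaveTrains

open PeriodicCalculus SmoothFamily

variable {δ : ℝ} (W : WaveTrains δ)

theorem zero_smul_perC (g : PerC) : (0 : ℂ) • g = 0 := by
  ext x
  simp

theorem isCompactOperator_smulRight (ℓ : PerC →L[ℂ] ℂ) (e : PerC) :
    IsCompactOperator (ℓ.smulRight e) := by
  have h := isCompactOperator_of_locallyCompactSpace_dom ℓ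
  exact h.clm_comp (ContinuousLinearMap.toSpanSingleton ℂ e)

variable {k : ℝ} (hk : k ∈ W.K)
include hk

theorem isCompactOperator_lower (ℓ : PerC →L[ℂ] ℂ) (e : PerC) :
    IsCompactOperator (W.bloch₀ hk + ℓ.smulRight e - ((δ : ℂ) * (k : ℂ) ^ 4) • T 4 :
      PerC →L[ℂ] PerC) := by
  have h1 : (W.bloch₀ hk + ℓ.smulRight e - ((δ : ℂ) * (k : ℂ) ^ 4) • T 4 : PerC →L[ℂ] PerC)
      = (k : ℂ) • (W.coeffDerivMul hk * T 0) + (k : ℂ) • (W.coeffMul hk * T 1)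
        + (k : ℂ) ^ 3 • T 3 + ((δ : ℂ) * (k : ℂ) ^ 2) • T 2 + ℓ.smulRight e := by
    rw [bloch₀]
    module
  have hT := fun j hj => isCompactOperator_T (j := j) hj
  have c0 : IsCompactOperator ((k : ℂ) • (W.coeffDerivMul hk * T 0) : PerC →L[ℂ] PerC) :=
    ((hT 0 (by norm_num)).clm_comp (W.coeffDerivMul hk)).smul (k : ℂ)
  have c1 : IsCompactOperator ((k : ℂ) • (W.coeffMul hk * T 1) : PerC →L[ℂ] PerC) :=
    ((hT 1 (by norm_num)).clm_comp (W.coeffMul hk)).smul (k : ℂ)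
  have c3 : IsCompactOperator ((k : ℂ) ^ 3 • T 3 : PerC →L[ℂ] PerC) :=
    (hT 3 (by norm_num)).smul ((k : ℂ) ^ 3)
  have c2 : IsCompactOperator (((δ : ℂ) * (k : ℂ) ^ 2) • T 2 : PerC →L[ℂ] PerC) :=
    (hT 2 (by norm_num)).smul ((δ : ℂ) * (k : ℂ) ^ 2)
  rw [h1]
  exact (((c0.add c1).add c3).add c2).add (isCompactOperator_smulRight ℓ e)

theorem Vd_one_ne_zero {M : ℝ} (hker : W.KernelSpannedByTranslation k M) :
    ∃ x, W.Vd 1 k x ≠ 0 := by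
  by_contra! h
  -- If U' vanished, constants would lie in the kernel, which would then be spanned by the zero
  -- function.
  have h1 : ∀ x, W.blochOp k M 0 (fun _ => 1) x = 0 := by
    intro x
    have h2 := W.blochOp_eq (f := fun j _ => if j = 0 then 1 else 0) (W.hasDerivAt_coeff hk M)
      (fun j _ x => by simpa using hasDerivAt_const x _) 0 x
    simp only [if_true] at h2
    rw [h2, h x]
    simp
  obtain ⟨a, ha⟩ := hker (fun _ => 1) contDiff_const (fun _ => rfl) h1
  have := ha 0
  rw [deriv_U, h 0] at this
  simp at this

/-- The derivative `U'` solves the linearized equation. -/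
theorem blochOp_translation (x : ℝ) :
    k * (6 * W.Vd 1 k x * W.Vd 1 k x + (6 * W.Vd 0 k x - W.c₀ k) * W.Vd 2 k x)
      + k ^ 3 * W.Vd 4 k x + δ * (k ^ 2 * W.Vd 3 k x + k ^ 4 * W.Vd 5 k x) = 0 := by
  have hV := fun j => W.hasDerivAt_Vd hk j x
  have h1 := ((((((hV 0).const_mul 6).sub_const (W.c₀ k)).mul (hV 1)).add
    ((hV 3).const_mul (k ^ 2))).add
    ((((hV 2).const_mul k).add ((hV 4).const_mul (k ^ 3))).const_mul δ))
  have h2 := h1.unique ((hasDerivAt_const x (0 : ℝ)).congr_of_eventuallyEq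
    (Filter.Eventually.of_forall fun y => W.profile_dy hk y))
  simp only [Nat.reduceAdd, zero_add] at h2
  linear_combination k * h2

/-- The Bloch pencil of a wave train whose kernel is spanned by the translation mode. -/
theorem exists_bifurcationData (hδ : 0 < δ) {M : ℝ} (hker : W.KernelSpannedByTranslation k M) :
    ∃ B : BifurcationData PerC, (∀ p, B.A p = W.pencil hk p) ∧ B.a = 6 * k ∧
      B.b = k ^ 2 * deriv W.c₀ k ∧ B.p₀ = k ^ 2 * deriv W.q₀ k ∧ B.p₁ = -(k * W.c₀ k) ∧
      per (T 0 B.φ) = (fun x => (W.Vd 1 k x : ℂ)) ∧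
      per (T 0 B.ψ) = (fun x => ((k * W.Gd 0 k x : ℝ) : ℂ)) ∧ B.e = 1 := by
  have hkpos : 0 < k := W.pos k hk
  have hkC : (k : ℂ) ≠ 0 := by exact_mod_cast hkpos.ne'
  obtain ⟨φ, hφ⟩ := exists_T_zero_eq (f := fun x => (W.Vd 1 k x : ℂ))
    (Complex.ofRealCLM.contDiff.comp (W.contDiff_Vd hk 1))
    (fun x => by simp only [W.periodic_Vd hk 1 x])
  obtain ⟨ψ, hψ⟩ := exists_T_zero_eq (f := fun x => ((k * W.Gd 0 k x : ℝ) : ℂ))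
    (Complex.ofRealCLM.contDiff.comp (contDiff_const.mul (W.contDiff_Gd hk 0)))
    (fun x => by simp only [W.periodic_Gd hk 0 x])
  have hφj : ∀ j ≤ 4, per (T j φ) = fun x => (W.Vd (j + 1) k x : ℂ) := by
    intro j hj
    induction j with
    | zero => exact hφ
    | succ j ih =>
      funext x
      have h1 := hasDerivAt_T (j := j) (by omega) φ x
      rw [ih (by omega)] at h1
      exact h1.unique (W.hasDerivAt_Vd hk (j + 1) x).ofReal_comp
  have hψj : ∀ j ≤ 4, per (T j ψ) = fun x => ((k * W.Gd j k x : ℝ) : ℂ) := by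
    intro j hj
    induction j with
    | zero => exact hψ
    | succ j ih =>
      funext x
      have h1 := hasDerivAt_T (j := j) (by omega) ψ x
      rw [ih (by omega)] at h1
      exact h1.unique ((W.hasDerivAt_Gd hk j x).const_mul k).ofReal_comp
  have hone : per (1 : PerC) = fun _ => ((1 : ℝ) : ℂ) := by
    funext x; rw [Complex.ofReal_one]; rfl
  have hzero : per (0 : PerC) = fun _ => 0 := rfl
  have hφ0 : φ ≠ 0 := by
    rintro rfl
    obtain ⟨x, hx⟩ := W.Vd_one_ne_zero hk hker
    apply hx
    have := congrFun hφ x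
    rw [map_zero, hzero] at this
    exact Complex.ofReal_eq_zero.mp this.symm
  -- Any functional normalized on φ will do: at the origin ℓ composed with the bordered inverse is
  -- the mean anyway.
  obtain ⟨ℓ, hℓ⟩ := SeparatingDual.exists_eq_one (R := ℂ) hφ0
  have hA₀φ : W.bloch₀ hk φ = 0 := by
    apply per_injective
    funext x
    rw [per_bloch₀, hzero, hφj 0 (by norm_num), hφj 1 (by norm_num), hφj 2 (by norm_num),
      hφj 3 (by norm_num), hφj 4 (by norm_num)]
    have h := W.blochOp_translation hk x
    simp only [Nat.reduceAdd, zero_add] at h ⊢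
    have h' := congrArg (fun t : ℝ => (t : ℂ)) h
    push_cast at h' ⊢
    linear_combination h'
  have hpencil0 : ∀ g, W.pencil hk (0, 0) g = W.bloch₀ hk g := fun g => by simp [pencil]
  have hunit : IsUnit (W.bloch₀ hk + ℓ.smulRight (1 : PerC)) := by
    refine isUnit_of_injective (c := (δ : ℂ) * (k : ℂ) ^ 4) ?_ (W.isCompactOperator_lower hk ℓ 1)
      fun g hg => ?_
    · exact_mod_cast (by positivity : δ * k ^ 4 ≠ 0)
    · have h1 : W.bloch₀ hk g + ℓ g • (1 : PerC) = 0 := hg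
      -- The mean separates the two terms, so both vanish. Then g is a multiple aφ, and a = ℓ(g) =
      -- 0.
      have h2 : ℓ g = 0 := by
        have := congrArg mean h1
        rwa [map_add, mean_bloch₀, map_smul, mean_one, smul_eq_mul, mul_one, zero_add,
          map_zero] at this
      have h1 : W.bloch₀ hk g = 0 := by
        rwa [h2, zero_smul_perC, add_zero] at h1
      have h3 : W.pencil hk (0, 0) g = 0 := by rw [hpencil0, h1]
      obtain ⟨a, ha⟩ := hker (per (T 0 g)) (contDiff_T_zero (W.contDiff_of_pencil hk hδ h3))
        (periodic_per _) (fun x => by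
          have := W.per_pencil hk M (0, 0) g x
          rw [h3, hzero] at this
          linear_combination -this)
      have h4 : g = a • φ := by
        refine T_zero_injective (per_injective (funext fun x => ?_))
        rw [ha x, map_smul, deriv_U]
        have : per (a • T 0 φ) x = a * per (T 0 φ) x := rfl
        rw [this, hφ]
      rw [h4, map_smul, hℓ, smul_eq_mul, mul_one] at h2
      rw [h4, h2, zero_smul_perC]
  refine ⟨{ A₀ := W.bloch₀ hk, A₁ := W.bloch₁ hk, A₂ := bloch₂ δ k, A₃ := bloch₃ δ k,
            A₄ := bloch₄ δ k, R := T 0, φ := φ, ψ := ψ, e := 1, mean := mean, ℓ := ℓ,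
            a := 6 * k, b := k ^ 2 * deriv W.c₀ k, p₀ := k ^ 2 * deriv W.q₀ k,
            p₁ := -(k * W.c₀ k), a_ne := mul_ne_zero (by norm_num) hkC, isUnit := hunit,
            mean_A₀ := W.mean_bloch₀ hk, mean_e := mean_one, ℓ_φ := hℓ, A₀_φ := hA₀φ,
            A₀_e := ?_, A₀_ψ := ?_, mean_second := ?_, mean_A₁_e := ?_, mean_R_ψ := ?_,
            mean_R_e := ?_ }, fun p => rfl, rfl, rfl, rfl, rfl, hφ, hψ, rfl⟩
  · apply per_injective
    funext x
    have h0 : per ((6 * (k : ℂ)) • T 0 φ) x = 6 * k * per (T 0 φ) x := rfl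
    rw [per_bloch₀, h0, hφ, T_zero_one, T_succ_one (j := 0) (by norm_num),
      T_succ_one (j := 1) (by norm_num), T_succ_one (j := 2) (by norm_num),
      T_succ_one (j := 3) (by norm_num), hzero, hone]
    push_cast
    ring
  · apply per_injective
    funext x
    have h0 : per (((k : ℂ) ^ 2 * ((deriv W.c₀ k : ℝ) : ℂ)) • T 0 φ) x
      = k ^ 2 * ((deriv W.c₀ k : ℝ) : ℂ) * per (T 0 φ) x := rfl
    have h1 : per (W.bloch₀ hk ψ + W.bloch₁ hk φ) x
      = per (W.bloch₀ hk ψ) x + per (W.bloch₁ hk φ) x := rfl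
    rw [h0, h1, per_bloch₀, per_bloch₁, hφj 0 (by norm_num), hφj 1 (by norm_num),
      hφj 2 (by norm_num), hφj 3 (by norm_num), hψj 0 (by norm_num), hψj 1 (by norm_num),
      hψj 2 (by norm_num), hψj 3 (by norm_num), hψj 4 (by norm_num)]
    have e1 := congrArg (fun t : ℝ => (t : ℂ)) (W.profile_dk_dy hk x)
    have e2 := congrArg (fun t : ℝ => (t : ℂ)) (W.profile_dy hk x)
    push_cast at e1 e2 ⊢
    -- The parts of L₁U' that come from differentiating the powers of k in the profile equation go
    -- with `profile_dk_dy`; what remains is k times `profile_dy`.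
    linear_combination (k : ℂ) ^ 2 * e1 + (k : ℂ) * e2
  · rw [map_add, mean_bloch₁, mean_bloch₂, mean_coeffMul W hk hψ, mean_of_real hφ,
      W.integral_Vd_succ hk 0]
    have h1 : ∀ x, (6 * W.Vd 0 k x - W.c₀ k) * (k * W.Gd 0 k x)
        = k * ((6 * W.Vd 0 k x - W.c₀ k) * W.Gd 0 k x) := fun x => by ring
    simp only [h1]
    rw [intervalIntegral.integral_const_mul, W.integral_mul_Gd hk]
    push_cast
    ring
  · rw [mean_bloch₁, T_zero_one, mean_coeffMul W hk hone]
    simp only [mul_one]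
    rw [W.integral_coeff hk]
    push_cast
    ring
  · rw [mean_of_real hψ, intervalIntegral.integral_const_mul, W.integral_Gd_zero hk]
    simp
  · rw [T_zero_one, mean_one]

end WaveTrains

end

/-! ### Expansions of given families of kernel elements -/

noncomputable section

namespace BifurcationData

open Filter

variable {E : Type*} [NormedAddCommGroup E] [NormedSpace ℂ E] (B : BifurcationData E)

theorem exists_smul_φ {g : E} (hg : B.A₀ g = 0) : ∃ c : ℂ, g = c • B.φ := by
  have h : ∀ x, B.A 0 x = B.A₀ x := fun x => by simp [A]
  exact B.exists_smul_of_A_eq_zero B.isUnit_bordered_zero (by rw [h, hg]) (by rw [h, B.A₀_φ])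
    B.φ_ne_zero

/-- The vector Rφ is a⁻¹A₀e, hence lies in the range of A₀. -/
theorem mean_R_φ : B.mean (B.R B.φ) = 0 := by
  have h := B.mean_A₀ B.e
  rw [B.A₀_e, map_smul, smul_eq_mul] at h
  exact (mul_eq_zero.mp h).resolve_left B.a_ne

theorem mean_A₁_φ : B.mean (B.A₁ B.φ) = 0 := by
  have h := congrArg B.mean B.A₀_ψ
  rwa [map_add, B.mean_A₀, zero_add, map_smul, mean_R_φ, smul_zero] at h

/-- The first order terms of a family of kernel elements of the pencil. -/
theorem first_order_expansion {ι : Type*} {F : Filter ι} [F.NeBot] {ν lam : ι → ℂ} {G : ι → E}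
    {lam₀ : ℂ} {g₀ g₁ : E} (hg₀ : g₀ ≠ 0) (hν : Tendsto ν F (𝓝 0)) (hν0 : ∀ᶠ i in F, ν i ≠ 0)
    (hlam : Tendsto (fun i => (ν i)⁻¹ * lam i) F (𝓝 lam₀)) (hG : Tendsto G F (𝓝 g₀))
    (hG' : Tendsto (fun i => (ν i)⁻¹ • (G i - g₀)) F (𝓝 g₁))
    (hA : ∀ᶠ i in F, B.A (ν i, lam i) (G i) = 0) :
    ∃ κ m k₁ : ℂ, κ ≠ 0 ∧ g₀ = κ • B.φ ∧ g₁ = κ • B.ψ + m • B.e + k₁ • B.φ ∧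
      κ * (lam₀ + B.b) + B.a * m = 0 ∧ κ * B.p₀ + (B.p₁ + lam₀) * m = 0 := by
  have hlam0 : Tendsto lam F (𝓝 0) := by
    have h := hν.mul hlam
    rw [zero_mul] at h
    refine h.congr' ?_
    filter_upwards [hν0] with i hi
    rw [mul_inv_cancel_left₀ hi]
  have hT (L : E →L[ℂ] E) {f : ι → E} {x : E} (hf : Tendsto f F (𝓝 x)) :
      Tendsto (fun i => L (f i)) F (𝓝 (L x)) := (L.continuous.tendsto x).comp hf
  have hM {f : ι → E} {x : E} (hf : Tendsto f F (𝓝 x)) :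
      Tendsto (fun i => B.mean (f i)) F (𝓝 (B.mean x)) := (B.mean.continuous.tendsto x).comp hf
  have hrest : Tendsto (fun i => B.A₁ (G i) + ν i • B.A₂ (G i) + ν i ^ 2 • B.A₃ (G i)
      + ν i ^ 3 • B.A₄ (G i)) F (𝓝 (B.A₁ g₀)) := by
    have := (((hT B.A₁ hG).add (hν.smul (hT B.A₂ hG))).add
      ((hν.pow 2).smul (hT B.A₃ hG))).add ((hν.pow 3).smul (hT B.A₄ hG))
    simpa using this
  have h0 : B.A₀ g₀ = 0 := by
    have h1 := ((hT B.A₀ hG).add (hν.smul hrest)).add (hlam0.smul (hT B.R hG))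
    rw [zero_smul, zero_smul, add_zero, add_zero] at h1
    refine tendsto_nhds_unique h1 (tendsto_const_nhds.congr' ?_)
    filter_upwards [hA] with i hi
    rw [← hi]
    simp only [A, add_apply, smul_apply]
    module
  obtain ⟨κ, hκ⟩ := B.exists_smul_φ h0
  have hκ0 : κ ≠ 0 := by
    rintro rfl
    exact hg₀ (by rw [hκ, zero_smul])
  have h1 : B.A₀ g₁ + B.A₁ g₀ + lam₀ • B.R g₀ = 0 := by
    have h1 := ((hT B.A₀ hG').add hrest).add (hlam.smul (hT B.R hG))
    refine tendsto_nhds_unique h1 (tendsto_const_nhds.congr' ?_)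
    filter_upwards [hA, hν0] with i hi hi0
    have h2 : (ν i)⁻¹ • B.A (ν i, lam i) (G i) = 0 := by rw [hi, smul_zero]
    rw [← h2]
    simp only [A, add_apply, smul_apply, map_smul, map_sub, h0, sub_zero]
    match_scalars <;> field_simp
  -- This value makes A₀(κψ + me) cancel the first order forcing, so g₁ differs from κψ + me by a
  -- kernel element.
  set m : ℂ := -(κ * (lam₀ + B.b)) / B.a with hm
  have hm' : κ * (lam₀ + B.b) + B.a * m = 0 := by
    rw [hm]; field_simp [B.a_ne]; ring
  have h2 : B.A₀ (g₁ - κ • B.ψ - m • B.e) = 0 := by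
    have e1 : B.A₀ B.ψ = B.b • B.R B.φ - B.A₁ B.φ := eq_sub_of_add_eq B.A₀_ψ
    have e2 : B.A₀ g₁ = -(κ • B.A₁ B.φ) - (lam₀ * κ) • B.R B.φ := by
      have e3 := h1
      rw [hκ, map_smul, map_smul, smul_smul, add_assoc] at e3
      rw [eq_neg_of_add_eq_zero_left e3]
      module
    rw [map_sub, map_sub, map_smul, map_smul, B.A₀_e, e1, e2]
    have e4 : (-(κ * (lam₀ + B.b) + B.a * m)) • B.R B.φ = 0 := by rw [hm', neg_zero, zero_smul]
    rw [← e4]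
    module
  obtain ⟨k₁, hk₁⟩ := B.exists_smul_φ h2
  have hg₁ : g₁ = κ • B.ψ + m • B.e + k₁ • B.φ := by rw [← hk₁]; abel
  refine ⟨κ, m, k₁, hκ0, hκ, hg₁, hm', ?_⟩
  -- The second order condition needs no second order term of G: the mean removes A₀G, and A₁φ and
  -- Rφ have mean zero, so division by ν² only involves (G - g₀)/ν.
  have h3 : B.mean (B.A₁ g₁) + B.mean (B.A₂ g₀) + lam₀ * B.mean (B.R g₁) = 0 := by
    have hrest2 : Tendsto (fun i => B.mean (B.A₂ (G i)) + ν i * B.mean (B.A₃ (G i))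
        + ν i ^ 2 * B.mean (B.A₄ (G i))) F (𝓝 (B.mean (B.A₂ g₀))) := by
      have := ((hM (hT B.A₂ hG)).add (hν.mul (hM (hT B.A₃ hG)))).add
        ((hν.pow 2).mul (hM (hT B.A₄ hG)))
      simpa using this
    have h4 := ((hM (hT B.A₁ hG')).add hrest2).add (hlam.mul (hM (hT B.R hG')))
    refine tendsto_nhds_unique h4 (tendsto_const_nhds.congr' ?_)
    filter_upwards [hA, hν0] with i hi hi0
    have h5 : (ν i)⁻¹ * ((ν i)⁻¹ * B.mean (B.A (ν i, lam i) (G i))) = 0 := by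
      rw [hi, map_zero, mul_zero, mul_zero]
    rw [← h5]
    simp only [A, add_apply, smul_apply, map_smul, map_sub, map_add, hκ, B.mean_A₀, mean_R_φ,
      mean_A₁_φ, smul_eq_mul, mul_zero, sub_zero]
    field_simp
    ring
  have h6 := B.mean_second
  rw [map_add] at h6
  rw [hκ, hg₁] at h3
  simp only [map_add, map_smul, smul_eq_mul, B.mean_A₁_e, B.mean_R_ψ, B.mean_R_e, mean_R_φ,
    mean_A₁_φ] at h3
  rw [← h6]
  linear_combination h3

end BifurcationData

/-! ### Equivalence of uniform convergence with four derivatives and convergence in the transformed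
space -/

namespace PeriodicCalculus

/-- Binomial expansion of (D + S)⁴ = 1. The coefficients sum to 16, the constant in
`norm_le_of_iteratedDeriv`. -/
theorem sum_T (g : PerC) : g = T 0 g + (4 : ℂ) • T 1 g + (6 : ℂ) • T 2 g + (4 : ℂ) • T 3 g
    + T 4 g := by
  have hT0 : T 0 g = S (S (S (S g))) := by simp [T, pow_succ]
  have hT1 : T 1 g = D (S (S (S g))) := by simp [T, pow_succ]
  have hT2 : T 2 g = D (D (S (S g))) := by simp [T, pow_succ]
  have hT3 : T 3 g = D (D (D (S g))) := by simp [T, pow_succ]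
  have hT4 : T 4 g = D (D (D (D g))) := by simp [T, pow_succ]
  rw [hT0, hT1, hT2, hT3, hT4]
  simp only [D, sub_apply, map_sub, one_apply_eq_self]
  module

theorem norm_le_of_norm_per_le {g : PerC} {C : ℝ} (h : ∀ x, ‖per g x‖ ≤ C) : ‖g‖ ≤ C := by
  refine (ContinuousMap.norm_le _ ((norm_nonneg _).trans (h 0))).mpr fun x => ?_
  obtain ⟨x, rfl⟩ := QuotientAddGroup.mk_surjective x
  exact h x

theorem norm_le_of_iteratedDeriv {g : PerC} {C : ℝ}
    (h : ∀ j ≤ 4, ∀ x, ‖iteratedDeriv j (per (T 0 g)) x‖ ≤ C) : ‖g‖ ≤ 16 * C := by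
  have hj : ∀ j ≤ 4, ‖T j g‖ ≤ C := fun j hj => norm_le_of_norm_per_le fun x => by
    rw [← iteratedDeriv_T hj]
    exact h j hj x
  have h0 := hj 0 (by norm_num)
  have h1 := hj 1 (by norm_num)
  have h2 := hj 2 (by norm_num)
  have h3 := hj 3 (by norm_num)
  have h4 := hj 4 (by norm_num)
  have hs (c : ℝ) (hc : 0 ≤ c) (f : PerC) : ‖(c : ℂ) • f‖ ≤ c * ‖f‖ := by
    rw [norm_smul, Complex.norm_real, Real.norm_of_nonneg hc]
  have s1 := hs 4 (by norm_num) (T 1 g)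
  have s2 := hs 6 (by norm_num) (T 2 g)
  have s3 := hs 4 (by norm_num) (T 3 g)
  push_cast at s1 s2 s3
  have e1 := norm_add_le (T 0 g + (4 : ℂ) • T 1 g + (6 : ℂ) • T 2 g + (4 : ℂ) • T 3 g) (T 4 g)
  have e2 := norm_add_le (T 0 g + (4 : ℂ) • T 1 g + (6 : ℂ) • T 2 g) ((4 : ℂ) • T 3 g)
  have e3 := norm_add_le (T 0 g + (4 : ℂ) • T 1 g) ((6 : ℂ) • T 2 g)
  have e4 := norm_add_le (T 0 g) ((4 : ℂ) • T 1 g)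
  rw [← sum_T g] at e1
  linarith

/-- The fourth power of the resolvent gains four derivatives. -/
theorem exists_iteratedDeriv_le : ∃ C > 0, ∀ g : PerC, ∀ j ≤ 4, ∀ x,
    ‖iteratedDeriv j (per (T 0 g)) x‖ ≤ C * ‖g‖ := by
  refine ⟨(∑ j ∈ Finset.range 5, ‖T j‖) + 1, by positivity, fun g j hj x => ?_⟩
  rw [iteratedDeriv_T hj]
  refine (norm_per_le _ x).trans (((T j).le_opNorm g).trans ?_)
  refine mul_le_mul_of_nonneg_right ?_ (norm_nonneg _)
  have := Finset.single_le_sum (f := fun j => ‖T j‖) (fun j _ => (T j).opNorm_nonneg)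
    (Finset.mem_range.mpr (by omega : j < 5))
  linarith

end PeriodicCalculus

/-! ### The linearized Whitham system and its dispersion relation -/

namespace WaveTrains

variable {δ : ℝ} (W : WaveTrains δ) {k : ℝ} (hk : k ∈ W.K)
include hk

theorem deriv_c (M : ℝ) : deriv (fun k' => W.c k' M) k = deriv W.c₀ k :=
  ((W.hasDerivAt_c₀ hk).const_add (6 * M)).deriv

omit hk in
theorem deriv_c_mean (k M : ℝ) : deriv (fun M' => W.c k M') M = 6 := by
  have h := ((hasDerivAt_id M).const_mul 6).add_const (W.c₀ k)
  exact h.deriv.trans (mul_one 6)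

theorem deriv_avgFlux (M : ℝ) : deriv (fun k' => W.avgFlux k' M) k = deriv W.q₀ k := by
  refine (((W.hasDerivAt_q₀ hk).add_const (3 * M ^ 2)).congr_of_eventuallyEq ?_).deriv
  filter_upwards [W.isOpen_K.mem_nhds hk] with k' hk'
  exact W.avgFlux_eq hk' M

theorem deriv_avgFlux_mean (M : ℝ) : deriv (fun M' => W.avgFlux k M') M = 6 * M := by
  have h : (fun M' => W.avgFlux k M') = fun M' => W.q₀ k + 3 * M' ^ 2 :=
    funext fun M' => W.avgFlux_eq hk M'
  rw [h]
  have h1 := (((hasDerivAt_id M).pow 2).const_mul 3).const_add (W.q₀ k)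
  refine h1.deriv.trans ?_
  simp
  ring

theorem dispersionMatrix_eq (M : ℝ) (Λ : ℂ) : W.dispersionMatrix k M Λ
    = !![Λ + k * ((deriv W.c₀ k : ℝ) : ℂ), 6 * k; ((deriv W.q₀ k : ℝ) : ℂ), Λ - W.c₀ k] := by
  rw [dispersionMatrix, W.deriv_c hk, deriv_c_mean, W.deriv_avgFlux hk, W.deriv_avgFlux_mean hk]
  congr 1
  simp only [c]
  push_cast
  ring_nf

theorem mulVec_dispersionMatrix_eq_zero (M : ℝ) (Λ κ m : ℂ) :
    (W.dispersionMatrix k M Λ).mulVec ![κ, m] = 0 ↔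
      (Λ + k * ((deriv W.c₀ k : ℝ) : ℂ)) * κ + 6 * k * m = 0 ∧
      ((deriv W.q₀ k : ℝ) : ℂ) * κ + (Λ - W.c₀ k) * m = 0 := by
  rw [W.dispersionMatrix_eq hk, funext_iff, Fin.forall_fin_two]
  simp [Matrix.mulVec, dotProduct, Fin.sum_univ_two]

theorem det_dispersionMatrix (M : ℝ) (Λ : ℂ) : (W.dispersionMatrix k M Λ).det
    = Λ ^ 2 + ((k * deriv W.c₀ k - W.c₀ k : ℝ) : ℂ) * Λ
      - ((k * W.c₀ k * deriv W.c₀ k + 6 * k * deriv W.q₀ k : ℝ) : ℂ) := by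
  rw [W.dispersionMatrix_eq hk, Matrix.det_fin_two_of]
  push_cast
  ring

theorem whithamJacobian_eq (M : ℝ) : W.whithamJacobian k M
    = !![W.c k M + k * deriv W.c₀ k, 6 * k; deriv W.q₀ k, 6 * M] := by
  have h1 : deriv (fun k' => k' * W.c k' M) k = W.c k M + k * deriv W.c₀ k := by
    have h := (hasDerivAt_id k).mul ((W.hasDerivAt_c₀ hk).const_add (6 * M))
    refine h.deriv.trans ?_
    simp [c]
  have h2 : deriv (fun M' => k * W.c k M') M = 6 * k := by
    have h := (((hasDerivAt_id M).const_mul 6).add_const (W.c₀ k)).const_mul k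
    refine h.deriv.trans ?_
    ring
  rw [whithamJacobian, h1, h2, W.deriv_avgFlux hk, W.deriv_avgFlux_mean hk]

omit hk in
theorem hasDerivAt_planeWave_time (ν Λ κ : ℂ) (X T : ℝ) :
    HasDerivAt (fun t : ℝ => Complex.exp (ν * (X + Λ * t)) * κ)
      (Λ * (ν * Complex.exp (ν * (X + Λ * T)) * κ)) T := by
  have h := ((((((PeriodicCalculus.hasDerivAt_ofReal T).const_mul Λ).const_add (X : ℂ)).const_mul
    ν).cexp).mul_const κ)
  refine h.congr_deriv ?_
  ring

omit hk in
theorem hasDerivAt_planeWave_space (ν Λ κ : ℂ) (X T : ℝ) :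
    HasDerivAt (fun x : ℝ => Complex.exp (ν * (x + Λ * T)) * κ)
      (ν * Complex.exp (ν * (X + Λ * T)) * κ) X := by
  have h := (((((PeriodicCalculus.hasDerivAt_ofReal X).add_const (Λ * (T : ℂ))).const_mul
    ν).cexp).mul_const κ)
  refine h.congr_deriv ?_
  ring

theorem isWhithamMode_iff (M : ℝ) (Λ κ m : ℂ) :
    W.IsWhithamMode k M Λ κ m ↔ (W.dispersionMatrix k M Λ).mulVec ![κ, m] = 0 := by
  rw [W.mulVec_dispersionMatrix_eq_zero hk]
  have hdiff : ∀ ν κ : ℂ, Differentiable ℝ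
      (Function.uncurry fun X T : ℝ => Complex.exp (ν * (X + Λ * T)) * κ) := by
    intro ν κ
    have h1 : Differentiable ℝ fun p : ℝ × ℝ => ((p.1 : ℝ) : ℂ) :=
      Complex.ofRealCLM.differentiable.comp differentiable_fst
    have h2 : Differentiable ℝ fun p : ℝ × ℝ => ((p.2 : ℝ) : ℂ) :=
      Complex.ofRealCLM.differentiable.comp differentiable_snd
    simp only [Function.uncurry_def]
    fun_prop
  simp only [IsWhithamMode, IsLinWhithamSolution, hdiff, true_and,
    (hasDerivAt_planeWave_time _ _ _ _ _).deriv, (hasDerivAt_planeWave_space _ _ _ _ _).deriv,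
    W.whithamJacobian_eq hk]
  simp only [Matrix.of_apply, Matrix.cons_val', Matrix.cons_val_zero, Matrix.cons_val_one,
    Matrix.cons_val_fin_one, c]
  push_cast
  constructor
  · intro h
    -- Both equations carry the common factor ν exp(ν(X + ΛT)), which equals 1 for ν = 1 at the
    -- origin.
    obtain ⟨h1, h2⟩ := h 1 0 0
    simp at h1 h2
    constructor
    · linear_combination h1
    · linear_combination h2
  · rintro ⟨h1, h2⟩ ν X T
    constructor
    · linear_combination (ν * Complex.exp (ν * (X + Λ * T))) * h1
    · linear_combination (ν * Complex.exp (ν * (X + Λ * T))) * h2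

theorem isDispersionRoot_iff (M : ℝ) (Λ : ℂ) :
    W.IsDispersionRoot k M Λ ↔ (W.dispersionMatrix k M Λ).det = 0 := by
  rw [← Matrix.exists_mulVec_eq_zero_iff]
  simp only [IsDispersionRoot, W.isWhithamMode_iff hk]
  constructor
  · rintro ⟨κ, m, h1, h2⟩
    refine ⟨![κ, m], fun h => ?_, h2⟩
    have e0 := congrFun h 0
    have e1 := congrFun h 1
    simp at e0 e1
    tauto
  · rintro ⟨v, h1, h2⟩
    have hv : v = ![v 0, v 1] := by
      ext i; fin_cases i <;> rfl
    refine ⟨v 0, v 1, ?_, hv ▸ h2⟩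
    by_contra! h
    apply h1
    rw [hv, h.1, h.2]
    ext i; fin_cases i <;> rfl

theorem exists_distinct_real_roots_iff (M : ℝ) :
    (∃ Λ₁ Λ₂ : ℝ, Λ₁ ≠ Λ₂ ∧ W.IsDispersionRoot k M Λ₁ ∧ W.IsDispersionRoot k M Λ₂) ↔
      0 < W.Delta k := by
  simp only [W.isDispersionRoot_iff hk, W.det_dispersionMatrix hk]
  constructor
  · rintro ⟨Λ₁, Λ₂, hne, h1, h2⟩
    norm_cast at h1 h2
    have h3 : (Λ₁ - Λ₂) * (Λ₁ + Λ₂ + (k * deriv W.c₀ k - W.c₀ k)) = 0 := by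
      linear_combination h1 - h2
    have h4 := (mul_eq_zero.mp h3).resolve_left (sub_ne_zero.mpr hne)
    -- `Delta` is the discriminant of the monic quadratic det D.
    have h5 : W.Delta k = (Λ₁ - Λ₂) ^ 2 := by
      simp only [Delta]
      linear_combination (-4) * h1 + (3 * Λ₁ - Λ₂ + (k * deriv W.c₀ k - W.c₀ k)) * h4
    rw [h5]
    exact sq_pos_of_ne_zero (sub_ne_zero.mpr hne)
  · intro h
    have hs := Real.sq_sqrt h.le
    have hpos := Real.sqrt_pos.mpr h
    set s := Real.sqrt (W.Delta k) with hs'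
    rw [Delta] at hs
    refine ⟨(-(k * deriv W.c₀ k - W.c₀ k) + s) / 2, (-(k * deriv W.c₀ k - W.c₀ k) - s) / 2,
      ?_, ?_, ?_⟩
    · intro h; linarith
    · norm_cast
      linear_combination hs / 4
    · norm_cast
      linear_combination hs / 4

theorem delta_nonneg_of_roots_real (M : ℝ)
    (h : ∀ Λ : ℂ, W.IsDispersionRoot k M Λ → Λ.im = 0) : 0 ≤ W.Delta k := by
  by_contra! hneg
  have hs := Real.sq_sqrt (neg_pos.mpr hneg).le
  have hpos := Real.sqrt_pos.mpr (neg_pos.mpr hneg)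
  set s := Real.sqrt (-W.Delta k) with hs'
  have h1 : W.IsDispersionRoot k M ⟨-(k * deriv W.c₀ k - W.c₀ k) / 2, s / 2⟩ := by
    rw [W.isDispersionRoot_iff hk, W.det_dispersionMatrix hk]
    rw [Delta] at hs
    apply Complex.ext
    · simp [sq]
      linear_combination (-1 / 4 : ℝ) * hs
    · simp [sq]
      ring
  have h2 := h _ h1
  simp only at h2
  linarith

end WaveTrains

end

/-! ### From the abstract reduction to Bloch eigenvalues -/

noncomputable section

namespace WaveTrains

open PeriodicCalculus Filter

variable {δ : ℝ} (W : WaveTrains δ)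

theorem mode₀_eq {k : ℝ} {φ : PerC} (hφ : per (T 0 φ) = fun x => (W.Vd 1 k x : ℂ)) (M : ℝ)
    (κ : ℂ) : W.mode₀ k M κ = per (T 0 ((κ / k) • φ)) := by
  funext x
  have h : per (T 0 ((κ / k) • φ)) x = κ / k * per (T 0 φ) x := by rw [map_smul]; rfl
  rw [h, hφ, mode₀, deriv_U]

theorem mode₁_eq {k : ℝ} (hk : k ≠ 0) {ψ : PerC}
    (hψ : per (T 0 ψ) = fun x => ((k * W.Gd 0 k x : ℝ) : ℂ)) (M : ℝ) (κ m : ℂ) :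
    W.mode₁ k M κ m = per (T 0 ((κ / k) • ψ + m • (1 : PerC))) := by
  funext x
  have h : per (T 0 ((κ / k) • ψ + m • (1 : PerC))) x = κ / k * per (T 0 ψ) x + m * 1 := by
    rw [map_add, map_smul, map_smul, T_zero_one]; rfl
  have hk' : (k : ℂ) ≠ 0 := by exact_mod_cast hk
  rw [h, hψ, mode₁, deriv_U_param, deriv_U_mean]
  push_cast
  field_simp

/-- Any branch of Bloch eigenpairs with an expansion at the origin is governed by the Whitham
system. -/
theorem expansion_isWhithamMode (hδ : 0 < δ) {k M : ℝ} (hk : k ∈ W.K)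
    (hker : W.KernelSpannedByTranslation k M)
    (lam : ℝ → ℂ) (u : ℝ → ℝ → ℂ) (lam₀ : ℂ) (u₀ u₁ : ℝ → ℂ) (C : ℝ)
    (hu₀ : ContDiff ℝ ∞ u₀) (hu₁ : ContDiff ℝ ∞ u₁) (hne : u₀ ≠ 0)
    (hu : ∀ᶠ ξ : ℝ in 𝓝[≠] 0,
      W.IsBlochEigenpair k M (Complex.I * ξ) (lam ξ) (u ξ) ∧
      ‖lam ξ - Complex.I * ξ * lam₀‖ ≤ C * ξ ^ 2 ∧
      ∀ j ≤ 4, ∀ x : ℝ,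
        ‖iteratedDeriv j (fun y => u ξ y - (u₀ y + Complex.I * ξ * u₁ y)) x‖ ≤ C * ξ ^ 2) :
    ∃ κ m k₁ : ℂ, κ ≠ 0 ∧ W.IsWhithamMode k M (lam₀ / k) κ m ∧
      u₀ = W.mode₀ k M κ ∧ u₁ = W.mode₁ k M κ m + W.mode₀ k M k₁ := by
  obtain ⟨B, hA, ha, hb, hp₀, hp₁, hφ, hψ, he⟩ := W.exists_bifurcationData hk hδ hker
  have hkpos := W.pos k hk
  have hkC : (k : ℂ) ≠ 0 := by exact_mod_cast hkpos.ne'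
  have hξ : ∀ᶠ ξ : ℝ in 𝓝[≠] 0, ξ ≠ 0 := self_mem_nhdsWithin
  set ν : ℝ → ℂ := fun ξ => Complex.I * ξ with hν_def
  have hν0 : ∀ᶠ ξ : ℝ in 𝓝[≠] 0, ν ξ ≠ 0 := by
    filter_upwards [hξ] with ξ h
    simpa [hν_def] using h
  have hnorm : ∀ ξ, ‖ν ξ‖ = |ξ| := fun ξ => by simp [hν_def]
  have hν : Tendsto ν (𝓝[≠] 0) (𝓝 0) := by
    have : Continuous ν := by fun_prop
    have h := (this.tendsto 0).mono_left (nhdsWithin_le_nhds (s := {0}ᶜ))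
    simpa [hν_def] using h
  have hsmall : Tendsto (fun ξ : ℝ => |C| * |ξ|) (𝓝[≠] 0) (𝓝 0) := by
    have : Continuous fun ξ : ℝ => |C| * |ξ| := by fun_prop
    have h := (this.tendsto 0).mono_left (nhdsWithin_le_nhds (s := {0}ᶜ))
    simpa using h
  have hdiv {E : Type} [NormedAddCommGroup E] [NormedSpace ℂ E] {c : ℝ} (hc : 0 ≤ c) {h : ℝ → E}
      {x : E} (hh : ∀ᶠ ξ : ℝ in 𝓝[≠] 0, ‖h ξ - ν ξ • x‖ ≤ c * (C * ξ ^ 2)) :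
      Tendsto (fun ξ => (ν ξ)⁻¹ • h ξ) (𝓝[≠] 0) (𝓝 x) := by
    rw [tendsto_iff_norm_sub_tendsto_zero]
    have h0 : Tendsto (fun ξ : ℝ => c * (|C| * |ξ|)) (𝓝[≠] 0) (𝓝 0) := by
      simpa using hsmall.const_mul c
    refine squeeze_zero' (Eventually.of_forall fun _ => norm_nonneg _) ?_ h0
    filter_upwards [hh, hν0, hξ] with ξ h1 h2 h3
    have h4 : (ν ξ)⁻¹ • h ξ - x = (ν ξ)⁻¹ • (h ξ - ν ξ • x) := by
      rw [smul_sub, smul_smul, inv_mul_cancel₀ h2, one_smul]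
    rw [h4, norm_smul, norm_inv, hnorm, inv_mul_le_iff₀ (abs_pos.mpr h3)]
    refine h1.trans ?_
    have h5 : ξ ^ 2 = |ξ| * |ξ| := by rw [← sq, sq_abs]
    rw [h5]
    have h6 : C * (|ξ| * |ξ|) ≤ |C| * (|ξ| * |ξ|) :=
      mul_le_mul_of_nonneg_right (le_abs_self C) (by positivity)
    calc c * (C * (|ξ| * |ξ|)) ≤ c * (|C| * (|ξ| * |ξ|)) := mul_le_mul_of_nonneg_left h6 hc
      _ = |ξ| * (c * (|C| * |ξ|)) := by ring
  have hback {E : Type} [NormedAddCommGroup E] [NormedSpace ℂ E] {h : ℝ → E} {x y : E}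
      (hh : Tendsto (fun ξ => (ν ξ)⁻¹ • (h ξ - y)) (𝓝[≠] 0) (𝓝 x)) :
      Tendsto h (𝓝[≠] 0) (𝓝 y) := by
    have h1 := (hν.smul hh).add_const y
    rw [zero_smul, zero_add] at h1
    refine h1.congr' ?_
    filter_upwards [hν0] with ξ h2
    rw [smul_smul, mul_inv_cancel₀ h2, one_smul, sub_add_cancel]
  have hpt₁ : ∀ x, Tendsto (fun ξ => (ν ξ)⁻¹ • (u ξ x - u₀ x)) (𝓝[≠] 0) (𝓝 (u₁ x)) := by
    intro x
    refine hdiv zero_le_one ?_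
    filter_upwards [hu] with ξ h
    have h1 := h.2.2 0 (by norm_num) x
    rw [iteratedDeriv_zero] at h1
    rw [one_mul, smul_eq_mul, sub_sub]
    exact h1
  have hpt₀ : ∀ x, Tendsto (fun ξ => u ξ x) (𝓝[≠] 0) (𝓝 (u₀ x)) := fun x => hback (hpt₁ x)
  have hper : ∀ᶠ ξ : ℝ in 𝓝[≠] 0, Function.Periodic (u ξ) 1 := hu.mono fun ξ h => h.1.2.1
  -- Periodicity of u₀ and u₁ is not assumed; it is inherited from the eigenfunctions through
  -- pointwise limits.
  have hper₀ : Function.Periodic u₀ 1 := fun x =>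
    tendsto_nhds_unique_of_eventuallyEq (hpt₀ (x + 1)) (hpt₀ x) (hper.mono fun ξ h => h x)
  have hper₁ : Function.Periodic u₁ 1 := fun x =>
    tendsto_nhds_unique_of_eventuallyEq (hpt₁ (x + 1)) (hpt₁ x) (hper.mono fun ξ h => by
      simp only [h x, hper₀ x])
  obtain ⟨g₀, hg₀⟩ := exists_T_zero_eq hu₀ hper₀
  obtain ⟨g₁, hg₁⟩ := exists_T_zero_eq hu₁ hper₁
  have hg₀ne : g₀ ≠ 0 := by
    rintro rfl
    apply hne
    rw [← hg₀, map_zero]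
    rfl
  -- The value 0 away from eigenpairs only makes the choice total; the limit ξ → 0 never sees it.
  have hex : ∀ ξ : ℝ, ∃ g : PerC, W.IsBlochEigenpair k M (ν ξ) (lam ξ) (u ξ) →
      per (T 0 g) = u ξ ∧ W.pencil hk (ν ξ, lam ξ) g = 0 := by
    intro ξ
    by_cases h : W.IsBlochEigenpair k M (ν ξ) (lam ξ) (u ξ)
    · obtain ⟨g, h1, -, h2⟩ := W.exists_of_isBlochEigenpair hk h
      exact ⟨g, fun _ => ⟨h1, h2⟩⟩
    · exact ⟨0, fun h' => absurd h' h⟩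
  choose G hG using hex
  have hG₁ : Tendsto (fun ξ => (ν ξ)⁻¹ • (G ξ - g₀)) (𝓝[≠] 0) (𝓝 g₁) := by
    refine hdiv (c := 16) (by norm_num) ?_
    filter_upwards [hu] with ξ h
    refine norm_le_of_iteratedDeriv fun j hj x => ?_
    have h1 : per (T 0 (G ξ - g₀ - ν ξ • g₁))
        = fun y => u ξ y - (u₀ y + Complex.I * ξ * u₁ y) := by
      funext y
      have h2 : per (T 0 (G ξ - g₀ - ν ξ • g₁)) y
          = per (T 0 (G ξ)) y - per (T 0 g₀) y - ν ξ * per (T 0 g₁) y := by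
        rw [map_sub, map_sub, map_smul]; rfl
      rw [h2, (hG ξ h.1).1, hg₀, hg₁]
      ring
    rw [h1]
    exact h.2.2 j hj x
  have hlam : Tendsto (fun ξ => (ν ξ)⁻¹ * lam ξ) (𝓝[≠] 0) (𝓝 lam₀) := by
    refine hdiv (E := ℂ) zero_le_one ?_
    filter_upwards [hu] with ξ h
    rw [one_mul]
    exact h.2.1
  obtain ⟨κ, m, k₁, hκ, e₀, e₁, hr₁, hr₂⟩ := B.first_order_expansion hg₀ne hν hν0 hlam
    (hback hG₁) hG₁ (hu.mono fun ξ h => by rw [hA]; exact (hG ξ h.1).2)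
  -- Abstract coefficients multiply U' and k∂ₖU, while the modes are normalized by U'/k and ∂ₖU;
  -- hence the factor k.
  refine ⟨k * κ, m, k * k₁, mul_ne_zero hkC hκ, ?_, ?_, ?_⟩
  · rw [W.isWhithamMode_iff hk, W.mulVec_dispersionMatrix_eq_zero hk]
    rw [ha, hb] at hr₁
    rw [hp₀, hp₁] at hr₂
    constructor
    · field_simp
      linear_combination hr₁
    · field_simp
      linear_combination hr₂
  · rw [W.mode₀_eq hφ, ← hg₀, e₀, mul_div_cancel_left₀ _ hkC]
  · rw [W.mode₀_eq hφ, W.mode₁_eq hkpos.ne' hψ, ← hg₁, e₁, mul_div_cancel_left₀ _ hkC,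
      mul_div_cancel_left₀ _ hkC, he, map_add]
    rfl

/-- Eliminating m by the first row of D(Λ)(κ, m) = 0 leaves the second row as a scalar equation. The
scaling μ = kΛ reflects that Bloch exponents refer to the phase variable. -/
theorem charPoly_eq_det (B : BifurcationData PerC) {k : ℝ} (M : ℝ) (hk : k ∈ W.K)
    (ha : B.a = 6 * k)
    (hb : B.b = k ^ 2 * deriv W.c₀ k) (hp₀ : B.p₀ = k ^ 2 * deriv W.q₀ k)
    (hp₁ : B.p₁ = -(k * W.c₀ k)) (μ : ℂ) :
    B.charPoly μ = -(k / 6) * (W.dispersionMatrix k M (μ / k)).det := by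
  have hkC : (k : ℂ) ≠ 0 := by exact_mod_cast (W.pos k hk).ne'
  rw [W.det_dispersionMatrix hk, BifurcationData.charPoly, BifurcationData.slope, ha, hb, hp₀, hp₁]
  push_cast
  field_simp
  ring

theorem isDispersionRoot_iff_charPoly (B : BifurcationData PerC) {k : ℝ} (M : ℝ) (hk : k ∈ W.K)
    (ha : B.a = 6 * k)
    (hb : B.b = k ^ 2 * deriv W.c₀ k) (hp₀ : B.p₀ = k ^ 2 * deriv W.q₀ k)
    (hp₁ : B.p₁ = -(k * W.c₀ k)) (Λ : ℂ) :
    W.IsDispersionRoot k M Λ ↔ B.charPoly (k * Λ) = 0 := by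
  have hkC : (k : ℂ) ≠ 0 := by exact_mod_cast (W.pos k hk).ne'
  rw [W.isDispersionRoot_iff hk, W.charPoly_eq_det B M hk ha hb hp₀ hp₁,
    mul_div_cancel_left₀ _ hkC, mul_eq_zero, or_iff_right]
  simpa using hkC

/-- All small Bloch eigenvalues satisfy the dispersion relation to leading order. -/
theorem exists_det_bound (hδ : 0 < δ) {k M : ℝ} (hk : k ∈ W.K)
    (hker : W.KernelSpannedByTranslation k M) :
    ∃ r > 0, ∃ C : ℝ, ∀ (ν lam : ℂ) (f : ℝ → ℂ), ν ≠ 0 → ‖ν‖ < r → ‖lam‖ < r →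
      W.IsBlochEigenpair k M ν lam f →
      ‖(W.dispersionMatrix k M (lam / (ν * k))).det‖ ≤ C * ‖ν‖ := by
  obtain ⟨B, hA, ha, hb, hp₀, hp₁, -⟩ := W.exists_bifurcationData hk hδ hker
  obtain ⟨r, hr, C, hC⟩ := B.exists_bound
  have hkpos := W.pos k hk
  refine ⟨r, hr, 6 / k * C, fun ν lam f hν0 hν hlam hf => ?_⟩
  obtain ⟨g, -, hg0, hg⟩ := W.exists_of_isBlochEigenpair hk hf
  have h1 := (hC ν lam g hν hlam (by rw [hA, hg]) hg0).2 hν0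
  rw [W.charPoly_eq_det B M hk ha hb hp₀ hp₁, div_div, norm_mul] at h1
  have h2 : ‖(-(k / 6) : ℂ)‖ = k / 6 := by
    rw [norm_neg, norm_div, Complex.norm_real, Real.norm_of_nonneg hkpos.le]
    simp
  rw [h2] at h1
  rw [div_mul_eq_mul_div, div_mul_eq_mul_div, le_div_iff₀ hkpos]
  linarith

/-- Every root of the dispersion relation is approached by Bloch eigenvalues. -/
theorem eventually_exists_near (hδ : 0 < δ) {k M : ℝ} (hk : k ∈ W.K)
    (hker : W.KernelSpannedByTranslation k M) (Λ : ℂ) (hΛ : W.IsDispersionRoot k M Λ) (ε : ℝ)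
    (hε : 0 < ε) : ∀ᶠ ν : ℂ in 𝓝 0,
      ∃ (lam : ℂ) (f : ℝ → ℂ), W.IsBlochEigenpair k M ν lam f ∧
        ‖lam - ν * k * Λ‖ ≤ ε * ‖ν‖ := by
  obtain ⟨B, hA, ha, hb, hp₀, hp₁, -⟩ := W.exists_bifurcationData hk hδ hker
  rw [W.isDispersionRoot_iff_charPoly B M hk ha hb hp₀ hp₁] at hΛ
  filter_upwards [B.eventually_exists_near_root hΛ hε] with ν hν
  obtain ⟨lam, g, hg0, hg, hle⟩ := hν
  refine ⟨lam, per (T 0 g), W.isBlochEigenpair_of_pencil hk hδ M (by rw [← hA, hg]) hg0, ?_⟩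
  rwa [mul_assoc]

/-- If the discriminant does not vanish, the small Bloch eigenvalues form two analytic branches. -/
theorem exists_bloch_branches (hδ : 0 < δ) {k M : ℝ} (hk : k ∈ W.K)
    (hker : W.KernelSpannedByTranslation k M) (hΔ : W.Delta k ≠ 0) :
    ∃ r > 0, ∃ (C : ℝ) (lam : ℂ → ℂ → ℂ) (u : ℂ → ℂ → ℝ → ℂ),
      (∀ Λ : ℂ, W.IsDispersionRoot k M Λ →
        AnalyticOnNhd ℂ (lam Λ) (Metric.ball 0 r) ∧
        ∃ κ m : ℂ, κ ≠ 0 ∧ W.IsWhithamMode k M Λ κ m ∧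
          ∀ ν : ℂ, ‖ν‖ < r →
            W.IsBlochEigenpair k M ν (lam Λ ν) (u Λ ν) ∧
            ‖lam Λ ν - ν * k * Λ‖ ≤ C * ‖ν‖ ^ 2 ∧
            ∀ j ≤ 4, ∀ x : ℝ,
              ‖iteratedDeriv j
                (fun y => u Λ ν y - (W.mode₀ k M κ y + ν * W.mode₁ k M κ m y)) x‖
                ≤ C * ‖ν‖ ^ 2) ∧
      (∀ (ν l : ℂ) (f : ℝ → ℂ), ‖ν‖ < r → ‖l‖ < r → W.IsBlochEigenpair k M ν l f →
        ∃ Λ : ℂ, W.IsDispersionRoot k M Λ ∧ l = lam Λ ν ∧ ∃ a : ℂ, ∀ x, f x = a * u Λ ν x) := by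
  obtain ⟨B, hA, ha, hb, hp₀, hp₁, hφ, hψ, he⟩ := W.exists_bifurcationData hk hδ hker
  have hkpos := W.pos k hk
  have hkC : (k : ℂ) ≠ 0 := by exact_mod_cast hkpos.ne'
  have hroot := W.isDispersionRoot_iff_charPoly B M hk ha hb hp₀ hp₁
  -- A root equal to its companion is a double root, and then the discriminant `Delta` vanishes.
  have hsimple : ∀ μ, B.charPoly μ = 0 → μ ≠ -μ - B.p₁ - B.b := by
    intro μ hμ heq
    apply hΔ
    have h1 : B.p₁ + B.b = -2 * μ := by linear_combination heq
    have h2 : (k : ℂ) ^ 2 * (W.Delta k : ℂ) = 0 := by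
      rw [BifurcationData.charPoly, BifurcationData.slope, ha] at hμ
      field_simp at hμ
      rw [hb, hp₁] at h1
      rw [hb, hp₁, hp₀] at hμ
      rw [Delta]
      push_cast
      linear_combination 4 * hμ
        + (k ^ 2 * ((deriv W.c₀ k : ℝ) : ℂ) - k * W.c₀ k + 2 * μ) * h1
    have h3 := (mul_eq_zero.mp h2).resolve_left (pow_ne_zero 2 hkC)
    exact_mod_cast h3
  obtain ⟨r, hr, C, lam, G, hbranch, hall⟩ := B.exists_branches hsimple
  obtain ⟨C', hC'0, hC'⟩ := exists_iteratedDeriv_le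
  refine ⟨r, hr, max C (C' * C), fun Λ => lam (k * Λ), fun Λ ν => per (T 0 (G (k * Λ) ν)),
    fun Λ hΛ => ?_, fun ν l f hν hl hf => ?_⟩
  · obtain ⟨h1, h2⟩ := hbranch (k * Λ) ((hroot Λ).mp hΛ)
    have hrow : (Λ + k * ((deriv W.c₀ k : ℝ) : ℂ)) * k + 6 * k * B.slope (k * Λ) = 0 := by
      rw [BifurcationData.slope, ha, hb]
      field_simp
      ring
    -- Taking κ = k matches the normalization of the abstract branch, whose leading term is φ, that
    -- is U'.
    refine ⟨h1, k, B.slope (k * Λ), hkC, ?_, fun ν hν => ?_⟩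
    · rw [W.isWhithamMode_iff hk, W.mulVec_dispersionMatrix_eq_zero hk]
      refine ⟨hrow, ?_⟩
      have h3 := (hroot Λ).mp hΛ
      rw [BifurcationData.charPoly, hp₀, hp₁] at h3
      refine mul_left_cancel₀ hkC ?_
      linear_combination h3
    · obtain ⟨h3, h4, h5, h6⟩ := h2 ν hν
      refine ⟨W.isBlochEigenpair_of_pencil hk hδ M (by rw [← hA, h4]) h3, ?_, fun j hj x => ?_⟩
      · rw [mul_assoc]
        exact h5.trans (mul_le_mul_of_nonneg_right (le_max_left _ _) (by positivity))
      · have h7 : (fun y => per (T 0 (G (k * Λ) ν)) y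
            - (W.mode₀ k M k y + ν * W.mode₁ k M k (B.slope (k * Λ)) y))
            = per (T 0 (G (k * Λ) ν - (B.φ + ν • (B.ψ + B.slope (k * Λ) • B.e)))) := by
          rw [W.mode₀_eq hφ, W.mode₁_eq hkpos.ne' hψ, div_self hkC, he]
          funext y
          simp only [map_sub, map_add, map_smul, one_smul]
          rfl
        rw [h7]
        refine (hC' _ j hj x).trans ((mul_le_mul_of_nonneg_left h6 hC'0.le).trans ?_)
        rw [← mul_assoc]
        exact mul_le_mul_of_nonneg_right (le_max_right _ _) (by positivity)
  · obtain ⟨g, hgf, hg0, hg⟩ := W.exists_of_isBlochEigenpair hk hf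
    obtain ⟨μ, h1, h2, c, h3⟩ := hall ν l g hν hl (by rw [hA, hg]) hg0
    have h4 : (k : ℂ) * (μ / k) = μ := mul_div_cancel₀ _ hkC
    refine ⟨μ / k, (hroot _).mpr (by rw [h4, h1]), by simpa only [h4] using h2, c, fun x => ?_⟩
    simp only [h4]
    rw [← hgf, h3, map_smul]
    rfl

/-- The roots of the dispersion relation of a spectrally stable wave are real. -/
theorem im_eq_zero_of_spectrallyStable (hδ : 0 < δ) {k M : ℝ} (hk : k ∈ W.K)
    (hker : W.KernelSpannedByTranslation k M) (hst : W.SpectrallyStable k M) (Λ : ℂ)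
    (hΛ : W.IsDispersionRoot k M Λ) : Λ.im = 0 := by
  by_contra him
  have hkpos := W.pos k hk
  have hpos : 0 < |Λ.im| := abs_pos.mpr him
  obtain ⟨r, hr, hball⟩ := Metric.eventually_nhds_iff.mp
    (W.eventually_exists_near hδ hk hker Λ hΛ (k * |Λ.im| / 2) (by positivity))
  -- The real part of iξkΛ is -ξk Im Λ, so this sign makes it k |Im Λ| r/2 > 0. The tolerance k |Im
  -- Λ|/2 allows an error of at most half of that, leaving Re λ > 0.
  set ξ : ℝ := -(SignType.sign Λ.im : ℝ) * (r / 2) with hξ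
  have hsgn : |(SignType.sign Λ.im : ℝ)| = 1 := by
    rcases lt_or_gt_of_ne him with h | h
    · simp [sign_neg h]
    · simp [sign_pos h]
  have hξabs : |ξ| = r / 2 := by
    rw [hξ, abs_mul, abs_neg, hsgn, one_mul, abs_of_pos (by positivity)]
  have hnorm : ‖Complex.I * (ξ : ℂ)‖ = r / 2 := by
    rw [norm_mul, Complex.norm_I, one_mul, Complex.norm_real, Real.norm_eq_abs, hξabs]
  obtain ⟨lam, f, hf, hle⟩ := hball (y := Complex.I * ξ) (by
    rw [dist_zero_right, hnorm]; linarith)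
  have h1 := hst ξ lam f hf
  have h2 : (Complex.I * ξ * k * Λ).re = k * |Λ.im| * (r / 2) := by
    have h3 : (Complex.I * ξ * k * Λ).re = -(ξ * k * Λ.im) := by
      simp [Complex.mul_re, Complex.mul_im]
    have h4 : (SignType.sign Λ.im : ℝ) * Λ.im = |Λ.im| := sign_mul_self Λ.im
    rw [h3, hξ, ← h4]
    ring
  have h5 := (Complex.abs_re_le_norm (lam - Complex.I * ξ * k * Λ)).trans hle
  rw [hnorm, Complex.sub_re, h2] at h5
  have h6 := (abs_le.mp h5).1
  have h7 : 0 < k * |Λ.im| * (r / 2) := by positivity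
  nlinarith

end WaveTrains

end

theorem mainTheorem2 (δ : ℝ) (hδ : 0 < δ) (W : WaveTrains δ) (k M : ℝ) (hk : k ∈ W.K)
    (hker : W.KernelSpannedByTranslation k M) :
    -- the averaged flux in terms of the mean-zero problem
    (∀ k' ∈ W.K, ∀ M' : ℝ, W.avgFlux k' M' = W.q₀ k' + 3 * M' ^ 2) ∧
    -- plane waves of the linearized Whitham system, and the dispersion relation
    (∀ Λ κ m : ℂ, W.IsWhithamMode k M Λ κ m ↔ (W.dispersionMatrix k M Λ).mulVec ![κ, m] = 0) ∧
    (∀ Λ : ℂ, W.IsDispersionRoot k M Λ ↔ (W.dispersionMatrix k M Λ).det = 0) ∧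
    (∀ Λ : ℂ, (W.dispersionMatrix k M Λ).det
      = Λ ^ 2 + ((k * deriv W.c₀ k - W.c₀ k : ℝ) : ℂ) * Λ
        - ((k * W.c₀ k * deriv W.c₀ k + 6 * k * deriv W.q₀ k : ℝ) : ℂ)) ∧
    ((∃ Λ₁ Λ₂ : ℝ, Λ₁ ≠ Λ₂ ∧ W.IsDispersionRoot k M Λ₁ ∧ W.IsDispersionRoot k M Λ₂) ↔
      0 < W.Delta k) ∧
    -- any branch of eigenvalues and eigenvectors which has an expansion at `ν = 0`
    (∀ (lam : ℝ → ℂ) (u : ℝ → ℝ → ℂ) (lam₀ : ℂ) (u₀ u₁ : ℝ → ℂ) (C : ℝ),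
      ContDiff ℝ ∞ u₀ → ContDiff ℝ ∞ u₁ → u₀ ≠ 0 →
      (∀ᶠ ξ : ℝ in 𝓝[≠] 0,
        W.IsBlochEigenpair k M (Complex.I * ξ) (lam ξ) (u ξ) ∧
        ‖lam ξ - Complex.I * ξ * lam₀‖ ≤ C * ξ ^ 2 ∧
        ∀ j ≤ 4, ∀ x : ℝ,
          ‖iteratedDeriv j (fun y => u ξ y - (u₀ y + Complex.I * ξ * u₁ y)) x‖ ≤ C * ξ ^ 2) →
      ∃ κ m k₁ : ℂ, κ ≠ 0 ∧ W.IsWhithamMode k M (lam₀ / k) κ m ∧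
        u₀ = W.mode₀ k M κ ∧ u₁ = W.mode₁ k M κ m + W.mode₀ k M k₁) ∧
    -- all small eigenvalues, without any condition on `Δ`
    (∃ r > 0, ∃ C : ℝ, ∀ (ν lam : ℂ) (f : ℝ → ℂ), ν ≠ 0 → ‖ν‖ < r → ‖lam‖ < r →
      W.IsBlochEigenpair k M ν lam f →
      ‖(W.dispersionMatrix k M (lam / (ν * k))).det‖ ≤ C * ‖ν‖) ∧
    (∀ Λ : ℂ, W.IsDispersionRoot k M Λ → ∀ ε > 0, ∀ᶠ ν : ℂ in 𝓝 0,
      ∃ (lam : ℂ) (f : ℝ → ℂ), W.IsBlochEigenpair k M ν lam f ∧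
        ‖lam - ν * k * Λ‖ ≤ ε * ‖ν‖) ∧
    -- if `Δ ≠ 0`, the small eigenvalues and their eigenvectors form exactly two branches
    (W.Delta k ≠ 0 → ∃ r > 0, ∃ (C : ℝ) (lam : ℂ → ℂ → ℂ) (u : ℂ → ℂ → ℝ → ℂ),
      (∀ Λ : ℂ, W.IsDispersionRoot k M Λ →
        AnalyticOnNhd ℂ (lam Λ) (Metric.ball 0 r) ∧
        ∃ κ m : ℂ, κ ≠ 0 ∧ W.IsWhithamMode k M Λ κ m ∧
          ∀ ν : ℂ, ‖ν‖ < r →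
            W.IsBlochEigenpair k M ν (lam Λ ν) (u Λ ν) ∧
            ‖lam Λ ν - ν * k * Λ‖ ≤ C * ‖ν‖ ^ 2 ∧
            ∀ j ≤ 4, ∀ x : ℝ,
              ‖iteratedDeriv j
                (fun y => u Λ ν y - (W.mode₀ k M κ y + ν * W.mode₁ k M κ m y)) x‖
                ≤ C * ‖ν‖ ^ 2) ∧
      (∀ (ν l : ℂ) (f : ℝ → ℂ), ‖ν‖ < r → ‖l‖ < r → W.IsBlochEigenpair k M ν l f →
        ∃ Λ : ℂ, W.IsDispersionRoot k M Λ ∧ l = lam Λ ν ∧ ∃ a : ℂ, ∀ x, f x = a * u Λ ν x)) ∧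
    -- hyperbolicity is necessary for spectral stability
    (W.SpectrallyStable k M →
      (∀ Λ : ℂ, W.IsDispersionRoot k M Λ → Λ.im = 0) ∧ 0 ≤ W.Delta k) := by
  have hroots := W.im_eq_zero_of_spectrallyStable hδ hk hker
  exact ⟨fun k' hk' M' => W.avgFlux_eq hk' M', W.isWhithamMode_iff hk M,
    W.isDispersionRoot_iff hk M, W.det_dispersionMatrix hk M,
    W.exists_distinct_real_roots_iff hk M,
    fun lam u lam₀ u₀ u₁ C h₀ h₁ hne hu =>
      W.expansion_isWhithamMode hδ hk hker lam u lam₀ u₀ u₁ C h₀ h₁ hne hu,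
    W.exists_det_bound hδ hk hker,
    fun Λ hΛ ε hε => W.eventually_exists_near hδ hk hker Λ hΛ ε hε,
    W.exists_bloch_branches hδ hk hker,
    fun hst => ⟨hroots hst, W.delta_nonneg_of_roots_real hk M (hroots hst)⟩⟩
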